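/- **Setting.** Let $d\ge 1$, $\Omega=[0,2\pi)^d$ with periodic boundary conditions, $e_G(x)=(2\pi)^{-d/2}e^{\mathrm{i}G\cdot x}$ for $G\in\mathbb{Z}^d$, and $\hat u_G=(e_G,u)_{L^2}$. For $t\in\mathbb{R}$ let $H_p^t(\Omega)$ be the space of real periodic (generalized) functions $u=\sum_G\hat u_Ge_G$ (that is, $\hat u_{-G}=\overline{\hat u_G}$) with $\|u\|_{H_p^t}^2=\sum_G(1+|G|^2)^t|\hat u_G|^2<\infty$. Let $V\in H_p^\sigma(\Omega)$ with $\sigma>d/2$ and $0<\nu_*\le V\le\nu^*$; put $\alpha_*=\min(\nu_*,1)$, $\alpha^*=\max(\nu^*,1)$, $a(u,v)=(\nabla u,\nabla v)+(Vu,v)$ and $\|u\|_a=a(u,u)^{1/2}$ on $H_p^1(\Omega)$. For finite $\mathbb{G}=-\mathbb{G}\subset\mathbb{Z}^d$ with cardinality $|\mathbb{G}|$ let $V_{\mathbb{G}}=\operatorname{span}\{e_G:G\in\mathbb{G}\}\cap H_p^1(\Omega)$, let $\Pi_{\mathbb{G}}$ be the truncation of Fourier series to the frequencies in $\mathbb{G}$,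 and let $\mathbb{G}^M=\{G:|G|\le M\}$. Norms of tuples are Euclidean combinations of the norms of the entries. Let $0<\lambda_1\le\lambda_2\le\cdots$ be the eigenvalues, repeated according to multiplicity, of the problem $u\in H_p^1(\Omega)$, $a(u,v)=\lambda(u,v)$ for all $v\in H_p^1(\Omega)$, let $M(\lambda)$ be the eigenspace of $\lambda$, and set $\lambda_0=0$. Fix a cluster $\lambda_{k_0}<\lambda_{k_0+1}\le\cdots\le\lambda_{k_0+N}<\lambda_{k_0+N+1}$, $N\ge1$, with distinct values $\lambda_{(1)}<\cdots<\lambda_{(m)}$ of multiplicities $q_1,\dots,q_m$, $N=\sum_iq_i$, and $k_i=\sum_{j<i}q_j$. Let $\lambda_{\mathbb{G},l}$ be the $(k_0+l)$-th eigenvalue of the same problem posed in $V_{\mathbb{G}}$ instead of $H_p^1(\Omega)$. Let $K_{\mathbb{G}}:L^2\to\operatorname{span}\{e_G:G\in\mathbb{G}\}$ (complex-valued functions) be given by $a(K_{\mathbb{G}}w,v)=(w,v)$ for all $v\in V_{\mathbb{G}}$. For each $i$ fix a circle $\Gamma_i$ centred at $\lambda_{(i)}^{-1}$ such that $\mu^{-1}$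 lies strictly outside $\Gamma_i$ for every eigenvalue $\mu\ne\lambda_{(i)}$, and put $E_{\mathbb{G},i}=\frac1{2\pi\mathrm{i}}\oint_{\Gamma_i}(z-K_{\mathbb{G}})^{-1}dz$. For $U=(U_1,\dots,U_m)$ with $U_i=(u_{k_i+1},\dots,u_{k_i+q_i})$ let $\mathscr{E}_{\mathbb{G}}U=(E_{\mathbb{G},1}U_1,\dots,E_{\mathbb{G},m}U_m)$, each $E_{\mathbb{G},i}$ acting entrywise. **Approximation class.** Given $\mathbb{G}_0$ and $s>0$, $\mathcal{A}^s$ consists of all $v\in H_p^1(\Omega)$ with $$|v|_s=\sup_{\varepsilon>0}\ \varepsilon\inf\Bigl\{(|\mathbb{G}|-|\mathbb{G}_0|)^s:\ \mathbb{G}\text{ finite},\ \mathbb{G}_0\subset\mathbb{G}=-\mathbb{G},\ \inf_{w\in V_{\mathbb{G}}}\|v-w\|_a\le\varepsilon\Bigr\}<\infty.$$ **Algorithm.** With parameters $\tilde\theta\in(0,1)$, $\zeta\in(0,\tilde\theta)$, $tol\in[0,1)$, $M_0\in\mathbb{N}$, start from $\mathbb{G}_0=\mathbb{G}^{M_0}$.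 At step $n$, compute $L^2$-orthonormal eigenfunctions $u_{\mathbb{G}_n,l}\in V_{\mathbb{G}_n}$ for $\lambda_{\mathbb{G}_n,l}$, $l=1,\dots,N$, with residuals $r_l=\lambda_{\mathbb{G}_n,l}u_{\mathbb{G}_n,l}+\Delta u_{\mathbb{G}_n,l}-Vu_{\mathbb{G}_n,l}$, and choose any $\tilde r=(\tilde r_1,\dots,\tilde r_N)\in(H_p^{-1})^N$ with $\|\tilde r-r\|_{H_p^{-1}}\le\zeta\|\tilde r\|_{H_p^{-1}}$. Stop if $\|\tilde r\|_{H_p^{-1}}<tol/(1+\zeta)$. Otherwise choose a finite set $\delta\mathbb{G}_n=-\delta\mathbb{G}_n\subset\mathbb{Z}^d\setminus\mathbb{G}_n$ with $\|\Pi_{\delta\mathbb{G}_n}\tilde r\|_{H_p^{-1}}\ge\tilde\theta\|\tilde r\|_{H_p^{-1}}$ and put $\mathbb{G}_{n+1}=\mathbb{G}_n\cup\delta\mathbb{G}_n$. The marking is called minimal if every $\delta\mathbb{G}_n$ has the least cardinality among all such sets. **Theorem.** Let $s>0$, let $$0<\tilde\theta<\theta_*:=\sqrt{\frac{\alpha_*}{3\alpha^*}},\qquad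 0<\zeta<\frac{\theta_*-\tilde\theta}{1+\theta_*},\qquad \zeta<\tilde\theta.$$ There are $M_*\in\mathbb{N}$ and $C>0$ such that for every $M_0\ge M_*$ the following holds. If $M(\lambda_{(i)})\subset\mathcal{A}^s$ for $i=1,\dots,m$ (with $\mathbb{G}_0=\mathbb{G}^{M_0}$), then for all $L^2$-orthonormal bases $\{u_{k_i+l}\}_{l=1}^{q_i}$ of $M(\lambda_{(i)})$, $i=1,\dots,m$, with $U=(u_1,\dots,u_N)$, every run of the algorithm with minimal marking, and every iterate $n$ that it reaches and for which $|\mathbb{G}_n|>|\mathbb{G}_0|$, $$\|U-\mathscr{E}_{\mathbb{G}_n}U\|_a\le C(|\mathbb{G}_n|-|\mathbb{G}_0|)^{-s},$$ $$\lambda_{\mathbb{G}_n,k_i+l}-\lambda_{(i)}\le C(|\mathbb{G}_n|-|\mathbb{G}_0|)^{-2s},\qquad l=1,\dots,q_i,\ i=1,\dots,m.$$ -/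

import Mathlib

open MeasureTheory Real
open scoped ENNReal ComplexConjugate

noncomputable section

namespace PlaneWave

instance factTwoPiPos : Fact (0 < 2 * π) := ⟨Real.two_pi_pos⟩

/-- The period cell `Ω = [0, 2π)^d` with periodic identification. Its measure is the product of the
Lebesgue measures of total mass `2π`. -/
abbrev Torus (d : ℕ) : Type := Fin d → AddCircle (2 * π)

/-- Frequencies `G ∈ ℤ^d`. -/
abbrev Freq (d : ℕ) : Type := Fin d → ℤ

/-- Complex-valued `2π`-periodic square integrable functions, with the inner product
`(u, v) = ∫_Ω conj u * v`. Real-valued functions are singled out below. -/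
abbrev L2 (d : ℕ) : Type := Lp ℂ 2 (volume : Measure (Torus d))

variable {d : ℕ}

/-- `|G|²`, the squared Euclidean norm. -/
def normSq (G : Freq d) : ℝ := ∑ j, (G j : ℝ) ^ 2

lemma normSq_nonneg (G : Freq d) : 0 ≤ normSq G := Finset.sum_nonneg fun _ _ => sq_nonneg _

/-- `e_G(x) = (2π)^{-d/2} exp(i G·x)`. -/
def planewave (G : Freq d) : C(Torus d, ℂ) where
  toFun x := ((((2 * π) ^ (-(d : ℝ) / 2) : ℝ)) : ℂ) * ∏ j, fourier (G j) (x j)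

/-- `e_G` as an element of `L²`. -/
def planewaveL2 (G : Freq d) : L2 d := ContinuousMap.toLp 2 volume ℂ (planewave G)

/-- The Fourier coefficient `(e_G, f) = (2π)^{-d/2} ∫_Ω f(x) exp(-i G·x) dx`. -/
def fourierCoef (f : Torus d → ℂ) (G : Freq d) : ℂ := ∫ x, conj (planewave G x) * f x

/-! ### Sobolev spaces of real-valued periodic functions -/

/-- `H_p^s`, `s ∈ ℝ`, as the space of families of Fourier coefficients `c` with
`∑ (1 + |G|²)^s |c_G|² < ∞` and `c_{-G} = conj c_G` (real-valuedness). -/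
def Hp (d : ℕ) (s : ℝ) : Submodule ℝ (Freq d → ℂ) where
  carrier := {c | Summable (fun G => (1 + normSq G) ^ s * ‖c G‖ ^ 2) ∧ ∀ G, c (-G) = conj (c G)}
  zero_mem' := by simp [summable_zero]
  add_mem' := by
    rintro a b ⟨ha, ha'⟩ ⟨hb, hb'⟩
    refine ⟨?_, fun G => by simp [ha' G, hb' G]⟩
    refine Summable.of_nonneg_of_le (fun G => ?_) (fun G => ?_) ((ha.add hb).mul_left 2)
    · have := normSq_nonneg G
      positivity
    · have h0 := normSq_nonneg G
      have h1 : ‖(a + b) G‖ ^ 2 ≤ 2 * (‖a G‖ ^ 2 + ‖b G‖ ^ 2) := by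
        have := norm_add_le (a G) (b G)
        have h2 : ‖(a + b) G‖ ^ 2 ≤ (‖a G‖ + ‖b G‖) ^ 2 := by
          gcongr
          exact this
        nlinarith [sq_nonneg (‖a G‖ - ‖b G‖)]
      have h3 : 0 ≤ (1 + normSq G) ^ s := by positivity
      calc _ ≤ (1 + normSq G) ^ s * (2 * (‖a G‖ ^ 2 + ‖b G‖ ^ 2)) := by gcongr
        _ = _ := by ring
  smul_mem' := by
    rintro r a ⟨ha, ha'⟩
    refine ⟨?_, fun G => by simp [ha' G]⟩
    refine (ha.mul_left (r ^ 2)).congr fun G => ?_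
    rw [Pi.smul_apply, norm_smul, mul_pow, Real.norm_eq_abs, sq_abs]
    ring

/-- The norm of `H_p^s` of a finite tuple of coefficient families,
`‖(c_1, …, c_N)‖² = ∑_l ∑_G (1 + |G|²)^s |c_{l,G}|²`. -/
def hpNorm {ι : Type*} [Fintype ι] (s : ℝ) (c : ι → Freq d → ℂ) : ℝ :=
  √(∑ l, ∑' G, (1 + normSq G) ^ s * ‖c l G‖ ^ 2)

/-- `Π_S` on coefficient families: keep the frequencies in `S`. -/
def proj {ι : Type*} (S : Set (Freq d)) (c : ι → Freq d → ℂ) : ι → Freq d → ℂ :=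
  fun l => S.indicator (c l)

lemma fourierCoef_eq_inner (u : L2 d) (G : Freq d) :
    fourierCoef u G = inner ℂ (planewaveL2 G) u := by
  rw [L2.inner_def, fourierCoef]
  refine integral_congr_ae ?_
  filter_upwards [ContinuousMap.coeFn_toLp (p := 2) (𝕜 := ℂ) volume (planewave G)] with x hx
  simp only [planewaveL2, hx, RCLike.inner_apply]
  ring

/-- The map taking `u ∈ L²` to its family of Fourier coefficients. -/
def coefMap (d : ℕ) : L2 d →ₗ[ℂ] (Freq d → ℂ) where
  toFun u := fourierCoef u
  map_add' u v := by
    funext G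
    simp only [fourierCoef_eq_inner, Pi.add_apply, inner_add_right]
  map_smul' c u := by
    funext G
    simp only [fourierCoef_eq_inner, Pi.smul_apply, inner_smul_right, RingHom.id_apply, smul_eq_mul]

/-- `H_p^1(Ω)`, as a space of (real-valued) functions. -/
def H1 (d : ℕ) : Submodule ℝ (L2 d) := (Hp d 1).comap ((coefMap d).restrictScalars ℝ)

/-- `V_𝔾 = span {e_G : G ∈ 𝔾} ∩ H_p^1(Ω)`. -/
def VG (𝔾 : Finset (Freq d)) : Submodule ℝ (L2 d) :=
  (Submodule.span ℂ (planewaveL2 '' (𝔾 : Set (Freq d)))).restrictScalars ℝ ⊓ H1 d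

/-- `𝔾 = -𝔾`. -/
def IsSymm (𝔾 : Finset (Freq d)) : Prop := ∀ G, G ∈ 𝔾 ↔ -G ∈ 𝔾

/-- `𝔾^M = {G ∈ ℤ^d : |G| ≤ M}`. -/
def ballFreq (d M : ℕ) : Finset (Freq d) :=
  (Fintype.piFinset fun _ => Finset.Icc (-(M : ℤ)) M).filter fun G => ∑ j, G j ^ 2 ≤ (M : ℤ) ^ 2

lemma mem_ballFreq {M : ℕ} {G : Freq d} : G ∈ ballFreq d M ↔ √(normSq G) ≤ M := by
  rw [Real.sqrt_le_left (Nat.cast_nonneg M), ballFreq, Finset.mem_filter, Fintype.mem_piFinset]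
  have key : (∑ j, G j ^ 2 ≤ (M : ℤ) ^ 2) ↔ normSq G ≤ (M : ℝ) ^ 2 := by
    rw [normSq]
    exact_mod_cast Iff.rfl
  rw [key]
  refine ⟨fun h => h.2, fun h => ⟨fun j => ?_, h⟩⟩
  rw [← key] at h
  have hj : G j ^ 2 ≤ (M : ℤ) ^ 2 :=
    (Finset.single_le_sum (f := fun j => G j ^ 2) (fun _ _ => sq_nonneg _) (Finset.mem_univ j)).trans h
  rw [Finset.mem_Icc, ← abs_le]
  exact abs_le_of_sq_le_sq hj (by positivity)

/-! ### The bilinear form and the eigenvalue problem -/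

/-- `a(u, v) = (∇u, ∇v) + (V u, v)`; the first term is written on the Fourier side, where
`∂_j u = ∑_G i G_j û_G e_G`. -/
def energy (V : C(Torus d, ℝ)) (u v : L2 d) : ℂ :=
  (∑' G, (normSq G : ℂ) * (conj (fourierCoef u G) * fourierCoef v G)) +
    ∫ x, (V x : ℂ) * (conj (u x) * v x)

/-- `‖u‖_a = a(u, u)^{1/2}`. -/
def energyNorm (V : C(Torus d, ℝ)) (u : L2 d) : ℝ := √(energy V u u).re

lemma summable_energy {u v : L2 d} (hu : u ∈ H1 d) (hv : v ∈ H1 d) :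
    Summable fun G => (normSq G : ℂ) * (conj (fourierCoef u G) * fourierCoef v G) := by
  refine Summable.of_norm_bounded (hu.1.add hv.1) fun G => ?_
  have h0 := normSq_nonneg G
  change _ ≤ (1 + normSq G) ^ (1 : ℝ) * ‖fourierCoef u G‖ ^ 2 +
    (1 + normSq G) ^ (1 : ℝ) * ‖fourierCoef v G‖ ^ 2
  rw [Real.rpow_one, norm_mul, norm_mul, Complex.norm_real, Real.norm_of_nonneg h0,
    RCLike.norm_conj]
  have h1 : ‖fourierCoef u G‖ * ‖fourierCoef v G‖ ≤
      ‖fourierCoef u G‖ ^ 2 + ‖fourierCoef v G‖ ^ 2 := by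
    nlinarith [sq_nonneg (‖fourierCoef u G‖ - ‖fourierCoef v G‖), sq_nonneg ‖fourierCoef u G‖,
      sq_nonneg ‖fourierCoef v G‖]
  have h2 : 0 ≤ ‖fourierCoef u G‖ ^ 2 + ‖fourierCoef v G‖ ^ 2 := by positivity
  nlinarith

lemma integrable_potential (V : C(Torus d, ℝ)) (u v : L2 d) :
    Integrable fun x => (V x : ℂ) * (conj (u x) * v x) := by
  have h : Integrable fun x => conj (u x) * v x := by
    refine (L2.integrable_inner (𝕜 := ℂ) u v).congr (Filter.Eventually.of_forall fun x => ?_)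
    simp only [RCLike.inner_apply]
    ring
  refine h.bdd_mul (c := ‖V‖) (by fun_prop) (Filter.Eventually.of_forall fun x => ?_)
  rw [Complex.norm_real]
  exact V.norm_coe_le_norm x

lemma energy_add_left_aux (V : C(Torus d, ℝ)) {u u' v : L2 d}
    (hu : Summable fun G => (normSq G : ℂ) * (conj (fourierCoef u G) * fourierCoef v G))
    (hu' : Summable fun G => (normSq G : ℂ) * (conj (fourierCoef u' G) * fourierCoef v G)) :
    energy V (u + u') v = energy V u v + energy V u' v := by
  have h1 : ∀ G, fourierCoef (u + u' : L2 d) G = fourierCoef u G + fourierCoef u' G := fun G => by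
    simp only [fourierCoef_eq_inner, inner_add_right]
  have h2 : ∫ x, (V x : ℂ) * (conj ((u + u' : L2 d) x) * v x) =
      (∫ x, (V x : ℂ) * (conj (u x) * v x)) + ∫ x, (V x : ℂ) * (conj (u' x) * v x) := by
    rw [← integral_add (integrable_potential V u v) (integrable_potential V u' v)]
    refine integral_congr_ae ?_
    filter_upwards [Lp.coeFn_add u u'] with x hx
    simp only [hx, Pi.add_apply, map_add]
    ring
  have h3 := hu.tsum_add hu'
  simp only [energy, h1, h2, map_add, add_mul, mul_add] at h3 ⊢
  rw [h3]
  ring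

lemma energy_add_left (V : C(Torus d, ℝ)) {u u' v : L2 d} (hu : u ∈ H1 d) (hu' : u' ∈ H1 d)
    (hv : v ∈ H1 d) : energy V (u + u') v = energy V u v + energy V u' v :=
  energy_add_left_aux V (summable_energy hu hv) (summable_energy hu' hv)

lemma energy_smul_left (V : C(Torus d, ℝ)) (c : ℂ) (u v : L2 d) :
    energy V (c • u) v = conj c * energy V u v := by
  have h1 : ∀ G, fourierCoef (c • u : L2 d) G = c * fourierCoef u G := fun G => by
    simp only [fourierCoef_eq_inner, inner_smul_right]
  have h2 : ∫ x, (V x : ℂ) * (conj ((c • u : L2 d) x) * v x) =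
      conj c * ∫ x, (V x : ℂ) * (conj (u x) * v x) := by
    rw [← integral_const_mul]
    refine integral_congr_ae ?_
    filter_upwards [Lp.coeFn_smul c u] with x hx
    simp only [hx, Pi.smul_apply, smul_eq_mul, map_mul]
    ring
  simp only [energy, h1, h2, map_mul, mul_add, ← tsum_mul_left]
  congr 2
  funext G
  ring

/-- For `W ⊆ H_p^1(Ω)`, the space of all `u ∈ W` with `a(u, v) = μ (u, v)` for all `v ∈ W`
(the intersections with `H_p^1(Ω)` are immaterial for such `W`). With `W = H_p^1(Ω)` this is `M(μ)`,
with `W = V_𝔾` it is the eigenspace of the planewave discretization. -/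
def eigenspace (V : C(Torus d, ℝ)) (W : Submodule ℝ (L2 d)) (μ : ℝ) : Submodule ℝ (L2 d) where
  carrier := {u | u ∈ W ⊓ H1 d ∧ ∀ v ∈ W ⊓ H1 d, energy V u v = μ * inner ℂ u v}
  zero_mem' := by
    refine ⟨zero_mem _, fun v _ => ?_⟩
    simpa using energy_smul_left V 0 0 v
  add_mem' := by
    rintro u u' ⟨hu, h⟩ ⟨hu', h'⟩
    refine ⟨add_mem hu hu', fun v hv => ?_⟩
    rw [energy_add_left V hu.2 hu'.2 hv.2, h v hv, h' v hv, inner_add_left, mul_add]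
  smul_mem' := by
    rintro r u ⟨hu, h⟩
    refine ⟨Submodule.smul_mem _ _ hu, fun v hv => ?_⟩
    have hr : r • u = (r : ℂ) • u := (Complex.coe_smul r u).symm
    rw [hr, energy_smul_left, h v hv, inner_smul_left]
    ring

/-- The number, counted with multiplicity, of eigenvalues at most `μ`. -/
def eigenCount (V : C(Torus d, ℝ)) (W : Submodule ℝ (L2 d)) (μ : ℝ) : ℕ :=
  Module.finrank ℝ ↥(⨆ ν : Set.Iic μ, eigenspace V W ν)

/-- The `k`-th eigenvalue (`k = 1, 2, …`) in increasing order, repeated according to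
multiplicity. -/
def eigenvalue (V : C(Torus d, ℝ)) (W : Submodule ℝ (L2 d)) (k : ℕ) : ℝ :=
  sInf {μ : ℝ | k ≤ eigenCount V W μ}

/-- A cluster `λ_{k₀} < λ_{k₀+1} ≤ … ≤ λ_{k₀+N} < λ_{k₀+N+1}` (with `λ_0 = 0`) of eigenvalues,
whose distinct values are `Λ 0 < … < Λ (m-1)` with multiplicities `q i`. -/
structure IsCluster (V : C(Torus d, ℝ)) (k₀ N m : ℕ) (Λ : Fin m → ℝ) (q : Fin m → ℕ) : Prop where
  pos : 0 < N
  gap_left : (if k₀ = 0 then 0 else eigenvalue V (H1 d) k₀) < eigenvalue V (H1 d) (k₀ + 1)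
  gap_right : eigenvalue V (H1 d) (k₀ + N) < eigenvalue V (H1 d) (k₀ + N + 1)
  strictMono : StrictMono Λ
  range_eq : Set.range Λ = {μ | ∃ j ∈ Finset.Icc 1 N, μ = eigenvalue V (H1 d) (k₀ + j)}
  mult : ∀ i, q i = Module.finrank ℝ (eigenspace V (H1 d) (Λ i))
  sum_mult : N = ∑ i, q i

/-- `k_i`, the sum of the multiplicities of the earlier distinct eigenvalues. -/
def offset {m : ℕ} (q : Fin m → ℕ) (i : Fin m) : ℕ := ∑ j ∈ Finset.univ.filter (· < i), q j

/-! ### The discrete solution operator and the spectral projections -/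

/-- The Galerkin matrix `a(e_P, e_Q)`, `P, Q ∈ 𝔾`. -/
def stiffness (V : C(Torus d, ℝ)) (𝔾 : Finset (Freq d)) : Matrix 𝔾 𝔾 ℂ :=
  Matrix.of fun P Q => energy V (planewaveL2 (P : Freq d)) (planewaveL2 (Q : Freq d))

/-- The discrete solution operator `K_𝔾` on `L²`, determined by `K_𝔾 w ∈ span {e_G : G ∈ 𝔾}` and
`a(v, K_𝔾 w) = (v, w)` for all `v` in that span (see `galerkin_spec`). -/
def galerkin (V : C(Torus d, ℝ)) (𝔾 : Finset (Freq d)) : L2 d →L[ℂ] L2 d :=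
  ∑ P : 𝔾, ∑ Q : 𝔾, (stiffness V 𝔾)⁻¹ P Q •
    (innerSL ℂ (planewaveL2 (Q : Freq d))).smulRight (planewaveL2 (P : Freq d))

lemma integral_fourier (n : ℤ) :
    ∫ x : AddCircle (2 * π), fourier n x = if n = 0 then ((2 * π : ℝ) : ℂ) else 0 := by
  split_ifs with hn
  · subst hn
    simp [Measure.real, AddCircle.measure_univ, Real.pi_pos.le]
  · exact integral_eq_zero_of_add_right_eq_neg (fourier_add_half_inv_index hn Real.two_pi_pos)

lemma inner_planewave (P Q : Freq d) :
    inner ℂ (planewaveL2 P) (planewaveL2 Q) = if P = Q then 1 else 0 := by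
  have h0 : ∀ x : Torus d, planewave Q x * conj (planewave P x) =
      ((((2 * π) ^ (-(d : ℝ)) : ℝ)) : ℂ) * ∏ j, fourier (Q j - P j) (x j) := fun x => by
    have h1 : ((((2 * π) ^ (-(d : ℝ)) : ℝ)) : ℂ) = (((2 * π) ^ (-(d : ℝ) / 2) : ℝ) : ℂ) *
        (((2 * π) ^ (-(d : ℝ) / 2) : ℝ) : ℂ) := by
      rw [← Complex.ofReal_mul, ← Real.rpow_add Real.two_pi_pos]
      congr 2
      ring
    have h2 : ∀ j, fourier (Q j - P j) (x j) = fourier (Q j) (x j) * conj (fourier (P j) (x j)) :=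
      fun j => by rw [sub_eq_add_neg, fourier_add, fourier_neg]
    simp only [planewave, ContinuousMap.coe_mk, map_mul, map_prod, Complex.conj_ofReal, h1, h2,
      Finset.prod_mul_distrib]
    ring
  rw [planewaveL2, planewaveL2, ContinuousMap.inner_toLp]
  simp only [h0]
  rw [integral_const_mul, integral_fintype_prod_volume_eq_prod
    (fun j (y : AddCircle (2 * π)) => fourier (Q j - P j) y)]
  simp only [integral_fourier, sub_eq_zero]
  split_ifs with h
  · subst h
    simp only [if_true, Finset.prod_const, Finset.card_univ, Fintype.card_fin]
    rw [← Complex.ofReal_pow, ← Complex.ofReal_mul, ← Real.rpow_natCast,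
      ← Real.rpow_add Real.two_pi_pos]
    simp
  · obtain ⟨j, hj⟩ := Function.ne_iff.1 h
    rw [Finset.prod_eq_zero (Finset.mem_univ j) (if_neg (Ne.symm hj)), mul_zero]

lemma fourierCoef_sum (𝔾 : Finset (Freq d)) (x : 𝔾 → ℂ) (G : Freq d) :
    fourierCoef (∑ P : 𝔾, x P • planewaveL2 (P : Freq d) : L2 d) G =
      if h : G ∈ 𝔾 then x ⟨G, h⟩ else 0 := by
  rw [fourierCoef_eq_inner, inner_sum]
  simp only [inner_smul_right, inner_planewave]
  split_ifs with h
  · rw [Finset.sum_eq_single ⟨G, h⟩]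
    · simp
    · intro P _ hP
      rw [if_neg, mul_zero]
      rintro rfl
      exact hP rfl
    · simp
  · refine Finset.sum_eq_zero fun P _ => ?_
    rw [if_neg, mul_zero]
    rintro rfl
    exact h P.2

lemma energy_sum_left (V : C(Torus d, ℝ)) {ι : Type*} (S : Finset ι) (P : ι → Freq d) (x : ι → ℂ)
    (v : L2 d) : energy V (∑ i ∈ S, x i • planewaveL2 (P i)) v =
      ∑ i ∈ S, conj (x i) * energy V (planewaveL2 (P i)) v := by
  classical
  have hs : ∀ S : Finset ι, Summable fun G => (normSq G : ℂ) *
      (conj (fourierCoef (∑ i ∈ S, x i • planewaveL2 (P i) : L2 d) G) * fourierCoef v G) := by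
    intro S
    refine summable_of_ne_finset_zero (s := S.image P) fun G hG => ?_
    rw [fourierCoef_eq_inner, inner_sum, Finset.sum_eq_zero, map_zero, zero_mul, mul_zero]
    intro i hi
    rw [inner_smul_right, inner_planewave, if_neg, mul_zero]
    rintro rfl
    exact hG (Finset.mem_image_of_mem P hi)
  induction S using Finset.induction_on with
  | empty => simpa using energy_smul_left V 0 0 v
  | insert i S hi ih =>
    rw [Finset.sum_insert hi, Finset.sum_insert hi, energy_add_left_aux V _ (hs S), ih,
      energy_smul_left]
    simpa using hs {i}

lemma energy_symm (V : C(Torus d, ℝ)) (u v : L2 d) : energy V v u = conj (energy V u v) := by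
  rw [energy, energy, map_add, Complex.conj_tsum, ← integral_conj]
  congr 1
  · refine tsum_congr fun G => ?_
    simp only [map_mul, Complex.conj_ofReal, Complex.conj_conj]
    ring
  · congr 1
    funext x
    simp only [map_mul, Complex.conj_ofReal, Complex.conj_conj]
    ring

lemma eq_zero_of_energy_eq_zero {V : C(Torus d, ℝ)} (hV : ∀ x, 0 < V x) {u : L2 d}
    (h : energy V u u = 0) : u = 0 := by
  have e1 : ∀ z : ℂ, conj z * z = ((‖z‖ ^ 2 : ℝ) : ℂ) := fun z => by
    rw [← Complex.normSq_eq_conj_mul_self, Complex.normSq_eq_norm_sq]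
  simp only [energy, e1, ← Complex.ofReal_mul, ← Complex.ofReal_tsum] at h
  rw [integral_complex_ofReal, ← Complex.ofReal_add, Complex.ofReal_eq_zero] at h
  have h1 : 0 ≤ ∑' G, normSq G * ‖fourierCoef u G‖ ^ 2 :=
    tsum_nonneg fun G => mul_nonneg (normSq_nonneg G) (sq_nonneg _)
  have h2 : 0 ≤ fun x => V x * ‖u x‖ ^ 2 := fun x => mul_nonneg (hV x).le (sq_nonneg _)
  have h3 : ∫ x, V x * ‖u x‖ ^ 2 = 0 := le_antisymm (by linarith) (integral_nonneg h2)
  have h4 : Integrable fun x => V x * ‖u x‖ ^ 2 := by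
    have := (integrable_potential V u u).re
    refine this.congr (Filter.Eventually.of_forall fun x => ?_)
    simp only [e1, ← Complex.ofReal_mul]
    rfl
  rw [integral_eq_zero_iff_of_nonneg h2 h4] at h3
  rw [Lp.eq_zero_iff_ae_eq_zero]
  filter_upwards [h3] with x hx
  have hx' : V x * ‖u x‖ ^ 2 = 0 := hx
  simpa [(hV x).ne'] using hx'

lemma isUnit_stiffness {V : C(Torus d, ℝ)} (hV : ∀ x, 0 < V x) (𝔾 : Finset (Freq d)) :
    IsUnit (stiffness V 𝔾).det := by
  rw [isUnit_iff_ne_zero]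
  intro hdet
  obtain ⟨x, hx, hAx⟩ := Matrix.exists_mulVec_eq_zero_iff.2 hdet
  have h0 : energy V (∑ P : 𝔾, x P • planewaveL2 (P : Freq d))
      (∑ P : 𝔾, x P • planewaveL2 (P : Freq d)) = 0 := by
    rw [energy_sum_left]
    refine Finset.sum_eq_zero fun P _ => ?_
    rw [energy_symm, energy_sum_left, map_sum]
    have hP := congrFun hAx P
    simp only [Matrix.mulVec, dotProduct, stiffness, Matrix.of_apply, Pi.zero_apply] at hP
    simp only [map_mul, Complex.conj_conj, ← energy_symm]
    simp only [mul_comm (x _), hP, mul_zero]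
  have h1 := eq_zero_of_energy_eq_zero hV h0
  refine hx (funext fun P => ?_)
  have h2 := fourierCoef_sum 𝔾 x P
  rw [h1, dif_pos P.2, fourierCoef_eq_inner, inner_zero_right] at h2
  exact h2.symm

lemma galerkin_apply (V : C(Torus d, ℝ)) (𝔾 : Finset (Freq d)) (w : L2 d) :
    galerkin V 𝔾 w = ∑ P : 𝔾, ((stiffness V 𝔾)⁻¹.mulVec
      fun Q : 𝔾 => fourierCoef w (Q : Freq d)) P • planewaveL2 (P : Freq d) := by
  simp only [galerkin, _root_.sum_apply, _root_.smul_apply,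
    ContinuousLinearMap.smulRight_apply, innerSL_apply_apply, Matrix.mulVec, dotProduct,
    fourierCoef_eq_inner, Finset.sum_smul, smul_smul]

/-- `K_𝔾` is the discrete solution operator. -/
theorem galerkin_spec {V : C(Torus d, ℝ)} (hV : ∀ x, 0 < V x) (𝔾 : Finset (Freq d)) (w : L2 d) :
    galerkin V 𝔾 w ∈ Submodule.span ℂ (planewaveL2 '' (𝔾 : Set (Freq d))) ∧
      ∀ v ∈ Submodule.span ℂ (planewaveL2 '' (𝔾 : Set (Freq d))),
        energy V v (galerkin V 𝔾 w) = inner ℂ v w := by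
  rw [galerkin_apply]
  refine ⟨Submodule.sum_mem _ fun P _ => Submodule.smul_mem _ _
    (Submodule.subset_span ⟨P, P.2, rfl⟩), fun v hv => ?_⟩
  have hbase : ∀ R : 𝔾, energy V (planewaveL2 (R : Freq d)) (∑ P : 𝔾, ((stiffness V 𝔾)⁻¹.mulVec
      fun Q : 𝔾 => fourierCoef w (Q : Freq d)) P • planewaveL2 (P : Freq d)) =
        inner ℂ (planewaveL2 (R : Freq d)) w := fun R => by
    rw [energy_symm, energy_sum_left, map_sum, ← fourierCoef_eq_inner]
    simp only [map_mul, Complex.conj_conj, ← energy_symm]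
    have h := congrFun (Matrix.mulVec_mulVec (fun Q : 𝔾 => fourierCoef w (Q : Freq d))
      (stiffness V 𝔾) (stiffness V 𝔾)⁻¹) R
    rw [Matrix.mul_nonsing_inv _ (isUnit_stiffness hV 𝔾), Matrix.one_mulVec] at h
    rw [← h]
    simp only [Matrix.mulVec, dotProduct, stiffness, Matrix.of_apply]
    exact Finset.sum_congr rfl fun _ _ => mul_comm _ _
  obtain ⟨x, rfl⟩ : ∃ x : 𝔾 → ℂ, ∑ P : 𝔾, x P • planewaveL2 (P : Freq d) = v := by
    rw [Set.image_eq_range, Submodule.mem_span_range_iff_exists_fun] at hv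
    exact hv
  rw [energy_sum_left, sum_inner]
  simp only [hbase, inner_smul_left]

/-- The spectral projection `(2πi)⁻¹ ∮_Γ (z - K_𝔾)⁻¹ dz`, where `Γ` is the circle with centre `μ⁻¹`
and radius `r`. -/
def spectralProj (V : C(Torus d, ℝ)) (𝔾 : Finset (Freq d)) (μ r : ℝ) : L2 d →L[ℂ] L2 d :=
  (2 * π * Complex.I : ℂ)⁻¹ • ∮ z in C(((μ⁻¹ : ℝ) : ℂ), r), resolvent (galerkin V 𝔾) z

/-- `‖U - ℰ_𝔾 U‖_a` for `U = (u_{i,l})`, where `ℰ_𝔾` acts on the `i`-th block by the spectral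
projection for the circle with centre `(Λ i)⁻¹` and radius `r i`. -/
def projError (V : C(Torus d, ℝ)) {m : ℕ} (Λ r : Fin m → ℝ) {q : Fin m → ℕ}
    (U : (i : Fin m) → Fin (q i) → L2 d) (𝔾 : Finset (Freq d)) : ℝ :=
  √(∑ i, ∑ l, energyNorm V (U i l - spectralProj V 𝔾 (Λ i) (r i) (U i l)) ^ 2)

/-! ### The approximation class -/

/-- `inf_{v ∈ V_𝔾} ‖u - v‖_a`. -/
def bestError (V : C(Torus d, ℝ)) (u : L2 d) (𝔾 : Finset (Freq d)) : ℝ :=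
  ⨅ v : VG 𝔾, energyNorm V (u - v)

/-- `|u|_s = sup_{ε > 0} ε inf (|𝔾| - |𝔾₀|)^s`, the infimum over all finite symmetric `𝔾 ⊇ 𝔾₀` with
`inf_{v ∈ V_𝔾} ‖u - v‖_a ≤ ε`. -/
def approxSeminorm (V : C(Torus d, ℝ)) (𝔾₀ : Finset (Freq d)) (s : ℝ) (u : L2 d) : ℝ≥0∞ :=
  ⨆ (ε : ℝ) (_ : 0 < ε), ENNReal.ofReal ε *
    ⨅ (𝔾 : Finset (Freq d)) (_ : 𝔾₀ ⊆ 𝔾 ∧ IsSymm 𝔾 ∧ bestError V u 𝔾 ≤ ε),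
      ENNReal.ofReal (((𝔾.card : ℝ) - 𝔾₀.card) ^ s)

/-- The class `𝒜^s`. -/
def approxClass (V : C(Torus d, ℝ)) (𝔾₀ : Finset (Freq d)) (s : ℝ) : Set (L2 d) :=
  {u | u ∈ H1 d ∧ approxSeminorm V 𝔾₀ s u < ∞}

/-! ### The feasible adaptive planewave algorithm -/

/-- The Fourier coefficients of the residual `r = μ u + Δu - V u`. -/
def residual (V : C(Torus d, ℝ)) (μ : ℝ) (u : L2 d) (G : Freq d) : ℂ :=
  μ * fourierCoef u G - normSq G * fourierCoef u G - fourierCoef (fun x => (V x : ℂ) * u x) G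

/-- `δ` is an admissible output of Dörfler marking with parameter `θ` for the estimator
`S ↦ ‖Π_S r‖_{H_p^{-1}}`. -/
def IsDorfler {N : ℕ} (r : Fin N → Freq d → ℂ) (θ : ℝ) (𝔾 δ : Finset (Freq d)) : Prop :=
  Disjoint δ 𝔾 ∧ IsSymm δ ∧ θ * hpNorm (-1) r ≤ hpNorm (-1) (proj (δ : Set (Freq d)) r)

/-- The data recorded during `n` steps of the feasible adaptive planewave algorithm: index sets
`𝔾 j`, discrete eigenfunctions `u j l`, approximate residuals `rt j l` (through their Fourier
coefficients), and marked sets `δ j`. The discrete eigenvalue belonging to `u j l` is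
the `(k₀ + l)`-th one. The parameters are `θ`, `ζ`, `tol`, `M₀`. -/
structure IsAdaptiveRun (V : C(Torus d, ℝ)) (k₀ N : ℕ) (θ ζ tol : ℝ) (M₀ n : ℕ)
    (𝔾 : ℕ → Finset (Freq d)) (u : ℕ → Fin N → L2 d) (rt : ℕ → Fin N → Freq d → ℂ)
    (δ : ℕ → Finset (Freq d)) : Prop where
  init : 𝔾 0 = ballFreq d M₀
  solve_orthonormal : ∀ j ≤ n, Orthonormal ℂ (u j)
  solve_mem : ∀ j ≤ n, ∀ l : Fin N,
    u j l ∈ eigenspace V (VG (𝔾 j)) (eigenvalue V (VG (𝔾 j)) (k₀ + l + 1))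
  approx_mem : ∀ j < n, ∀ l, rt j l ∈ Hp d (-1)
  approx_le : ∀ j < n,
    hpNorm (-1) (fun l : Fin N =>
        rt j l - residual V (eigenvalue V (VG (𝔾 j)) (k₀ + l + 1)) (u j l)) ≤
      ζ * hpNorm (-1) (rt j)
  not_stop : ∀ j < n, tol / (1 + ζ) ≤ hpNorm (-1) (rt j)
  mark : ∀ j < n, IsDorfler (rt j) θ (𝔾 j) (δ j)
  refine_eq : ∀ j < n, 𝔾 (j + 1) = 𝔾 j ∪ δ j

end PlaneWave

end

open PlaneWave

/-!
The eigenvalue problem is treated in the Hilbert space `EnergySpace`, that is, `H_p^1(Ω)` with the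
inner product `a(u, v)`, where it reads `⟪u, v⟫ = μ ⟪J u, J v⟫` with the inclusion `J` into `L²`. On
the orthogonal complement of `V_𝔾` the norm of `J` tends to zero as `𝔾` grows
(`exists_ball_norm_le`); so `J` is compact, the spectrum is discrete, and the min-max principle
(`finrank_le_finrank_eigSum`) compares the numbers of exact and discrete eigenvalues below a given
bound. Hence, for large `𝔾`, the discrete eigenvalues of the cluster converge from above, all others
stay away from it (`IsCluster.exists_clusterBasis`), and the contour integral `spectralProj` selects
the discrete eigenfunctions of one block (`IsGalerkinFamily.spectralProj_eq`). The Strang–Fix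
identity then gives the a priori bounds: the error of the spectral projection is of the order of the
distance `pwDist` of an eigenbasis `ψ` from `V_𝔾`, and the eigenvalue errors are of the order of its
square (`IsCluster.exists_error_bounds`). It remains to estimate `pwDist ψ (𝔾 n)`.

A discrete eigenpair `(λ, u)` is the Galerkin approximation of the solution `T` (`lift`) of the
source problem with right-hand side `λ u`, and `T - u` represents the residual, so that its energy
norm is equivalent to the `H_p^{-1}` norm of the residual, also locally in frequency. For such a
linear problem, Dörfler marking reduces the error by a fixed factor
(`IsGalerkinFamily.pwDist_le_of_dorfler`), and conversely each enlargement of `𝔾` that reduces the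
error sufficiently satisfies the Dörfler criterion (`IsGalerkinFamily.isDorfler_sdiff`); here the
upper bound on `θ` enters. The eigenfunctions `ψ` solve source problems with right-hand sides `Λ ψ`,
and the passage from `ψ` to the discrete eigenfunctions changes these in `L²` only by the energy
error times a factor that tends to zero. Therefore the errors of `ψ` and of the lifted discrete
eigenfunctions agree, on all index sets simultaneously, up to a small multiple of the current error
(`IsCluster.exists_comparison`), and both properties carry over to `pwDist ψ`
(`IsAdaptiveRun.step`).

For `ψ` in the approximation class the error can be halved by adding at most a constant times
`pwDist ψ 𝔾 ^ (-1 / s)` frequencies (`exists_halving`). Minimal marking adds no more than that in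
each step, and the errors decrease geometrically, so the total number of added frequencies is
bounded by a constant times the last term of a geometric series (`IsAdaptiveRun.card_mul_le`), which
is the claimed rate.
-/

namespace PlaneWave

/-! ### Eigenvalue problems with compact inclusion -/

section Abstract

variable {H L : Type*} [NormedAddCommGroup H] [InnerProductSpace ℝ H]
  [NormedAddCommGroup L] [InnerProductSpace ℝ L]

/-- The solutions `u` of the eigenvalue problem `⟪u, v⟫ = μ ⟪J u, J v⟫` for all `v`. With the energy
inner product on `H` and the inclusion `J` of `H` into `L²`, this is `a(u, v) = μ (u, v)`. -/
def genEig (J : H →L[ℝ] L) (μ : ℝ) : Submodule ℝ H where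
  carrier := {u | ∀ v, inner ℝ u v = μ * inner ℝ (J u) (J v)}
  zero_mem' := fun v => by simp
  add_mem' := fun {a b} ha hb v => by
    simp only [Set.mem_ofPred_eq] at ha hb
    rw [inner_add_left, map_add, inner_add_left, ha, hb, mul_add]
  smul_mem' := fun c a ha v => by
    simp only [Set.mem_ofPred_eq] at ha
    rw [inner_smul_left, map_smul, inner_smul_left, ha]
    ring

/-- The sum of the eigenspaces for eigenvalues at most `μ`. -/
def eigSum (J : H →L[ℝ] L) (μ : ℝ) : Submodule ℝ H := ⨆ ν : Set.Iic μ, genEig J ν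

/-- `J` is small on the orthogonal complements of suitable finite-dimensional spaces. -/
def SmallOffFinite (J : H →L[ℝ] L) : Prop :=
  ∀ ε > 0, ∃ F : Submodule ℝ H, FiniteDimensional ℝ F ∧ ∀ u ∈ Fᗮ, ‖J u‖ ≤ ε * ‖u‖

variable {J : H →L[ℝ] L}

lemma genEig_norm_sq {μ : ℝ} {u : H} (hu : u ∈ genEig J μ) : ‖u‖ ^ 2 = μ * ‖J u‖ ^ 2 := by
  have := hu u
  rwa [real_inner_self_eq_norm_sq, real_inner_self_eq_norm_sq] at this

lemma genEig_inner_map {μ ν : ℝ} (h : μ ≠ ν) {u v : H} (hu : u ∈ genEig J μ)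
    (hv : v ∈ genEig J ν) : inner ℝ (J u) (J v) = 0 := by
  have h1 := hu v
  have h2 := hv u
  rw [real_inner_comm, h1, real_inner_comm (J u)] at h2
  have h3 : (μ - ν) * inner ℝ (J u) (J v) = 0 := by linarith
  exact (mul_eq_zero.1 h3).resolve_left (sub_ne_zero.2 h)

lemma genEig_inner {μ ν : ℝ} (h : μ ≠ ν) {u v : H} (hu : u ∈ genEig J μ)
    (hv : v ∈ genEig J ν) : inner ℝ u v = 0 := by
  rw [hu v, genEig_inner_map h hu hv, mul_zero]

lemma genEig_eq_bot {μ : ℝ} (hμ : μ ≤ 0) : genEig J μ = ⊥ := by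
  rw [Submodule.eq_bot_iff]
  intro u hu
  have h := genEig_norm_sq hu
  have h2 : ‖u‖ ^ 2 ≤ 0 := h.trans_le (mul_nonpos_of_nonpos_of_nonneg hμ (sq_nonneg _))
  simpa using h2

lemma eigSum_eq_bot {μ : ℝ} (hμ : μ ≤ 0) : eigSum J μ = ⊥ := by
  rw [eigSum, iSup_eq_bot]
  exact fun ν => genEig_eq_bot (ν.2.trans hμ)

lemma eigSum_mono : Monotone (eigSum J) := fun _ μ h =>
  iSup_le fun ν => le_iSup (fun ν : Set.Iic μ => genEig J (ν : ℝ)) ⟨(ν : ℝ), le_trans ν.2 h⟩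

lemma genEig_le_eigSum {ν μ : ℝ} (h : ν ≤ μ) : genEig J ν ≤ eigSum J μ :=
  le_iSup (fun ν : Set.Iic μ => genEig J (ν : ℝ)) ⟨ν, h⟩

/-- A vector in a sum of eigenspaces is a sum of eigenvectors that are orthogonal for both forms. -/
lemma exists_decomp {ι : Type*} (f : ι → ℝ) (hf : Function.Injective f) {u : H}
    (hu : u ∈ ⨆ i, genEig J (f i)) : ∃ (s : Finset ι) (g : ι → H), (∀ i, g i ∈ genEig J (f i)) ∧
      ‖u‖ ^ 2 = ∑ i ∈ s, f i * ‖J (g i)‖ ^ 2 ∧ ‖J u‖ ^ 2 = ∑ i ∈ s, ‖J (g i)‖ ^ 2 := by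
  classical
  obtain ⟨g, hg, rfl⟩ := (Submodule.mem_iSup_iff_exists_finsupp _ _).1 hu
  have hg' : ∀ i, g i ∈ genEig J (f i) := hg
  refine ⟨g.support, g, hg', ?_, ?_⟩
  · rw [Finsupp.sum, ← real_inner_self_eq_norm_sq, sum_inner]
    refine Finset.sum_congr rfl fun i hi => ?_
    rw [inner_sum, Finset.sum_eq_single i, real_inner_self_eq_norm_sq, genEig_norm_sq (hg' i)]
    · exact fun j _ hj => genEig_inner (hf.ne hj.symm) (hg' i) (hg' j)
    · exact fun h => (h hi).elim
  · rw [Finsupp.sum, map_sum, ← real_inner_self_eq_norm_sq, sum_inner]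
    refine Finset.sum_congr rfl fun i hi => ?_
    rw [inner_sum, Finset.sum_eq_single i, real_inner_self_eq_norm_sq]
    · exact fun j _ hj => genEig_inner_map (hf.ne hj.symm) (hg' i) (hg' j)
    · exact fun h => (h hi).elim

lemma eigSum_norm_sq_le {μ : ℝ} {u : H} (hu : u ∈ eigSum J μ) : ‖u‖ ^ 2 ≤ μ * ‖J u‖ ^ 2 := by
  obtain ⟨s, g, -, h1, h2⟩ := exists_decomp (fun ν : Set.Iic μ => (ν : ℝ)) Subtype.val_injective hu
  rw [h1, h2, Finset.mul_sum]
  exact Finset.sum_le_sum fun i _ => mul_le_mul_of_nonneg_right i.2 (sq_nonneg _)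

lemma le_norm_sq_of_mem_iSup {μ : ℝ} {u : H} (hu : u ∈ ⨆ ν : Set.Ioi μ, genEig J (ν : ℝ)) :
    μ * ‖J u‖ ^ 2 ≤ ‖u‖ ^ 2 := by
  obtain ⟨s, g, -, h1, h2⟩ := exists_decomp (fun ν : Set.Ioi μ => (ν : ℝ)) Subtype.val_injective hu
  rw [h1, h2, Finset.mul_sum]
  exact Finset.sum_le_sum fun i _ => mul_le_mul_of_nonneg_right (le_of_lt i.2) (sq_nonneg _)

/-- A subspace meeting `Fᗮ` trivially has dimension at most that of `F`. -/
lemma finrank_le_of_disjoint_orthogonal {E F : Submodule ℝ H} [FiniteDimensional ℝ F]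
    (h : ∀ u ∈ E, u ∈ Fᗮ → u = 0) :
    FiniteDimensional ℝ E ∧ Module.finrank ℝ E ≤ Module.finrank ℝ F := by
  let p : E →ₗ[ℝ] F := (F.orthogonalProjectionOnto : H →L[ℝ] F).toLinearMap ∘ₗ E.subtype
  have hp : Function.Injective p := by
    rw [← LinearMap.ker_eq_bot, LinearMap.ker_eq_bot']
    intro u hu
    have h1 : F.orthogonalProjectionOnto (u : H) = 0 := hu
    rw [Submodule.orthogonalProjectionOnto_eq_zero_iff] at h1
    exact Subtype.ext (h u u.2 h1)
  exact ⟨Module.Finite.of_injective p hp, LinearMap.finrank_le_finrank_of_injective hp⟩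

/-- A space on which the Rayleigh quotient is bounded meets `Fᗮ` trivially if `J` is small enough
on `Fᗮ`. -/
lemma finiteDimensional_of_norm_sq_le (hJ : SmallOffFinite J) {μ : ℝ} {E : Submodule ℝ H}
    (hE : ∀ u ∈ E, ‖u‖ ^ 2 ≤ μ * ‖J u‖ ^ 2) : FiniteDimensional ℝ E := by
  have hμ : 0 < |μ| + 1 := by positivity
  obtain ⟨F, hF, h⟩ := hJ (√(|μ| + 1))⁻¹ (by positivity)
  refine (finrank_le_of_disjoint_orthogonal (F := F) fun u hu huF => ?_).1
  have h1 := hE u hu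
  have h2 : ‖J u‖ ^ 2 ≤ (|μ| + 1)⁻¹ * ‖u‖ ^ 2 := by
    calc ‖J u‖ ^ 2 ≤ ((√(|μ| + 1))⁻¹ * ‖u‖) ^ 2 := by
          gcongr
          exact h u huF
      _ = _ := by rw [mul_pow, inv_pow, Real.sq_sqrt hμ.le]
  have h3 : (|μ| + 1) * ‖J u‖ ^ 2 ≤ ‖u‖ ^ 2 := by
    rwa [inv_mul_eq_div, le_div_iff₀' hμ] at h2
  have h4 : μ * ‖J u‖ ^ 2 ≤ |μ| * ‖J u‖ ^ 2 :=
    mul_le_mul_of_nonneg_right (le_abs_self μ) (sq_nonneg _)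
  have h5 : ‖J u‖ ^ 2 = 0 := le_antisymm (by linarith) (sq_nonneg _)
  rw [h5, mul_zero] at h1
  simpa using h1

lemma finiteDimensional_eigSum (hJ : SmallOffFinite J) (μ : ℝ) :
    FiniteDimensional ℝ (eigSum J μ) :=
  finiteDimensional_of_norm_sq_le hJ fun _ => eigSum_norm_sq_le

lemma finrank_eigSum_mono (hJ : SmallOffFinite J) :
    Monotone fun μ => Module.finrank ℝ (eigSum J μ) := fun μ ν h => by
  have := finiteDimensional_eigSum hJ ν
  exact Submodule.finrank_mono (eigSum_mono h)

/-- The spectrum is discrete: there are no eigenvalues immediately to the right of `μ`. -/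
lemma exists_eigSum_eq (hJ : SmallOffFinite J) (μ : ℝ) : ∃ μ' > μ, eigSum J μ' = eigSum J μ := by
  have hfd := finiteDimensional_eigSum hJ (μ + 1)
  have hfin : {ν : ℝ | ν ≤ μ + 1 ∧ genEig J ν ≠ ⊥}.Finite := by
    have hind : iSupIndep fun ν : Set.Iic (μ + 1) =>
        (genEig J (ν : ℝ)).comap (eigSum J (μ + 1)).subtype := by
      have h1 : OrthogonalFamily ℝ (fun ν : Set.Iic (μ + 1) =>
          ((genEig J (ν : ℝ)).comap (eigSum J (μ + 1)).subtype)) fun ν =>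
          ((genEig J (ν : ℝ)).comap (eigSum J (μ + 1)).subtype).subtypeₗᵢ :=
        fun ν ν' h u v => genEig_inner (J := J) (Subtype.coe_injective.ne h)
          (Submodule.mem_comap.1 u.2) (Submodule.mem_comap.1 v.2)
      exact h1.independent
    have h2 := WellFoundedGT.finite_ne_bot_of_iSupIndep hind
    refine (h2.image Subtype.val).subset ?_
    rintro ν ⟨h3, h4⟩
    refine ⟨⟨ν, h3⟩, ?_, rfl⟩
    intro h5
    apply h4
    rw [Submodule.eq_bot_iff]
    intro u hu
    have : (⟨u, genEig_le_eigSum h3 hu⟩ : eigSum J (μ + 1)) ∈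
      (genEig J ν).comap (eigSum J (μ + 1)).subtype := hu
    rw [h5] at this
    simpa using this
  obtain ⟨μ', hμ', h⟩ : ∃ μ' > μ, ∀ ν, μ < ν → ν ≤ μ' → genEig J ν = ⊥ := by
    have hev : ∀ᶠ x in nhdsWithin μ (Set.Ioi μ),
        x ∉ {ν : ℝ | ν ≤ μ + 1 ∧ genEig J ν ≠ ⊥} ∩ Set.Ioi μ := by
      have h1 : IsClosed ({ν : ℝ | ν ≤ μ + 1 ∧ genEig J ν ≠ ⊥} ∩ Set.Ioi μ) :=
        (hfin.subset Set.inter_subset_left).isClosed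
      exact nhdsWithin_le_nhds (h1.isOpen_compl.mem_nhds fun h => lt_irrefl μ h.2)
    obtain ⟨c, hc, hsub⟩ := mem_nhdsGT_iff_exists_Ioo_subset.1 hev
    have hc' : μ < c := hc
    refine ⟨(μ + min c (μ + 1)) / 2, ?_, fun ν h1 h2 => ?_⟩
    · have : μ < min c (μ + 1) := lt_min hc' (by linarith)
      linarith
    · by_contra h3
      have h4 : μ < min c (μ + 1) := lt_min hc' (by linarith)
      refine hsub ⟨h1, ?_⟩ ⟨⟨?_, h3⟩, h1⟩
      · linarith [min_le_left c (μ + 1)]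
      · linarith [min_le_right c (μ + 1)]
  refine ⟨μ', hμ', le_antisymm (iSup_le fun ν => ?_) (eigSum_mono hμ'.le)⟩
  rcases le_or_gt (ν : ℝ) μ with h1 | h1
  · exact genEig_le_eigSum h1
  · rw [h ν h1 ν.2]
    exact bot_le

/-- The count of eigenvalues jumps at `μ` by the multiplicity of `μ`. -/
lemma finrank_eigSum_step (hJ : SmallOffFinite J) {μ' μ : ℝ} (h : μ' < μ)
    (hgap : ∀ ν, μ' < ν → ν < μ → genEig J ν = ⊥) :
    Module.finrank ℝ (eigSum J μ) = Module.finrank ℝ (eigSum J μ') +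
      Module.finrank ℝ (genEig J μ) := by
  have h1 : eigSum J μ = eigSum J μ' ⊔ genEig J μ := by
    refine le_antisymm (iSup_le fun ν => ?_) (sup_le (eigSum_mono h.le) (genEig_le_eigSum le_rfl))
    rcases le_or_gt (ν : ℝ) μ' with h2 | h2
    · exact (genEig_le_eigSum h2).trans le_sup_left
    · rcases eq_or_lt_of_le (show (ν : ℝ) ≤ μ from ν.2) with h3 | h3
      · rw [h3]
        exact le_sup_right
      · rw [hgap ν h2 h3]
        exact bot_le
  have h2 : eigSum J μ' ⊓ genEig J μ = ⊥ := by
    rw [Submodule.eq_bot_iff]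
    rintro u ⟨hu1, hu2⟩
    have e1 := eigSum_norm_sq_le hu1
    have e2 := genEig_norm_sq hu2
    have e3 : ‖J u‖ ^ 2 = 0 := by
      have : 0 ≤ ‖J u‖ ^ 2 := sq_nonneg _
      nlinarith
    rw [e3, mul_zero] at e2
    simpa using e2
  have := finiteDimensional_eigSum hJ μ
  have i1 : FiniteDimensional ℝ (eigSum J μ') := finiteDimensional_eigSum hJ μ'
  have i2 : FiniteDimensional ℝ (genEig J μ) :=
    Submodule.finiteDimensional_of_le (genEig_le_eigSum le_rfl : _ ≤ eigSum J μ)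
  have h3 := Submodule.finrank_sup_add_finrank_inf_eq (eigSum J μ') (genEig J μ)
  rw [h2, finrank_bot, add_zero] at h3
  rw [h1, h3]

/-- The operators `J ∘ P`, with `P` the orthogonal projection onto a suitable finite-dimensional
space, have finite rank and approximate `J` in norm. -/
lemma isCompactOperator_of_smallOffFinite [CompleteSpace L] (hJ : SmallOffFinite J) :
    IsCompactOperator J := by
  choose F hF h using fun n : ℕ => hJ (1 / (n + 1)) Nat.one_div_pos_of_nat
  have htend : Filter.Tendsto (fun n => J ∘L ((F n).starProjection)) Filter.atTop (nhds J) := by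
    rw [tendsto_iff_norm_sub_tendsto_zero]
    refine squeeze_zero (fun _ => norm_nonneg _) (fun n => ?_)
      tendsto_one_div_add_atTop_nhds_zero_nat
    refine ContinuousLinearMap.opNorm_le_bound _ (by positivity) fun u => ?_
    have h1 : u - (F n).starProjection u ∈ (F n)ᗮ := Submodule.sub_starProjection_mem_orthogonal u
    have h2 := h n _ h1
    have h3 : ‖u - (F n).starProjection u‖ ≤ ‖u‖ := by
      have e := Submodule.norm_sq_eq_add_norm_sq_starProjection u (F n)
      rw [Submodule.starProjection_orthogonal_val] at e
      exact (abs_le_of_sq_le_sq' (by nlinarith [sq_nonneg ‖(F n).starProjection u‖])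
        (norm_nonneg _)).2
    calc ‖(J ∘L (F n).starProjection - J) u‖ = ‖J (u - (F n).starProjection u)‖ := by
          rw [map_sub, ← norm_neg]
          simp
      _ ≤ 1 / (n + 1) * ‖u - (F n).starProjection u‖ := h2
      _ ≤ _ := by gcongr
  refine isCompactOperator_of_tendsto htend (Filter.Eventually.of_forall fun n => ?_)
  have e : (J ∘L (F n).starProjection : H →L[ℝ] L) =
      (J ∘L (F n).subtypeL) ∘L (F n).orthogonalProjectionOnto := by
    ext u
    rfl
  rw [e]
  exact (isCompactOperator_of_locallyCompactSpace_rng (J ∘L (F n).subtypeL)).comp_clm _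

section Complete

variable [CompleteSpace H] [CompleteSpace L]

/-- The solution operator: `⟪K u, v⟫ = ⟪J u, J v⟫`. -/
noncomputable def solOp (J : H →L[ℝ] L) : H →L[ℝ] H := J.adjoint ∘L J

lemma inner_solOp (u v : H) : inner ℝ (solOp J u) v = inner ℝ (J u) (J v) := by
  simp [solOp, ContinuousLinearMap.adjoint_inner_left]

lemma norm_solOp_le (u : H) : ‖solOp J u‖ ≤ ‖J‖ * ‖J u‖ := by
  have := J.adjoint.le_opNorm (J u)
  rwa [LinearIsometryEquiv.norm_map] at this

lemma isSymmetric_solOp : (solOp J).IsSymmetric := fun u v => by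
  have h1 := inner_solOp (J := J) u v
  have h2 := inner_solOp (J := J) v u
  rw [real_inner_comm] at h2
  rw [real_inner_comm (J u)] at h2
  exact h1.trans h2.symm

lemma isCompactOperator_solOp (hJ : SmallOffFinite J) : IsCompactOperator (solOp J) :=
  (isCompactOperator_of_smallOffFinite hJ).clm_comp J.adjoint

lemma mem_genEig_of_solOp {κ : ℝ} (hκ : κ ≠ 0) {u : H} (hu : solOp J u = κ • u) :
    u ∈ genEig J κ⁻¹ := fun v => by
  rw [← inner_solOp, hu, inner_smul_left]
  simp [hκ]

/-- The eigenvectors are total: this is the spectral theorem for the compact symmetric operator `K`,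
whose kernel is trivial as `J` is injective. -/
lemma topologicalClosure_iSup_genEig (hinj : Function.Injective J) (hJ : SmallOffFinite J) :
    (⨆ ν, genEig J ν).topologicalClosure = ⊤ := by
  rw [Submodule.topologicalClosure_eq_top_iff, ← le_bot_iff,
    ← ContinuousLinearMap.orthogonalComplement_iSup_eigenspaces_eq_bot
      (isCompactOperator_solOp hJ) isSymmetric_solOp]
  refine Submodule.orthogonal_le (iSup_le fun κ u hu => ?_)
  have hu' : solOp J u = κ • u := Module.End.mem_eigenspace_iff.1 hu
  by_cases hκ : κ = 0
  · have h1 := inner_solOp (J := J) u u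
    rw [hu', hκ, zero_smul, inner_zero_left, real_inner_self_eq_norm_sq] at h1
    have h2 : J u = 0 := by simpa using h1.symm
    have h3 : u = 0 := hinj (by rw [h2, map_zero])
    rw [h3]
    exact zero_mem _
  · exact Submodule.mem_iSup_of_mem κ⁻¹ (mem_genEig_of_solOp hκ hu')

/-- The Rayleigh quotient is at least `μ` on the orthogonal complement of the eigenspaces for
eigenvalues at most `μ`. -/
lemma le_norm_sq_of_mem_orthogonal (hinj : Function.Injective J) (hJ : SmallOffFinite J) {μ : ℝ}
    {u : H} (hu : u ∈ (eigSum J μ)ᗮ) : μ * ‖J u‖ ^ 2 ≤ ‖u‖ ^ 2 := by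
  have hfd := finiteDimensional_eigSum hJ μ
  have hmem : u ∈ (⨆ ν, genEig J ν).topologicalClosure := by
    rw [topologicalClosure_iSup_genEig hinj hJ]
    trivial
  have hclosed : IsClosed {w : H | μ * ‖J (w - (eigSum J μ).starProjection w)‖ ^ 2 ≤
      ‖w - (eigSum J μ).starProjection w‖ ^ 2} := by
    refine isClosed_le ?_ ?_ <;> fun_prop
  have hsub : ((⨆ ν, genEig J ν : Submodule ℝ H) : Set H) ⊆
      {w : H | μ * ‖J (w - (eigSum J μ).starProjection w)‖ ^ 2 ≤
      ‖w - (eigSum J μ).starProjection w‖ ^ 2} := by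
    intro w hw
    have hsup : (⨆ ν, genEig J ν) ≤ eigSum J μ ⊔ ⨆ ν : Set.Ioi μ, genEig J (ν : ℝ) := by
      refine iSup_le fun ν => ?_
      rcases le_or_gt ν μ with h | h
      · exact (genEig_le_eigSum h).trans le_sup_left
      · exact (le_iSup (fun ν : Set.Ioi μ => genEig J (ν : ℝ)) ⟨ν, h⟩).trans le_sup_right
    obtain ⟨a, ha, b, hb, rfl⟩ := Submodule.mem_sup.1 (hsup hw)
    have hb' : b ∈ (eigSum J μ)ᗮ := by
      have : eigSum J μ ⟂ ⨆ ν : Set.Ioi μ, genEig J (ν : ℝ) := by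
        rw [eigSum, Submodule.isOrtho_iSup_left]
        intro ν
        rw [Submodule.isOrtho_iSup_right]
        intro ν'
        rw [Submodule.isOrtho_iff_inner_eq]
        intro x hx y hy
        exact genEig_inner (ne_of_lt (lt_of_le_of_lt ν.2 ν'.2)) hx hy
      exact this.symm hb
    have e : a + b - (eigSum J μ).starProjection (a + b) = b := by
      rw [map_add, Submodule.starProjection_eq_self_iff.2 ha,
        (Submodule.starProjection_apply_eq_zero_iff _).2 hb']
      abel
    simp only [Set.mem_ofPred_eq, e]
    exact le_norm_sq_of_mem_iSup hb
  have h1 := closure_minimal hsub hclosed hmem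
  rw [Set.mem_ofPred_eq, (Submodule.starProjection_apply_eq_zero_iff _).2 hu, sub_zero] at h1
  exact h1

/-- The min-max principle: a space on which the Rayleigh quotient is at most `μ` has dimension at
most the number of eigenvalues up to `μ`. -/
theorem finrank_le_finrank_eigSum (hinj : Function.Injective J) (hJ : SmallOffFinite J) {μ : ℝ}
    {S : Submodule ℝ H} (hS : ∀ u ∈ S, ‖u‖ ^ 2 ≤ μ * ‖J u‖ ^ 2) :
    Module.finrank ℝ S ≤ Module.finrank ℝ (eigSum J μ) := by
  -- on the complement the quotient is at least some `μ' > μ`, as the spectrum is discrete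
  obtain ⟨μ', hμ', he⟩ := exists_eigSum_eq hJ μ
  have hfd := finiteDimensional_eigSum hJ μ
  refine (finrank_le_of_disjoint_orthogonal fun u hu huo => ?_).2
  rw [← he] at huo
  have h1 := le_norm_sq_of_mem_orthogonal hinj hJ huo
  have h2 := hS u hu
  have h3 : ‖J u‖ ^ 2 = 0 := by
    have : 0 ≤ ‖J u‖ ^ 2 := sq_nonneg _
    nlinarith
  rw [h3, mul_zero] at h2
  simpa using h2

end Complete

lemma smallOffFinite_of_finiteDimensional [FiniteDimensional ℝ H] : SmallOffFinite J := by
  refine fun ε hε => ⟨⊤, inferInstance, fun u hu => ?_⟩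
  rw [Submodule.top_orthogonal_eq_bot, Submodule.mem_bot] at hu
  simp [hu]

/-- A finite family of eigenvectors with eigenvalues `lam`, orthonormal for `⟪J ·, J ·⟫`. -/
structure IsEigenFamily (J : H →L[ℝ] L) {ι : Type*} (φ : ι → H) (lam : ι → ℝ) : Prop where
  orthonormal : Orthonormal ℝ fun j => J (φ j)
  mem : ∀ j, φ j ∈ genEig J (lam j)

/-- In finite dimensions there is an eigenbasis which is orthonormal for `⟪J ·, J ·⟫`. -/
lemma exists_eigenbasis [FiniteDimensional ℝ H] (hinj : Function.Injective J) :
    ∃ (n : ℕ) (φ : Fin n → H) (lam : Fin n → ℝ), IsEigenFamily J φ lam ∧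
      Submodule.span ℝ (Set.range φ) = ⊤ := by
  -- pull the form `⟪J ·, J ·⟫` back to an operator on `H` and diagonalize it
  let J' : H →L[ℝ] (LinearMap.range J.toLinearMap) := J.rangeRestrict
  let K := solOp J'
  have hK : (K : H →ₗ[ℝ] H).IsSymmetric := isSymmetric_solOp
  have hKi : ∀ u v, inner ℝ (K u) v = inner ℝ (J u) (J v) := fun u v => inner_solOp u v
  let b := hK.eigenvectorBasis rfl
  let κ : Fin (Module.finrank ℝ H) → ℝ := hK.eigenvalues rfl
  have hb : ∀ j, K (b j) = κ j • b j := fun j => hK.apply_eigenvectorBasis rfl j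
  have hin : ∀ i j, inner ℝ (J (b i)) (J (b j)) = κ i * inner ℝ (b i) (b j) := fun i j => by
    rw [← hKi, hb, inner_smul_left]
    simp
  have hpos : ∀ j, 0 < κ j := fun j => by
    have h1 := hin j j
    rw [real_inner_self_eq_norm_sq, real_inner_self_eq_norm_sq, b.orthonormal.1 j] at h1
    have h2 : J (b j) ≠ 0 := fun h => b.orthonormal.ne_zero j (hinj (by rw [h, map_zero]))
    have h3 : 0 < ‖J (b j)‖ ^ 2 := by positivity
    linarith
  refine ⟨_, fun j => (√(κ j))⁻¹ • b j, fun j => (κ j)⁻¹, ⟨?_, fun j => ?_⟩, ?_⟩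
  · rw [orthonormal_iff_ite]
    intro i j
    rw [map_smul, map_smul, inner_smul_left, inner_smul_right, hin,
      orthonormal_iff_ite.1 b.orthonormal]
    split_ifs with h
    · subst h
      have := Real.mul_self_sqrt (hpos i).le
      have h' := (Real.sqrt_pos.2 (hpos i)).ne'
      simp only [conj_trivial, mul_one]
      field_simp
      nlinarith
    · simp
  · refine Submodule.smul_mem _ _ fun v => ?_
    have h1 := hKi (b j) v
    rw [hb, inner_smul_left] at h1
    rw [← h1]
    simp [(hpos j).ne']
  · rw [eq_top_iff, ← b.toBasis.span_eq, Submodule.span_le]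
    rintro _ ⟨j, rfl⟩
    have h1 : b j = √(κ j) • ((√(κ j))⁻¹ • b j) := by
      rw [smul_smul, mul_inv_cancel₀ (Real.sqrt_pos.2 (hpos j)).ne', one_smul]
    rw [OrthonormalBasis.coe_toBasis, h1]
    exact Submodule.smul_mem _ _ (Submodule.subset_span ⟨j, rfl⟩)

lemma IsEigenFamily.linearIndependent {ι : Type*} {φ : ι → H} {lam : ι → ℝ}
    (h : IsEigenFamily J φ lam) : LinearIndependent ℝ φ :=
  LinearIndependent.of_comp (J : H →ₗ[ℝ] L) h.orthonormal.linearIndependent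

/-- Expansion of a vector in a spanning eigenfamily. -/
lemma IsEigenFamily.expand {ι : Type*} [Fintype ι] {φ : ι → H} {lam : ι → ℝ}
    (h : IsEigenFamily J φ lam) {u : H} (hu : u ∈ Submodule.span ℝ (Set.range φ)) :
    u = ∑ j, inner ℝ (J (φ j)) (J u) • φ j := by
  obtain ⟨c, rfl⟩ := (Submodule.mem_span_range_iff_exists_fun ℝ).1 hu
  refine Finset.sum_congr rfl fun j _ => ?_
  congr 1
  rw [map_sum]
  simp_rw [map_smul]
  rw [h.orthonormal.inner_right_fintype]

/-- The counting function is the number of basis eigenvalues at most `μ`. -/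
lemma IsEigenFamily.finrank_eigSum {ι : Type*} [Fintype ι] {φ : ι → H} {lam : ι → ℝ}
    (h : IsEigenFamily J φ lam) (hspan : Submodule.span ℝ (Set.range φ) = ⊤) (μ : ℝ) :
    Module.finrank ℝ (eigSum J μ) = (Finset.univ.filter fun j => lam j ≤ μ).card := by
  classical
  have h1 : eigSum J μ = Submodule.span ℝ
      (Set.range fun j : {j // lam j ≤ μ} => φ j) := by
    refine le_antisymm (iSup_le fun ν u hu => ?_) (Submodule.span_le.2 ?_)
    · have h2 := h.expand (u := u) (by rw [hspan]; trivial)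
      rw [h2]
      refine Submodule.sum_mem _ fun j _ => ?_
      by_cases hj : lam j ≤ μ
      · exact Submodule.smul_mem _ _ (Submodule.subset_span ⟨⟨j, hj⟩, rfl⟩)
      · rw [genEig_inner_map (fun h3 => hj (h3.trans_le ν.2)) (h.mem j) hu, zero_smul]
        exact zero_mem _
    · rintro _ ⟨j, rfl⟩
      exact genEig_le_eigSum j.2 (h.mem j)
  rw [h1, ← Fintype.card_subtype]
  exact finrank_span_eq_card (h.linearIndependent.comp _ Subtype.val_injective)

end Abstract

/-! ### Norms of tuples -/

section Tuple

variable {E : Type*} [NormedAddCommGroup E] {κ : Type*} [Fintype κ]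

/-- The Euclidean combination of the norms of the entries of a tuple. -/
noncomputable def tupleNorm (a : κ → E) : ℝ := √(∑ j, ‖a j‖ ^ 2)

lemma tupleNorm_nonneg (a : κ → E) : 0 ≤ tupleNorm a := Real.sqrt_nonneg _

lemma tupleNorm_sq (a : κ → E) : tupleNorm a ^ 2 = ∑ j, ‖a j‖ ^ 2 :=
  Real.sq_sqrt (Finset.sum_nonneg fun _ _ => sq_nonneg _)

lemma tupleNorm_eq (a : κ → E) : tupleNorm a = ‖WithLp.toLp 2 a‖ := by
  rw [PiLp.norm_eq_of_L2, tupleNorm]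

lemma tupleNorm_add_le (a b : κ → E) : tupleNorm (a + b) ≤ tupleNorm a + tupleNorm b := by
  simp only [tupleNorm_eq, WithLp.toLp_add]
  exact norm_add_le _ _

lemma tupleNorm_neg (a : κ → E) : tupleNorm (-a) = tupleNorm a := by
  simp [tupleNorm]

lemma tupleNorm_mono {E' : Type*} [NormedAddCommGroup E'] {a : κ → E} {b : κ → E'} {c : ℝ}
    (hc : 0 ≤ c) (h : ∀ j, ‖a j‖ ≤ c * ‖b j‖) : tupleNorm a ≤ c * tupleNorm b := by
  rw [tupleNorm, tupleNorm, ← Real.sqrt_sq hc, ← Real.sqrt_mul (sq_nonneg c), Finset.mul_sum]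
  refine Real.sqrt_le_sqrt (Finset.sum_le_sum fun j _ => ?_)
  rw [← mul_pow]
  exact pow_le_pow_left₀ (norm_nonneg _) (h j) 2

end Tuple

/-! ### Galerkin approximation of eigenvectors -/

section Galerkin

variable {H L : Type*} [NormedAddCommGroup H] [InnerProductSpace ℝ H]
  [NormedAddCommGroup L] [InnerProductSpace ℝ L]

/-- A family of eigenvectors of the Galerkin problem in `W`, orthonormal for `⟪J ·, J ·⟫`. -/
structure IsGalerkinFamily (J : H →L[ℝ] L) (W : Submodule ℝ H) {ι : Type*} (φ : ι → H)
    (lam : ι → ℝ) : Prop where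
  orthonormal : Orthonormal ℝ fun j => J (φ j)
  mem : ∀ j, φ j ∈ W
  eq : ∀ j, ∀ v ∈ W, inner ℝ (φ j) v = lam j * inner ℝ (J (φ j)) (J v)

variable {J : H →L[ℝ] L} {W : Submodule ℝ H}

lemma norm_sum_smul_sq {ι : Type*} {a : ι → L} (ha : Orthonormal ℝ a) (S : Finset ι)
    (c : ι → ℝ) : ‖∑ j ∈ S, c j • a j‖ ^ 2 = ∑ j ∈ S, c j ^ 2 := by
  rw [← real_inner_self_eq_norm_sq, ha.inner_sum]
  simp [sq]

lemma sum_inner_sq_le {ι : Type*} {a : ι → L} (ha : Orthonormal ℝ a) (S : Finset ι) (x : L) :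
    ∑ j ∈ S, inner ℝ (a j) x ^ 2 ≤ ‖x‖ ^ 2 := by
  simpa using ha.sum_inner_products_le (s := S) x

lemma IsGalerkinFamily.inner_eq {ι : Type*} [DecidableEq ι] {φ : ι → H} {lam : ι → ℝ}
    (h : IsGalerkinFamily J W φ lam) (i j : ι) :
    inner ℝ (φ i) (φ j) = if i = j then lam i else 0 := by
  rw [h.eq i _ (h.mem j), orthonormal_iff_ite.1 h.orthonormal]
  simp

lemma IsGalerkinFamily.norm_sum_sq {ι : Type*} {φ : ι → H} {lam : ι → ℝ}
    (h : IsGalerkinFamily J W φ lam) (S : Finset ι) (c : ι → ℝ) :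
    ‖∑ j ∈ S, c j • φ j‖ ^ 2 = ∑ j ∈ S, lam j * c j ^ 2 := by
  classical
  rw [← real_inner_self_eq_norm_sq, sum_inner]
  refine Finset.sum_congr rfl fun i hi => ?_
  rw [inner_sum, Finset.sum_eq_single i]
  · rw [inner_smul_left, inner_smul_right, h.inner_eq, if_pos rfl]
    simp only [conj_trivial]
    ring
  · intro j _ hj
    rw [inner_smul_left, inner_smul_right, h.inner_eq, if_neg hj.symm]
    simp
  · exact fun h => (h hi).elim

lemma IsGalerkinFamily.lam_nonneg {ι : Type*} {φ : ι → H} {lam : ι → ℝ}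
    (h : IsGalerkinFamily J W φ lam) (j : ι) : 0 ≤ lam j := by
  classical
  have := h.inner_eq j j
  rw [if_pos rfl, real_inner_self_eq_norm_sq] at this
  rw [← this]
  positivity

/-- The part of `u` in the span of the `φ j`, `j ∈ S`. -/
noncomputable def specPart (J : H →L[ℝ] L) {ι : Type*} (φ : ι → H) (S : Finset ι) (u : H) : H :=
  ∑ j ∈ S, inner ℝ (J (φ j)) (J u) • φ j

variable [W.HasOrthogonalProjection]

/-- The Strang–Fix identity: the coefficient of an exact eigenvector with respect to a discrete one
is expressed by its best approximation error. -/
lemma strang_fix {Λ lam : ℝ} {u φ : H} (hu : u ∈ genEig J Λ) (hφW : φ ∈ W)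
    (hφ : ∀ v ∈ W, inner ℝ φ v = lam * inner ℝ (J φ) (J v)) :
    (lam - Λ) * inner ℝ (J φ) (J u) = lam * inner ℝ (J φ) (J (u - W.starProjection u)) := by
  have h1 := hu φ
  have h2 := hφ _ (W.starProjection_apply_mem u)
  have h3 : inner ℝ φ (u - W.starProjection u) = 0 :=
    (Submodule.mem_orthogonal _ _).1 (Submodule.sub_starProjection_mem_orthogonal u) φ hφW
  rw [inner_sub_right, sub_eq_zero] at h3
  rw [real_inner_comm, h3, h2, real_inner_comm (J φ)] at h1
  rw [map_sub, inner_sub_right]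
  linarith

section Block

variable {ι : Type*} {φ : ι → H} {lam : ι → ℝ} {S : Finset ι} {Λ c : ℝ} {u : H}

/-- The spectral part of `u` for the discrete eigenvalues in `S` is close to the best approximation
of `u`: the coefficients with index in `S` differ by those of the error, and the remaining ones are
small by the Strang–Fix identity, since their eigenvalues are separated from `Λ`. The difference is
bounded by the error in the weaker norm `‖J ·‖`. -/
lemma norm_starProjection_sub_specPart_le [Fintype ι] (h : IsGalerkinFamily J W φ lam)
    (hspan : W ≤ Submodule.span ℝ (Set.range φ)) (hu : u ∈ genEig J Λ) (hc : 0 ≤ c)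
    (hS : ∀ j ∈ S, lam j ≤ c)
    (hS' : ∀ j ∉ S, lam j ≠ Λ ∧ lam j * Λ ^ 2 ≤ c * (lam j - Λ) ^ 2) :
    ‖W.starProjection u - specPart J φ S u‖ ^ 2 ≤ c * ‖J (u - W.starProjection u)‖ ^ 2 := by
  classical
  set g := u - W.starProjection u with hg
  let β : ι → ℝ := fun j => inner ℝ (J (φ j)) (J (W.starProjection u)) -
    if j ∈ S then inner ℝ (J (φ j)) (J u) else 0
  have hexp : W.starProjection u = ∑ j, inner ℝ (J (φ j)) (J (W.starProjection u)) • φ j := by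
    obtain ⟨d, hd⟩ := (Submodule.mem_span_range_iff_exists_fun ℝ).1
      (hspan (W.starProjection_apply_mem u))
    rw [← hd]
    refine Finset.sum_congr rfl fun j _ => ?_
    congr 1
    rw [map_sum]
    simp_rw [map_smul]
    rw [h.orthonormal.inner_right_fintype]
  have hdiff : W.starProjection u - specPart J φ S u = ∑ j, β j • φ j := by
    simp only [β, sub_smul, Finset.sum_sub_distrib]
    rw [← hexp, specPart]
    simp [ite_smul]
  rw [hdiff, h.norm_sum_sq]
  have hle : ∀ j, lam j * β j ^ 2 ≤ c * inner ℝ (J (φ j)) (J g) ^ 2 := fun j => by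
    by_cases hj : j ∈ S
    · have : β j = - inner ℝ (J (φ j)) (J g) := by
        simp only [β, if_pos hj, hg, map_sub, inner_sub_right]
        ring
      rw [this, neg_sq]
      exact mul_le_mul_of_nonneg_right (hS j hj) (sq_nonneg _)
    · obtain ⟨hne, hcj⟩ := hS' j hj
      have h1 := strang_fix hu (h.mem j) (h.eq j)
      have h2 : (lam j - Λ) * β j = Λ * inner ℝ (J (φ j)) (J g) := by
        have h3 : inner ℝ (J (φ j)) (J g) =
            inner ℝ (J (φ j)) (J u) - inner ℝ (J (φ j)) (J (W.starProjection u)) := by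
          rw [hg, map_sub, inner_sub_right]
        rw [← hg] at h1
        simp only [β, if_neg hj, sub_zero]
        linear_combination h1 + (lam j - Λ) * h3
      have h4 : 0 < (lam j - Λ) ^ 2 := by
        have := sub_ne_zero.2 hne
        positivity
      refine le_of_mul_le_mul_left ?_ h4
      calc (lam j - Λ) ^ 2 * (lam j * β j ^ 2) = lam j * ((lam j - Λ) * β j) ^ 2 := by ring
        _ = lam j * Λ ^ 2 * inner ℝ (J (φ j)) (J g) ^ 2 := by rw [h2]; ring
        _ ≤ c * (lam j - Λ) ^ 2 * inner ℝ (J (φ j)) (J g) ^ 2 :=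
          mul_le_mul_of_nonneg_right hcj (sq_nonneg _)
        _ = _ := by ring
  have hc0 : ∑ j, c * inner ℝ (J (φ j)) (J g) ^ 2 ≤ c * ‖J g‖ ^ 2 := by
    rw [← Finset.mul_sum]
    exact mul_le_mul_of_nonneg_left (sum_inner_sq_le h.orthonormal _ _) hc
  exact (Finset.sum_le_sum fun j _ => hle j).trans hc0

lemma norm_starProjection_sub_specPart_le' [Fintype ι] (h : IsGalerkinFamily J W φ lam)
    (hspan : W ≤ Submodule.span ℝ (Set.range φ)) (hu : u ∈ genEig J Λ) (hc : 0 ≤ c)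
    (hS : ∀ j ∈ S, lam j ≤ c)
    (hS' : ∀ j ∉ S, lam j ≠ Λ ∧ lam j * Λ ^ 2 ≤ c * (lam j - Λ) ^ 2)
    {ν : ℝ} (hν : ∀ w ∈ Wᗮ, ‖J w‖ ≤ ν * ‖w‖) :
    ‖W.starProjection u - specPart J φ S u‖ ≤ √c * ν * ‖u - W.starProjection u‖ := by
  have h1 := norm_starProjection_sub_specPart_le h hspan hu hc hS hS'
  have h2 : ‖W.starProjection u - specPart J φ S u‖ ≤ √c * ‖J (u - W.starProjection u)‖ := by
    refine abs_le_of_sq_le_sq' ?_ (by positivity) |>.2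
    rwa [mul_pow, Real.sq_sqrt hc]
  have h3 := hν _ (Submodule.sub_starProjection_mem_orthogonal (K := W) u)
  calc _ ≤ _ := h2
    _ ≤ √c * (ν * ‖u - W.starProjection u‖) := by gcongr
    _ = _ := by ring

/-- Up to a factor close to one, the spectral part of `u` is as good as its best approximation. -/
lemma norm_sub_specPart_le [Fintype ι] (h : IsGalerkinFamily J W φ lam)
    (hspan : W ≤ Submodule.span ℝ (Set.range φ)) (hu : u ∈ genEig J Λ) (hc : 0 ≤ c)
    (hS : ∀ j ∈ S, lam j ≤ c)
    (hS' : ∀ j ∉ S, lam j ≠ Λ ∧ lam j * Λ ^ 2 ≤ c * (lam j - Λ) ^ 2)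
    {ν : ℝ} (hν : ∀ w ∈ Wᗮ, ‖J w‖ ≤ ν * ‖w‖) :
    ‖u - specPart J φ S u‖ ≤ (1 + √c * ν) * ‖u - W.starProjection u‖ := by
  have h1 := norm_starProjection_sub_specPart_le' h hspan hu hc hS hS' hν
  have h2 := norm_add_le (u - W.starProjection u) (W.starProjection u - specPart J φ S u)
  rw [sub_add_sub_cancel] at h2
  linarith

/-- The spectral part of `u` approximates `u` in the weaker norm `‖J ·‖` with an additional factor
`ν`. -/
lemma norm_map_sub_specPart_le [Fintype ι] (h : IsGalerkinFamily J W φ lam)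
    (hspan : W ≤ Submodule.span ℝ (Set.range φ)) (hu : u ∈ genEig J Λ) (hc : 0 ≤ c)
    (hS : ∀ j ∈ S, lam j ≤ c)
    (hS' : ∀ j ∉ S, lam j ≠ Λ ∧ lam j * Λ ^ 2 ≤ c * (lam j - Λ) ^ 2)
    {ν : ℝ} (hν : ∀ w ∈ Wᗮ, ‖J w‖ ≤ ν * ‖w‖) :
    ‖J (u - specPart J φ S u)‖ ≤ (1 + ‖J‖ * √c) * ν * ‖u - W.starProjection u‖ := by
  have h1 := norm_starProjection_sub_specPart_le' h hspan hu hc hS hS' hν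
  have h2 := norm_add_le (J (u - W.starProjection u)) (J (W.starProjection u - specPart J φ S u))
  rw [← map_add, sub_add_sub_cancel] at h2
  have h3 := hν _ (Submodule.sub_starProjection_mem_orthogonal (K := W) u)
  have h4 := J.le_opNorm (W.starProjection u - specPart J φ S u)
  have h5 := mul_le_mul_of_nonneg_left h1 (norm_nonneg J)
  nlinarith

variable [CompleteSpace H] [CompleteSpace L]

/-- `u` is reproduced by the solutions `lam j • K (φ j)` of the source problems with right-hand
sides `lam j • φ j`, up to a small multiple of the error of best approximation. -/
lemma norm_sub_sum_solOp_le [Fintype ι] (h : IsGalerkinFamily J W φ lam)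
    (hspan : W ≤ Submodule.span ℝ (Set.range φ)) (hu : u ∈ genEig J Λ) (hc : 0 ≤ c)
    (hS : ∀ j ∈ S, lam j ≤ c)
    (hS' : ∀ j ∉ S, lam j ≠ Λ ∧ lam j * Λ ^ 2 ≤ c * (lam j - Λ) ^ 2)
    {ν : ℝ} (hν : ∀ w ∈ Wᗮ, ‖J w‖ ≤ ν * ‖w‖) :
    ‖u - ∑ j ∈ S, inner ℝ (J (φ j)) (J u) • lam j • solOp J (φ j)‖ ≤
      ‖J‖ * (|Λ| * (1 + ‖J‖ * √c) + c) * ν * ‖u - W.starProjection u‖ := by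
  set x : H := Λ • (u - specPart J φ S u) +
    ∑ j ∈ S, ((Λ - lam j) * inner ℝ (J (φ j)) (J u)) • φ j with hx
  have hKu : u = Λ • solOp J u := by
    refine ext_inner_right ℝ fun v => ?_
    rw [inner_smul_left, inner_solOp, hu v]
    simp
  -- the difference solves a source problem whose right-hand side `x` is small in the norm `‖J ·‖`
  have hxe : u - ∑ j ∈ S, inner ℝ (J (φ j)) (J u) • lam j • solOp J (φ j) = solOp J x := by
    rw [hx, map_add, map_smul, map_sub, smul_sub, ← hKu, specPart, map_sum, map_sum,
      Finset.smul_sum, sub_add, ← Finset.sum_sub_distrib]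
    congr 1
    refine Finset.sum_congr rfl fun j _ => ?_
    rw [map_smul, map_smul, smul_smul, smul_smul, ← sub_smul]
    congr 1
    ring
  have h1 := norm_map_sub_specPart_le h hspan hu hc hS hS' hν
  have hν' := hν _ (Submodule.sub_starProjection_mem_orthogonal (K := W) u)
  have h2 : ‖J (∑ j ∈ S, ((Λ - lam j) * inner ℝ (J (φ j)) (J u)) • φ j)‖ ≤
      c * ‖J (u - W.starProjection u)‖ := by
    refine abs_le_of_sq_le_sq' ?_ (by positivity) |>.2
    rw [map_sum]
    simp_rw [map_smul]
    rw [norm_sum_smul_sq h.orthonormal, mul_pow]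
    refine le_trans ?_ (mul_le_mul_of_nonneg_left
      (sum_inner_sq_le h.orthonormal S (J (u - W.starProjection u))) (sq_nonneg c))
    rw [Finset.mul_sum]
    refine Finset.sum_le_sum fun j hj => ?_
    have h3 := strang_fix hu (h.mem j) (h.eq j)
    have h4 : (Λ - lam j) * inner ℝ (J (φ j)) (J u) =
        -(lam j * inner ℝ (J (φ j)) (J (u - W.starProjection u))) := by linarith
    rw [h4, neg_sq, mul_pow]
    have := h.lam_nonneg j
    have := hS j hj
    gcongr
  have h3 : ‖J x‖ ≤ |Λ| * ‖J (u - specPart J φ S u)‖ + c * ‖J (u - W.starProjection u)‖ := by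
    rw [hx, map_add, map_smul]
    refine (norm_add_le _ _).trans ?_
    rw [norm_smul, Real.norm_eq_abs]
    linarith
  rw [hxe]
  calc ‖solOp J x‖ ≤ ‖J‖ * ‖J x‖ := norm_solOp_le x
    _ ≤ ‖J‖ * (|Λ| * ((1 + ‖J‖ * √c) * ν * ‖u - W.starProjection u‖) +
        c * (ν * ‖u - W.starProjection u‖)) := by
      refine mul_le_mul_of_nonneg_left (h3.trans ?_) (norm_nonneg _)
      gcongr
    _ = _ := by ring

end Block

section Comparison

lemma sum_comm_three {ι κ' : Type*} [Fintype ι] [Fintype κ'] (f : ι → ι → κ' → ℝ) :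
    ∑ l, ∑ l', ∑ k, f l l' k = ∑ k, ∑ l, ∑ l', f l l' k := by
  rw [Finset.sum_comm]
  simp_rw [Finset.sum_comm (s := (Finset.univ : Finset κ'))]
  rw [Finset.sum_comm]

variable {ι κ : Type*} [Fintype ι] [Fintype κ] {a : ι → L} {b : κ → L}

/-- The total defects of two orthonormal families of the same length, each with respect to the
span of the other, coincide. -/
lemma sum_defect_eq (ha : Orthonormal ℝ a) (hb : Orthonormal ℝ b)
    (hcard : Fintype.card ι = Fintype.card κ) :
    ∑ l, ‖a l - ∑ j, inner ℝ (a l) (b j) • b j‖ ^ 2 =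
      ∑ j, ‖b j - ∑ l, inner ℝ (a l) (b j) • a l‖ ^ 2 := by
  have h1 : ∀ l, ‖a l - ∑ j, inner ℝ (a l) (b j) • b j‖ ^ 2 =
      1 - ∑ j, inner ℝ (a l) (b j) ^ 2 := fun l => by
    rw [@norm_sub_sq_real, norm_sum_smul_sq hb, inner_sum, ha.1 l]
    simp only [inner_smul_right, ← sq]
    ring
  have h2 : ∀ j, ‖b j - ∑ l, inner ℝ (a l) (b j) • a l‖ ^ 2 =
      1 - ∑ l, inner ℝ (a l) (b j) ^ 2 := fun j => by
    rw [@norm_sub_sq_real, norm_sum_smul_sq ha, inner_sum, hb.1 j]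
    simp only [inner_smul_right, real_inner_comm (a _) (b j), ← sq]
    ring
  simp only [h1, h2, Finset.sum_sub_distrib, Finset.sum_const, Finset.card_univ, hcard]
  rw [Finset.sum_comm]

/-- The matrix `⟪a l, b j⟫` is a contraction, and it is close to an isometry if the family `b` is
close to the span of the family `a`. -/
lemma sum_mul_gram (ha : Orthonormal ℝ a) (hb : Orthonormal ℝ b)
    (hcard : Fintype.card ι = Fintype.card κ) (x : ι → H) :
    ∑ j, ‖∑ l, inner ℝ (a l) (b j) • x l‖ ^ 2 ≤ ∑ l, ‖x l‖ ^ 2 ∧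
    (1 - ∑ j, ‖b j - ∑ l, inner ℝ (a l) (b j) • a l‖ ^ 2) * ∑ l, ‖x l‖ ^ 2 ≤
      ∑ j, ‖∑ l, inner ℝ (a l) (b j) • x l‖ ^ 2 := by
  classical
  set g : ι → L := fun l => a l - ∑ j, inner ℝ (a l) (b j) • b j with hg
  have hgg : ∀ l l', inner ℝ (g l) (g l') =
      (if l = l' then 1 else 0) - ∑ j, inner ℝ (a l) (b j) * inner ℝ (a l') (b j) := fun l l' => by
    have e1 : inner ℝ (∑ j, inner ℝ (a l) (b j) • b j) (∑ j, inner ℝ (a l') (b j) • b j) =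
        ∑ j, inner ℝ (a l) (b j) * inner ℝ (a l') (b j) := by
      rw [hb.inner_sum]
      simp
    simp only [hg]
    rw [inner_sub_left, inner_sub_right, inner_sub_right, e1, orthonormal_iff_ite.1 ha, inner_sum,
      sum_inner]
    simp only [inner_smul_right, inner_smul_left, conj_trivial, real_inner_comm (a l') (b _)]
    simp only [mul_comm (inner ℝ (a l') (b _))]
    ring
  -- the defect is the trace of the product of the Gram matrices of `g` and `x`
  have key : ∑ l, ‖x l‖ ^ 2 - ∑ j, ‖∑ l, inner ℝ (a l) (b j) • x l‖ ^ 2 =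
      ∑ l, ∑ l', inner ℝ (g l) (g l') * inner ℝ (x l) (x l') := by
    simp only [hgg, sub_mul, Finset.sum_sub_distrib, ite_mul, one_mul, zero_mul,
      Finset.sum_ite_eq, Finset.mem_univ, if_true, real_inner_self_eq_norm_sq]
    congr 1
    simp only [Finset.sum_mul]
    rw [sum_comm_three]
    refine Finset.sum_congr rfl fun j _ => ?_
    rw [← real_inner_self_eq_norm_sq, sum_inner]
    refine Finset.sum_congr rfl fun l _ => ?_
    rw [inner_sum]
    refine Finset.sum_congr rfl fun l' _ => ?_
    rw [inner_smul_left, inner_smul_right, conj_trivial]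
    ring
  have hlow : 0 ≤ ∑ l, ∑ l', inner ℝ (g l) (g l') * inner ℝ (x l) (x l') := by
    -- expand the `x l` in an orthonormal basis of their span
    let F := Submodule.span ℝ (Set.range x)
    have hF : FiniteDimensional ℝ F := FiniteDimensional.span_of_finite ℝ (Set.finite_range x)
    let e := stdOrthonormalBasis ℝ F
    let y : ι → F := fun l => ⟨x l, Submodule.subset_span ⟨l, rfl⟩⟩
    have hxy : ∀ l l', inner ℝ (x l) (x l') = ∑ k, inner ℝ (y l) (e k) * inner ℝ (y l') (e k) :=
      fun l l' => by
        change inner ℝ (y l) (y l') = _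
        rw [← e.sum_inner_mul_inner (y l) (y l')]
        simp only [real_inner_comm (y l')]
    have : ∑ l, ∑ l', inner ℝ (g l) (g l') * inner ℝ (x l) (x l') =
        ∑ k, ‖∑ l, inner ℝ (y l) (e k) • g l‖ ^ 2 := by
      simp only [hxy, Finset.mul_sum]
      rw [sum_comm_three]
      refine Finset.sum_congr rfl fun k _ => ?_
      rw [← real_inner_self_eq_norm_sq, sum_inner]
      refine Finset.sum_congr rfl fun l _ => ?_
      rw [inner_sum]
      refine Finset.sum_congr rfl fun l' _ => ?_
      rw [inner_smul_left, inner_smul_right, conj_trivial]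
      ring
    rw [this]
    positivity
  have hup : ∑ l, ∑ l', inner ℝ (g l) (g l') * inner ℝ (x l) (x l') ≤
      (∑ l, ‖g l‖ ^ 2) * ∑ l, ‖x l‖ ^ 2 := by
    calc _ ≤ ∑ l, ∑ l', (‖g l‖ * ‖x l‖) * (‖g l'‖ * ‖x l'‖) := by
          refine Finset.sum_le_sum fun l _ => Finset.sum_le_sum fun l' _ => ?_
          refine (le_abs_self _).trans ?_
          rw [abs_mul]
          calc _ ≤ (‖g l‖ * ‖g l'‖) * (‖x l‖ * ‖x l'‖) := by
                gcongr <;> exact abs_real_inner_le_norm _ _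
            _ = _ := by ring
      _ = (∑ l, ‖g l‖ * ‖x l‖) ^ 2 := by rw [sq, Finset.sum_mul_sum]
      _ ≤ _ := Finset.sum_mul_sq_le_sq_mul_sq _ _ _
  rw [sum_defect_eq ha hb hcard] at hup
  constructor
  · linarith
  · rw [sub_mul, one_mul]
    linarith

/-- Comparison of two tuples `u` and `T` which are nearly related by the matrix `⟪a l, b j⟫`: all
contractions map them to tuples of nearly the same norm. -/
lemma tupleNorm_map_le (ha : Orthonormal ℝ a) (hb : Orthonormal ℝ b)
    (hcard : Fintype.card ι = Fintype.card κ) {u : κ → H} {T : ι → H} {ρ : ℝ}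
    (hR : tupleNorm (fun j => u j - ∑ l, inner ℝ (a l) (b j) • T l) ≤ ρ)
    (Z : H →L[ℝ] H) (hZ : ∀ x, ‖Z x‖ ≤ ‖x‖) :
    tupleNorm (fun j => Z (u j)) ≤ tupleNorm (fun l => Z (T l)) + ρ ∧
    √(1 - ∑ j, ‖b j - ∑ l, inner ℝ (a l) (b j) • a l‖ ^ 2) * tupleNorm (fun l => Z (T l)) ≤
      tupleNorm (fun j => Z (u j)) + ρ := by
  have hm := sum_mul_gram ha hb hcard fun l => Z (T l)
  set y : κ → H := fun j => ∑ l, inner ℝ (a l) (b j) • Z (T l) with hy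
  have h1 : tupleNorm y ≤ tupleNorm fun l => Z (T l) := Real.sqrt_le_sqrt hm.1
  have h2 : √(1 - ∑ j, ‖b j - ∑ l, inner ℝ (a l) (b j) • a l‖ ^ 2) *
      tupleNorm (fun l => Z (T l)) ≤ tupleNorm y := by
    rw [tupleNorm, tupleNorm, ← Real.sqrt_mul' _ (Finset.sum_nonneg fun _ _ => sq_nonneg _)]
    exact Real.sqrt_le_sqrt hm.2
  set R : κ → H := fun j => Z (u j - ∑ l, inner ℝ (a l) (b j) • T l) with hRdef
  have h3 : tupleNorm R ≤ ρ := by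
    refine le_trans ?_ hR
    exact (tupleNorm_mono zero_le_one fun j => (hZ _).trans_eq (one_mul _).symm).trans_eq
      (one_mul _)
  have h4 : (fun j => Z (u j)) = y + R := by
    funext j
    simp [hy, hRdef]
  have h5 : y = (fun j => Z (u j)) + -R := by rw [h4]; abel
  constructor
  · rw [h4]
    linarith [tupleNorm_add_le y R]
  · have h6 := tupleNorm_add_le (fun j => Z (u j)) (-R)
    rw [← h5, tupleNorm_neg] at h6
    linarith

end Comparison

/-- Linear combinations of unit length are approximated as well as the whole tuple. -/
lemma norm_sum_smul_le {κ : Type*} [Fintype κ] (c : κ → ℝ) (hc : ∑ j, c j ^ 2 ≤ 1) (x : κ → H) :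
    ‖∑ j, c j • x j‖ ≤ tupleNorm x := by
  calc ‖∑ j, c j • x j‖ ≤ ∑ j, |c j| * ‖x j‖ := by
        refine (norm_sum_le _ _).trans (Finset.sum_le_sum fun j _ => ?_)
        rw [norm_smul, Real.norm_eq_abs]
    _ ≤ tupleNorm x := by
        refine Real.le_sqrt_of_sq_le ((Finset.sum_mul_sq_le_sq_mul_sq _ _ _).trans ?_)
        simp only [sq_abs]
        exact mul_le_of_le_one_left (Finset.sum_nonneg fun _ _ => sq_nonneg _) hc

/-- The quadratic bound for the error of a discrete eigenvalue. The Strang–Fix identity is applied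
to the projection `w` of the discrete eigenvector `φ` onto the span of the exact ones: one
contribution to its right-hand side is the square of an energy error, the other one a product of two
errors in the weaker norm. -/
lemma eigenvalue_sub_le {κ : Type*} [Fintype κ] {φ : H} {lam Λ : ℝ}
    {u : κ → H} (hΛ : 0 < Λ) (hφ1 : ‖J φ‖ = 1) (hφW : φ ∈ W)
    (hφ : ∀ v ∈ W, inner ℝ φ v = lam * inner ℝ (J φ) (J v))
    (hlam : Λ ≤ lam)
    (hu : ∀ j, u j ∈ genEig J Λ) (huo : Orthonormal ℝ fun j => J (u j))
    {ν D η : ℝ} (hν0 : 0 ≤ ν) (hν : ∀ w ∈ Wᗮ, ‖J w‖ ≤ ν * ‖w‖)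
    (hD : tupleNorm (fun j => u j - W.starProjection (u j)) ≤ D)
    (hη : ‖J φ - ∑ j, inner ℝ (J φ) (J (u j)) • J (u j)‖ ≤ η) (hη2 : η ^ 2 ≤ 1 / 2) :
    lam - Λ ≤ 2 * lam * (η * (ν * D) + Λ⁻¹ * D ^ 2) := by
  set c : κ → ℝ := fun j => inner ℝ (J φ) (J (u j)) with hc
  set w : H := ∑ j, c j • u j with hw
  have hwe : w ∈ genEig J Λ := Submodule.sum_mem _ fun j _ => Submodule.smul_mem _ _ (hu j)
  have hJw : J w = ∑ j, c j • J (u j) := by simp [hw]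
  have hJw2 : ‖J w‖ ^ 2 = ∑ j, c j ^ 2 := by rw [hJw, norm_sum_smul_sq huo]
  have hφw : inner ℝ (J φ) (J w) = ‖J w‖ ^ 2 := by
    rw [hJw2, hJw, inner_sum]
    simp only [inner_smul_right, hc, sq]
  set g := J φ - J w with hg
  have hg' : ‖g‖ ≤ η := by rwa [hg, hJw]
  have hη0 : 0 ≤ η := (norm_nonneg g).trans hg'
  have hg2 : ‖g‖ ^ 2 = 1 - ‖J w‖ ^ 2 := by
    rw [hg, @norm_sub_sq_real, hφw, hφ1]
    ring
  have hgη : ‖g‖ ^ 2 ≤ η ^ 2 := by gcongr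
  have hc1 : ∑ j, c j ^ 2 ≤ 1 := by
    rw [← hJw2]
    nlinarith [sq_nonneg ‖g‖]
  have hp : w - W.starProjection w = ∑ j, c j • (u j - W.starProjection (u j)) := by
    simp [hw, smul_sub]
  have hD' : ‖w - W.starProjection w‖ ≤ D := by
    rw [hp]
    exact (norm_sum_smul_le c hc1 _).trans hD
  have hD0 : 0 ≤ D := (norm_nonneg _).trans hD'
  have hJp : ‖J (w - W.starProjection w)‖ ≤ ν * D :=
    (hν _ (Submodule.sub_starProjection_mem_orthogonal (K := W) w)).trans (by gcongr)
  have h1 := strang_fix hwe hφW hφ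
  have h2 : inner ℝ (J w) (J (w - W.starProjection w)) = Λ⁻¹ * ‖w - W.starProjection w‖ ^ 2 := by
    have e1 := hwe (w - W.starProjection w)
    have e2 : inner ℝ w (w - W.starProjection w) = ‖w - W.starProjection w‖ ^ 2 := by
      rw [← real_inner_self_eq_norm_sq]
      rw [inner_sub_left (𝕜 := ℝ) w, (Submodule.mem_orthogonal _ _).1
        (Submodule.sub_starProjection_mem_orthogonal (K := W) w)
        _ (W.starProjection_apply_mem w), sub_zero]
    rw [← e2, e1]
    field_simp
  have h3 : inner ℝ (J φ) (J (w - W.starProjection w)) =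
      inner ℝ g (J (w - W.starProjection w)) + Λ⁻¹ * ‖w - W.starProjection w‖ ^ 2 := by
    rw [← h2, hg, ← inner_add_left, sub_add_cancel]
  have h4 : inner ℝ g (J (w - W.starProjection w)) ≤ η * (ν * D) :=
    (real_inner_le_norm _ _).trans (by gcongr)
  have h5 : Λ⁻¹ * ‖w - W.starProjection w‖ ^ 2 ≤ Λ⁻¹ * D ^ 2 := by gcongr
  rw [hφw, h3] at h1
  have h6 : (lam - Λ) * (1 / 2) ≤ (lam - Λ) * ‖J w‖ ^ 2 :=
    mul_le_mul_of_nonneg_left (by linarith) (sub_nonneg.2 hlam)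
  have h7 : lam * (inner ℝ g (J (w - W.starProjection w)) +
      Λ⁻¹ * ‖w - W.starProjection w‖ ^ 2) ≤ lam * (η * (ν * D) + Λ⁻¹ * D ^ 2) :=
    mul_le_mul_of_nonneg_left (by linarith) (hΛ.le.trans hlam)
  linarith

end Galerkin

variable {d : ℕ}

/-! ### Fourier expansion in planewaves -/

/-- The unnormalized exponential `exp(i G·x)`. -/
noncomputable def expMonomial (G : Freq d) : C(Torus d, ℂ) where
  toFun x := ∏ j, fourier (G j) (x j)

lemma planewave_eq_smul (G : Freq d) :
    planewave G = ((((2 * π) ^ (-(d : ℝ) / 2) : ℝ)) : ℂ) • expMonomial G := by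
  ext x
  simp [planewave, expMonomial]

lemma planewave_neg (G : Freq d) (x : Torus d) : planewave (-G) x = conj (planewave G x) := by
  simp only [planewave, Pi.neg_apply, fourier_neg, ContinuousMap.coe_mk, map_prod, map_mul,
    Complex.conj_ofReal]

lemma span_expMonomial_eq_adjoin :
    Subalgebra.toSubmodule (Algebra.adjoin ℂ (Set.range (expMonomial (d := d)))) =
      Submodule.span ℂ (Set.range expMonomial) := by
  apply Algebra.adjoin_eq_span_of_subset
  refine .trans (fun x ↦ Submonoid.closure_induction (fun _ ↦ id) ⟨0, ?_⟩ ?_)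
    Submodule.subset_span
  · ext z
    simp [expMonomial]
  · rintro _ _ _ _ ⟨m, rfl⟩ ⟨n, rfl⟩
    refine ⟨m + n, ?_⟩
    ext z
    simp only [expMonomial, Pi.add_apply, fourier_add, ContinuousMap.coe_mk,
      ContinuousMap.mul_apply, ← Finset.prod_mul_distrib]

/-- The star subalgebra of trigonometric polynomials. -/
noncomputable def trigSubalgebra (d : ℕ) : StarSubalgebra ℂ C(Torus d, ℂ) where
  toSubalgebra := Algebra.adjoin ℂ (Set.range expMonomial)
  star_mem' := by
    change Algebra.adjoin ℂ (Set.range expMonomial) ≤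
      star (Algebra.adjoin ℂ (Set.range expMonomial))
    refine Algebra.adjoin_le ?_
    rintro _ ⟨n, rfl⟩
    refine Algebra.subset_adjoin ⟨-n, ?_⟩
    ext1 x
    simp only [expMonomial, Pi.neg_apply, fourier_neg, ContinuousMap.coe_mk,
      starRingEnd_apply, ContinuousMap.star_apply, star_prod]

lemma trigSubalgebra_separatesPoints :
    (trigSubalgebra d).toSubalgebra.SeparatesPoints := by
  intro x y hxy
  obtain ⟨i, hi⟩ := Function.ne_iff.1 hxy
  have hs : ∀ z : Torus d, expMonomial (Pi.single i 1) z = fourier 1 (z i) := fun z => by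
    rw [expMonomial, ContinuousMap.coe_mk, Finset.prod_eq_single i]
    · simp
    · intro j _ hj
      simp [Pi.single_eq_of_ne hj]
    · simp
  refine ⟨_, ⟨expMonomial (Pi.single i 1), Algebra.subset_adjoin ⟨_, rfl⟩, rfl⟩, ?_⟩
  dsimp only
  rw [hs, hs, fourier_one, fourier_one]
  exact fun h => hi (AddCircle.injective_toCircle Real.two_pi_pos.ne' (Circle.ext h))

lemma span_planewave_closure_eq_top :
    (Submodule.span ℂ (Set.range (planewave (d := d)))).topologicalClosure = ⊤ := by
  have h1 : (Submodule.span ℂ (Set.range (expMonomial (d := d)))).topologicalClosure = ⊤ := by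
    rw [← span_expMonomial_eq_adjoin]
    exact congr_arg (Subalgebra.toSubmodule <| StarSubalgebra.toSubalgebra ·)
      (ContinuousMap.starSubalgebra_topologicalClosure_eq_top_of_separatesPoints
        (trigSubalgebra d) trigSubalgebra_separatesPoints)
  rw [eq_top_iff, ← h1]
  refine Submodule.topologicalClosure_mono (Submodule.span_le.2 ?_)
  rintro _ ⟨G, rfl⟩
  have hc : ((((2 * π) ^ (-(d : ℝ) / 2) : ℝ)) : ℂ) ≠ 0 := by
    rw [Complex.ofReal_ne_zero]
    exact (Real.rpow_pos_of_pos Real.two_pi_pos _).ne'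
  have : expMonomial G = ((((2 * π) ^ (-(d : ℝ) / 2) : ℝ)) : ℂ)⁻¹ • planewave G := by
    rw [planewave_eq_smul, smul_smul, inv_mul_cancel₀ hc, one_smul]
  rw [this]
  exact Submodule.smul_mem _ _ (Submodule.subset_span ⟨G, rfl⟩)

lemma orthonormal_planewaveL2 : Orthonormal ℂ (planewaveL2 (d := d)) :=
  orthonormal_iff_ite.2 inner_planewave

lemma span_planewaveL2_closure_eq_top :
    (Submodule.span ℂ (Set.range (planewaveL2 (d := d)))).topologicalClosure = ⊤ := by
  change (Submodule.span ℂ (Set.range fun G => ContinuousMap.toLp (E := ℂ) 2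
    (volume : Measure (Torus d)) ℂ (planewave G))).topologicalClosure = ⊤
  simpa only [Submodule.map_span, ContinuousLinearMap.coe_coe, ← Set.range_comp,
    Function.comp_def] using
    (ContinuousMap.toLp_denseRange ℂ (volume : Measure (Torus d)) ℂ
      (p := 2) (by simp)).topologicalClosure_map_submodule span_planewave_closure_eq_top

/-- The planewaves form a Hilbert basis of `L²`. -/
noncomputable def planewaveBasis (d : ℕ) : HilbertBasis (Freq d) ℂ (L2 d) :=
  HilbertBasis.mk orthonormal_planewaveL2 span_planewaveL2_closure_eq_top.ge

lemma coe_planewaveBasis : ⇑(planewaveBasis d) = planewaveL2 := HilbertBasis.coe_mk _ _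

lemma planewaveBasis_repr (u : L2 d) (G : Freq d) :
    (planewaveBasis d).repr u G = fourierCoef u G := by
  rw [HilbertBasis.repr_apply_apply, coe_planewaveBasis, fourierCoef_eq_inner]

/-- Parseval's identity. -/
lemma hasSum_fourierCoef_mul (u v : L2 d) :
    HasSum (fun G => conj (fourierCoef u G) * fourierCoef v G) (inner ℂ u v) := by
  have h := (planewaveBasis d).hasSum_inner_mul_inner u v
  rw [coe_planewaveBasis] at h
  refine h.congr_fun fun G => ?_
  rw [fourierCoef_eq_inner, fourierCoef_eq_inner, inner_conj_symm]

lemma conj_mul_self_eq (z : ℂ) : conj z * z = ((‖z‖ ^ 2 : ℝ) : ℂ) := by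
  rw [← Complex.normSq_eq_conj_mul_self, Complex.normSq_eq_norm_sq]

lemma hasSum_norm_fourierCoef_sq (u : L2 d) :
    HasSum (fun G => ‖fourierCoef u G‖ ^ 2) (‖u‖ ^ 2) := by
  have h := hasSum_fourierCoef_mul u u
  simp only [conj_mul_self_eq] at h
  rw [inner_self_eq_norm_sq_to_K] at h
  simpa [← Complex.ofReal_pow] using Complex.hasSum_re h

lemma ext_fourierCoef {u v : L2 d} (h : ∀ G, fourierCoef u G = fourierCoef v G) : u = v := by
  apply (planewaveBasis d).repr.injective
  ext G
  rw [planewaveBasis_repr, planewaveBasis_repr, h]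

lemma fourierCoef_add (u v : L2 d) (G : Freq d) :
    fourierCoef (u + v : L2 d) G = fourierCoef u G + fourierCoef v G := by
  simp only [fourierCoef_eq_inner, inner_add_right]

lemma fourierCoef_sub (u v : L2 d) (G : Freq d) :
    fourierCoef (u - v : L2 d) G = fourierCoef u G - fourierCoef v G := by
  simp only [fourierCoef_eq_inner, inner_sub_right]

lemma fourierCoef_smul (c : ℂ) (u : L2 d) (G : Freq d) :
    fourierCoef (c • u : L2 d) G = c * fourierCoef u G := by
  simp only [fourierCoef_eq_inner, inner_smul_right]

/-- Square summable families are families of Fourier coefficients (Riesz–Fischer). -/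
lemma exists_fourierCoef_eq {c : Freq d → ℂ} (hc : Summable fun G => ‖c G‖ ^ 2) :
    ∃ u : L2 d, ∀ G, fourierCoef u G = c G := by
  have hm : Memℓp c 2 := by
    rw [memℓp_gen_iff (by norm_num)]
    simpa using hc
  refine ⟨(planewaveBasis d).repr.symm ⟨c, hm⟩, fun G => ?_⟩
  rw [← planewaveBasis_repr, LinearIsometryEquiv.apply_symm_apply]

lemma exists_mem_H1 {c : Freq d → ℂ} (hc : c ∈ Hp d 1) :
    ∃ u ∈ H1 d, ∀ G, fourierCoef u G = c G := by
  obtain ⟨u, hu⟩ := exists_fourierCoef_eq (c := c) (by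
    refine Summable.of_nonneg_of_le (fun _ => sq_nonneg _) (fun G => ?_) hc.1
    rw [Real.rpow_one]
    have := normSq_nonneg G
    nlinarith [sq_nonneg ‖c G‖])
  refine ⟨u, ?_, hu⟩
  change (fun G => fourierCoef u G) ∈ Hp d 1
  simpa only [funext hu] using hc

lemma fourierCoef_neg_of_mem_H1 {u : L2 d} (hu : u ∈ H1 d) (G : Freq d) :
    fourierCoef u (-G) = conj (fourierCoef u G) := hu.2 G

lemma summable_of_mem_H1 {u : L2 d} (hu : u ∈ H1 d) :
    Summable fun G => (1 + normSq G) * ‖fourierCoef u G‖ ^ 2 := by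
  have := hu.1
  simp only [Real.rpow_one] at this
  exact this

/-! ### Real-valuedness -/

lemma conj_ae_eq_of_mem_H1 {u : L2 d} (hu : u ∈ H1 d) : ∀ᵐ x, conj (u x) = u x := by
  have h : star u = u := by
    refine ext_fourierCoef fun G => ?_
    rw [← Complex.conj_conj (fourierCoef u G), ← fourierCoef_neg_of_mem_H1 hu, fourierCoef,
      fourierCoef, ← integral_conj]
    refine integral_congr_ae ?_
    filter_upwards [Lp.coeFn_star u] with x hx
    rw [hx, planewave_neg]
    simp
  filter_upwards [Lp.coeFn_star u] with x hx
  rw [h] at hx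
  exact hx.symm

lemma inner_real_eq_re (u v : L2 d) : inner ℝ u v = (inner ℂ u v).re := by
  rw [L2.inner_def, L2.inner_def]
  have := integral_re (L2.integrable_inner (𝕜 := ℂ) u v)
  refine Eq.trans ?_ this
  rfl

lemma inner_eq_ofReal {u v : L2 d} (hu : u ∈ H1 d) (hv : v ∈ H1 d) :
    inner ℂ u v = ((inner ℝ u v : ℝ) : ℂ) := by
  rw [inner_real_eq_re]
  refine (Complex.conj_eq_iff_re.1 ?_).symm
  rw [L2.inner_def, ← integral_conj]
  refine integral_congr_ae ?_
  filter_upwards [conj_ae_eq_of_mem_H1 hu, conj_ae_eq_of_mem_H1 hv] with x h1 h2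
  simp only [RCLike.inner_apply, map_mul, h1, h2]

lemma normSq_neg (G : Freq d) : normSq (-G) = normSq G := by simp [normSq]

lemma energy_eq_ofReal (V : C(Torus d, ℝ)) {u v : L2 d} (hu : u ∈ H1 d) (hv : v ∈ H1 d) :
    energy V u v = (((energy V u v).re : ℝ) : ℂ) := by
  refine (Complex.conj_eq_iff_re.1 ?_).symm
  rw [energy, map_add, Complex.conj_tsum, ← integral_conj]
  congr 1
  · rw [← (Equiv.neg (Freq d)).tsum_eq]
    refine tsum_congr fun G => ?_
    simp only [Equiv.neg_apply, normSq_neg, fourierCoef_neg_of_mem_H1 hu,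
      fourierCoef_neg_of_mem_H1 hv, map_mul, Complex.conj_conj, Complex.conj_ofReal]
  · refine integral_congr_ae ?_
    filter_upwards [conj_ae_eq_of_mem_H1 hu, conj_ae_eq_of_mem_H1 hv] with x h1 h2
    simp only [map_mul, h1, h2, Complex.conj_ofReal]

/-! ### Multiplication by the potential -/

lemma memLp_mul_potential (V : C(Torus d, ℝ)) (u : L2 d) :
    MemLp (fun x => (V x : ℂ) * u x) 2 volume := by
  refine (Lp.memLp u).of_le_mul (c := ‖V‖) ?_ (Filter.Eventually.of_forall fun x => ?_)
  · exact AEStronglyMeasurable.mul (by fun_prop) (Lp.aestronglyMeasurable u)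
  · rw [norm_mul, Complex.norm_real]
    gcongr
    exact V.norm_coe_le_norm x

/-- The product `V u` as an element of `L²`. -/
noncomputable def mulPotential (V : C(Torus d, ℝ)) (u : L2 d) : L2 d :=
  (memLp_mul_potential V u).toLp _

lemma coeFn_mulPotential (V : C(Torus d, ℝ)) (u : L2 d) :
    mulPotential V u =ᵐ[volume] fun x => (V x : ℂ) * u x := MemLp.coeFn_toLp _

lemma fourierCoef_mulPotential (V : C(Torus d, ℝ)) (u : L2 d) (G : Freq d) :
    fourierCoef (mulPotential V u) G = fourierCoef (fun x => (V x : ℂ) * u x) G := by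
  refine integral_congr_ae ?_
  filter_upwards [coeFn_mulPotential V u] with x hx
  rw [hx]

lemma inner_mulPotential (V : C(Torus d, ℝ)) (u v : L2 d) :
    inner ℂ (mulPotential V u) v = ∫ x, (V x : ℂ) * (conj (u x) * v x) := by
  rw [L2.inner_def]
  refine integral_congr_ae ?_
  filter_upwards [coeFn_mulPotential V u] with x hx
  simp only [RCLike.inner_apply, hx, map_mul, Complex.conj_ofReal]
  ring

lemma norm_mulPotential_le {V : C(Torus d, ℝ)} {c : ℝ} (hV : ∀ x, |V x| ≤ c) (u : L2 d) :
    ‖mulPotential V u‖ ≤ c * ‖u‖ := by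
  refine Lp.norm_le_mul_norm_of_ae_le_mul ?_
  filter_upwards [coeFn_mulPotential V u] with x hx
  rw [hx, norm_mul, Complex.norm_real]
  exact mul_le_mul_of_nonneg_right (hV x) (norm_nonneg _)

lemma energy_eq (V : C(Torus d, ℝ)) (u v : L2 d) : energy V u v =
    (∑' G, (normSq G : ℂ) * (conj (fourierCoef u G) * fourierCoef v G)) +
      inner ℂ (mulPotential V u) v := by
  rw [inner_mulPotential, energy]

lemma potential_self_re (V : C(Torus d, ℝ)) (u : L2 d) :
    (inner ℂ (mulPotential V u) u).re = ∫ x, V x * ‖u x‖ ^ 2 := by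
  rw [inner_mulPotential]
  refine (integral_re (𝕜 := ℂ) (integrable_potential V u u)).symm.trans ?_
  refine integral_congr_ae (Filter.Eventually.of_forall fun x => ?_)
  simp only [conj_mul_self_eq, ← Complex.ofReal_mul]
  rfl

lemma integrable_potential_norm_sq (V : C(Torus d, ℝ)) (u : L2 d) :
    Integrable fun x => V x * ‖u x‖ ^ 2 := by
  refine (integrable_potential V u u).re.congr (Filter.Eventually.of_forall fun x => ?_)
  simp only [conj_mul_self_eq, ← Complex.ofReal_mul]
  rfl

lemma integral_norm_sq_eq (u : L2 d) : ∫ x, ‖u x‖ ^ 2 = ‖u‖ ^ 2 := by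
  have h := potential_self_re (1 : C(Torus d, ℝ)) u
  simp only [ContinuousMap.one_apply, one_mul] at h
  rw [← h, inner_mulPotential]
  have h2 := inner_self_eq_norm_sq (𝕜 := ℂ) u
  rw [← h2, L2.inner_def]
  congr 1
  refine integral_congr_ae (Filter.Eventually.of_forall fun x => ?_)
  simp only [ContinuousMap.one_apply, Complex.ofReal_one, one_mul, RCLike.inner_apply]
  ring

lemma potential_self_bounds {V : C(Torus d, ℝ)} {a b : ℝ} (hV : ∀ x, a ≤ V x ∧ V x ≤ b)
    (u : L2 d) : a * ‖u‖ ^ 2 ≤ (inner ℂ (mulPotential V u) u).re ∧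
      (inner ℂ (mulPotential V u) u).re ≤ b * ‖u‖ ^ 2 := by
  have hi : Integrable fun x => ‖u x‖ ^ 2 := by
    simpa using integrable_potential_norm_sq (1 : C(Torus d, ℝ)) u
  rw [potential_self_re, ← integral_norm_sq_eq, ← integral_const_mul, ← integral_const_mul]
  constructor
  · exact integral_mono (hi.const_mul a) (integrable_potential_norm_sq V u)
      fun x => mul_le_mul_of_nonneg_right (hV x).1 (sq_nonneg _)
  · exact integral_mono (integrable_potential_norm_sq V u) (hi.const_mul b)
      fun x => mul_le_mul_of_nonneg_right (hV x).2 (sq_nonneg _)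

/-- The square of the norm of `H_p^1`. -/
noncomputable def h1Sq (u : L2 d) : ℝ := ∑' G, (1 + normSq G) * ‖fourierCoef u G‖ ^ 2

lemma summable_normSq_mul {u : L2 d} (hu : u ∈ H1 d) :
    Summable fun G => normSq G * ‖fourierCoef u G‖ ^ 2 := by
  refine Summable.of_nonneg_of_le (fun G => mul_nonneg (normSq_nonneg G) (sq_nonneg _))
    (fun G => ?_) (summable_of_mem_H1 hu)
  nlinarith [sq_nonneg ‖fourierCoef u G‖]

lemma h1Sq_eq {u : L2 d} (hu : u ∈ H1 d) :
    h1Sq u = ‖u‖ ^ 2 + ∑' G, normSq G * ‖fourierCoef u G‖ ^ 2 := by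
  rw [h1Sq, ← (hasSum_norm_fourierCoef_sq u).tsum_eq,
    ← (hasSum_norm_fourierCoef_sq u).summable.tsum_add (summable_normSq_mul hu)]
  exact tsum_congr fun G => by ring

lemma energy_self_re (V : C(Torus d, ℝ)) (u : L2 d) : (energy V u u).re =
    ∑' G, normSq G * ‖fourierCoef u G‖ ^ 2 + (inner ℂ (mulPotential V u) u).re := by
  rw [energy_eq, Complex.add_re]
  congr 1
  simp only [conj_mul_self_eq, ← Complex.ofReal_mul, ← Complex.ofReal_tsum, Complex.ofReal_re]

lemma energy_self_bounds {V : C(Torus d, ℝ)} {a b : ℝ} (hV : ∀ x, a ≤ V x ∧ V x ≤ b)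
    {u : L2 d} (hu : u ∈ H1 d) : min a 1 * h1Sq u ≤ (energy V u u).re ∧
      (energy V u u).re ≤ max b 1 * h1Sq u := by
  obtain ⟨h1, h2⟩ := potential_self_bounds hV u
  rw [energy_self_re, h1Sq_eq hu]
  have h3 : 0 ≤ ∑' G, normSq G * ‖fourierCoef u G‖ ^ 2 :=
    tsum_nonneg fun G => mul_nonneg (normSq_nonneg G) (sq_nonneg _)
  constructor
  · nlinarith [mul_le_mul_of_nonneg_right (min_le_left a 1) (sq_nonneg ‖u‖),
      mul_le_mul_of_nonneg_right (min_le_right a 1) h3]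
  · nlinarith [mul_le_mul_of_nonneg_right (le_max_left b 1) (sq_nonneg ‖u‖),
      mul_le_mul_of_nonneg_right (le_max_right b 1) h3]

end PlaneWave

noncomputable section

namespace PlaneWave

variable {d : ℕ}

/-! ### The energy space -/

/-- `H_p^1(Ω)` with the energy inner product `a(u, v)`. -/
def EnergySpace (V : C(Torus d, ℝ)) (_hV : ∀ x, 0 < V x) : Type := H1 d

namespace EnergySpace

variable {V : C(Torus d, ℝ)} {hV : ∀ x, 0 < V x}

instance : AddCommGroup (EnergySpace V hV) := inferInstanceAs (AddCommGroup (H1 d))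

instance : Module ℝ (EnergySpace V hV) := inferInstanceAs (Module ℝ (H1 d))

/-- The underlying function. -/
def toL2 : EnergySpace V hV →ₗ[ℝ] L2 d := (H1 d).subtype

/-- An element of `H_p^1(Ω)` as a vector of the energy space. -/
def of (hV : ∀ x, 0 < V x) (u : L2 d) (hu : u ∈ H1 d) : EnergySpace V hV := ⟨u, hu⟩

@[simp] lemma toL2_of (u : L2 d) (hu : u ∈ H1 d) : toL2 (of hV u hu) = u := rfl

lemma toL2_mem (u : EnergySpace V hV) : toL2 u ∈ H1 d := u.2

lemma toL2_injective : Function.Injective (toL2 : EnergySpace V hV →ₗ[ℝ] L2 d) :=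
  Subtype.val_injective

noncomputable instance core : InnerProductSpace.Core ℝ (EnergySpace V hV) where
  inner u v := (energy V (toL2 u) (toL2 v)).re
  conj_inner_symm u v := by
    rw [energy_symm V (toL2 u) (toL2 v)]
    simp
  re_inner_nonneg u := by
    have hb := (energy_self_bounds (a := 0) (b := ‖V‖)
      (fun x => ⟨(hV x).le, (le_abs_self _).trans (V.norm_coe_le_norm x)⟩) (toL2_mem u)).1
    simpa using hb
  add_left u v w := by
    rw [map_add, energy_add_left V (toL2_mem u) (toL2_mem v) (toL2_mem w), Complex.add_re]
  smul_left u v c := by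
    have hr : toL2 (c • u) = (c : ℂ) • toL2 u := by
      rw [map_smul]
      exact (Complex.coe_smul c (toL2 u)).symm
    rw [hr, energy_smul_left]
    simp
  definite u h := by
    apply toL2_injective
    rw [map_zero]
    apply eq_zero_of_energy_eq_zero hV
    rw [energy_eq_ofReal V (toL2_mem u) (toL2_mem u), h, Complex.ofReal_zero]

noncomputable instance : NormedAddCommGroup (EnergySpace V hV) := core.toNormedAddCommGroup

noncomputable instance : InnerProductSpace ℝ (EnergySpace V hV) := InnerProductSpace.ofCore _

lemma inner_eq (u v : EnergySpace V hV) : inner ℝ u v = (energy V (toL2 u) (toL2 v)).re := rfl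

lemma energy_eq_inner (u v : EnergySpace V hV) :
    energy V (toL2 u) (toL2 v) = ((inner ℝ u v : ℝ) : ℂ) :=
  energy_eq_ofReal V (toL2_mem u) (toL2_mem v)

lemma energyNorm_eq (u : EnergySpace V hV) : energyNorm V (toL2 u) = ‖u‖ := by
  rw [energyNorm, ← inner_eq, real_inner_self_eq_norm_sq, Real.sqrt_sq (norm_nonneg u)]

lemma norm_sq_eq (u : EnergySpace V hV) : ‖u‖ ^ 2 = (energy V (toL2 u) (toL2 u)).re := by
  rw [← real_inner_self_eq_norm_sq, inner_eq]

lemma norm_sq_bounds {a b : ℝ} (h : ∀ x, a ≤ V x ∧ V x ≤ b) (u : EnergySpace V hV) :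
    min a 1 * h1Sq (toL2 u) ≤ ‖u‖ ^ 2 ∧ ‖u‖ ^ 2 ≤ max b 1 * h1Sq (toL2 u) := by
  rw [norm_sq_eq]
  exact energy_self_bounds h (toL2_mem u)

end EnergySpace

lemma exists_potential_bounds {V : C(Torus d, ℝ)} (hV : ∀ x, 0 < V x) :
    ∃ a b : ℝ, 0 < a ∧ 0 < b ∧ ∀ x, a ≤ V x ∧ V x ≤ b := by
  obtain ⟨x, -, hx⟩ := isCompact_univ.exists_isMinOn (Set.univ_nonempty (α := Torus d))
    V.continuous.continuousOn
  refine ⟨V x, ‖V‖, hV x, ?_, fun y => ⟨hx (Set.mem_univ y),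
    (le_abs_self _).trans (V.norm_coe_le_norm y)⟩⟩
  exact (hV x).trans_le ((le_abs_self _).trans (V.norm_coe_le_norm x))

lemma norm_sq_le_h1Sq {u : L2 d} (hu : u ∈ H1 d) : ‖u‖ ^ 2 ≤ h1Sq u := by
  rw [h1Sq_eq hu]
  have h : 0 ≤ ∑' G, normSq G * ‖fourierCoef u G‖ ^ 2 :=
    tsum_nonneg fun G => mul_nonneg (normSq_nonneg G) (sq_nonneg _)
  linarith

namespace EnergySpace

variable {V : C(Torus d, ℝ)} {hV : ∀ x, 0 < V x}

lemma continuous_toL2 : Continuous (toL2 : EnergySpace V hV →ₗ[ℝ] L2 d) := by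
  obtain ⟨a, b, ha, hb, h⟩ := exists_potential_bounds hV
  have hm : 0 < min a 1 := lt_min ha one_pos
  refine AddMonoidHomClass.continuous_of_bound _ (√(min a 1))⁻¹ fun u => ?_
  refine abs_le_of_sq_le_sq' ?_ (by positivity) |>.2
  rw [mul_pow, inv_pow, Real.sq_sqrt hm.le, inv_mul_eq_div, le_div_iff₀' hm]
  exact (mul_le_mul_of_nonneg_left (norm_sq_le_h1Sq (toL2_mem u)) hm.le).trans
    (norm_sq_bounds h u).1

/-- The inclusion of `H_p^1(Ω)` into `L²`. -/
noncomputable def incl (V : C(Torus d, ℝ)) (hV : ∀ x, 0 < V x) : EnergySpace V hV →L[ℝ] L2 d :=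
  ⟨toL2, continuous_toL2⟩

lemma incl_apply (u : EnergySpace V hV) : incl V hV u = toL2 u := rfl

lemma incl_injective : Function.Injective (incl V hV) := toL2_injective

/-- The weighted Fourier coefficients `(1 + |G|²)^{1/2} û_G`. -/
noncomputable def weightedCoef (u : L2 d) (G : Freq d) : ℂ :=
  (√(1 + normSq G) : ℝ) * fourierCoef u G

lemma norm_weightedCoef_sq (u : L2 d) (G : Freq d) :
    ‖weightedCoef u G‖ ^ 2 = (1 + normSq G) * ‖fourierCoef u G‖ ^ 2 := by
  have := normSq_nonneg G
  rw [weightedCoef, norm_mul, Complex.norm_real, mul_pow, Real.norm_eq_abs, sq_abs,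
    Real.sq_sqrt (by linarith)]

/-- The energy norm is equivalent to the norm of `H_p^1`, and the weighted Fourier coefficients
identify `H_p^1` with a closed subspace of `ℓ²`. -/
instance : CompleteSpace (EnergySpace V hV) := by
  obtain ⟨a, b, ha, hb, h⟩ := exists_potential_bounds hV
  have hm : 0 < min a 1 := lt_min ha one_pos
  have hM : 0 < max b 1 := lt_max_of_lt_left hb
  have hmem : ∀ u : EnergySpace V hV, Memℓp (weightedCoef (toL2 u)) 2 := fun u => by
    rw [memℓp_gen_iff (by norm_num)]
    simpa [norm_weightedCoef_sq] using summable_of_mem_H1 (toL2_mem u)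
  let Φ : EnergySpace V hV → lp (fun _ : Freq d => ℂ) 2 := fun u => ⟨_, hmem u⟩
  have hΦ : ∀ u v, ‖Φ u - Φ v‖ ^ 2 = h1Sq (toL2 (u - v)) := fun u v => by
    have h1 := lp.norm_rpow_eq_tsum (p := 2) (by norm_num) (Φ u - Φ v)
    simp only [ENNReal.toReal_ofNat, Real.rpow_ofNat] at h1
    rw [h1, h1Sq]
    refine tsum_congr fun G => ?_
    rw [← norm_weightedCoef_sq]
    congr 2
    change weightedCoef (toL2 u) G - weightedCoef (toL2 v) G = _
    rw [weightedCoef, weightedCoef, weightedCoef, map_sub, fourierCoef_sub, mul_sub]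
  refine Metric.complete_of_cauchySeq_tendsto fun s hs => ?_
  have hcau : CauchySeq fun n => Φ (s n) := by
    rw [Metric.cauchySeq_iff'] at hs ⊢
    intro ε hε
    obtain ⟨N, hN⟩ := hs (√(min a 1) * ε) (mul_pos (Real.sqrt_pos.2 hm) hε)
    refine ⟨N, fun n hn => ?_⟩
    have h1 := hN n hn
    rw [dist_eq_norm] at h1 ⊢
    have h2 := (norm_sq_bounds h (s n - s N)).1
    rw [← hΦ] at h2
    have h3 : √(min a 1) * ‖Φ (s n) - Φ (s N)‖ ≤ ‖s n - s N‖ := by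
      refine abs_le_of_sq_le_sq' ?_ (norm_nonneg _) |>.2
      rwa [mul_pow, Real.sq_sqrt hm.le]
    exact lt_of_mul_lt_mul_left (h3.trans_lt h1) (Real.sqrt_nonneg _)
  obtain ⟨c, hc⟩ := cauchySeq_tendsto_of_complete hcau
  have hpos : ∀ G : Freq d, 0 < √(1 + normSq G) := fun G =>
    Real.sqrt_pos.2 (by linarith [normSq_nonneg G])
  have hcw : (fun G => ((√(1 + normSq G) : ℝ) : ℂ)⁻¹ * c G) ∈ Hp d 1 := by
    refine ⟨?_, fun G => ?_⟩
    · have h1 := lp.memℓp c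
      rw [memℓp_gen_iff (by norm_num)] at h1
      simp only [ENNReal.toReal_ofNat, Real.rpow_ofNat] at h1
      refine h1.congr fun G => ?_
      have h2 : 0 < 1 + normSq G := by linarith [normSq_nonneg G]
      rw [norm_mul, norm_inv, Complex.norm_real, mul_pow, inv_pow, Real.norm_eq_abs, sq_abs,
        Real.sq_sqrt h2.le, Real.rpow_one]
      field_simp
    · have hcoord : ∀ G, Filter.Tendsto (fun n => Φ (s n) G) Filter.atTop (nhds (c G)) := fun G =>
        tendsto_pi_nhds.1 ((lp.uniformContinuous_coe (E := fun _ : Freq d => ℂ)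
          (p := 2)).continuous.tendsto c |>.comp hc) G
      have h1 : c (-G) = conj (c G) := by
        refine tendsto_nhds_unique (hcoord (-G))
          (((Complex.continuous_conj.tendsto _).comp (hcoord G)).congr fun n => ?_)
        change conj (weightedCoef (toL2 (s n)) G) = weightedCoef (toL2 (s n)) (-G)
        rw [weightedCoef, weightedCoef, normSq_neg, fourierCoef_neg_of_mem_H1 (toL2_mem _), map_mul,
          Complex.conj_ofReal]
      simp only [normSq_neg, h1, map_mul, map_inv₀, Complex.conj_ofReal]
  obtain ⟨u, hu, huc⟩ := exists_mem_H1 hcw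
  refine ⟨of hV u hu, ?_⟩
  have hΦu : Φ (of hV u hu) = c := by
    ext G
    change weightedCoef (toL2 (of hV u hu)) G = c G
    have h0 : ((√(1 + normSq G) : ℝ) : ℂ) ≠ 0 := Complex.ofReal_ne_zero.2 (hpos G).ne'
    rw [toL2_of, weightedCoef, huc, mul_inv_cancel_left₀ h0]
  rw [tendsto_iff_norm_sub_tendsto_zero] at hc ⊢
  refine squeeze_zero (g := fun n => √(max b 1) * ‖Φ (s n) - c‖) (fun _ => norm_nonneg _)
    (fun n => ?_) (by simpa using hc.const_mul (√(max b 1)))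
  refine abs_le_of_sq_le_sq' ?_ (by positivity) |>.2
  rw [mul_pow, Real.sq_sqrt hM.le, ← hΦu, hΦ]
  exact (norm_sq_bounds h _).2

end EnergySpace

open EnergySpace

/-! ### Planewave spaces -/

lemma mem_span_planewave_iff {𝔾 : Finset (Freq d)} {u : L2 d} :
    u ∈ Submodule.span ℂ (planewaveL2 '' (𝔾 : Set (Freq d))) ↔
      ∀ G ∉ 𝔾, fourierCoef u G = 0 := by
  constructor
  · intro hu
    rw [Set.image_eq_range] at hu
    obtain ⟨x, rfl⟩ := (Submodule.mem_span_range_iff_exists_fun ℂ).1 hu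
    intro G hG
    exact (fourierCoef_sum 𝔾 x G).trans (dif_neg hG)
  · intro hu
    have : u = ∑ G : 𝔾, fourierCoef u (G : Freq d) • planewaveL2 (G : Freq d) := by
      refine ext_fourierCoef fun G => ?_
      rw [fourierCoef_sum 𝔾 (fun G => fourierCoef u (G : Freq d)) G]
      split_ifs with h
      · rfl
      · exact hu G h
    rw [this]
    exact Submodule.sum_mem _ fun G _ => Submodule.smul_mem _ _
      (Submodule.subset_span ⟨G, G.2, rfl⟩)

lemma mem_VG_iff {𝔾 : Finset (Freq d)} {u : L2 d} :
    u ∈ VG 𝔾 ↔ u ∈ H1 d ∧ ∀ G ∉ 𝔾, fourierCoef u G = 0 := by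
  rw [VG, Submodule.mem_inf, Submodule.restrictScalars_mem, mem_span_planewave_iff, and_comm]

lemma VG_le_H1 (𝔾 : Finset (Freq d)) : VG 𝔾 ≤ H1 d := inf_le_right

lemma VG_mono {𝔾 𝔾' : Finset (Freq d)} (h : 𝔾 ⊆ 𝔾') : VG 𝔾 ≤ VG 𝔾' := fun _ hu => by
  rw [mem_VG_iff] at hu ⊢
  exact ⟨hu.1, fun G hG => hu.2 G fun h' => hG (h h')⟩

/-- Prescribed coefficients on a symmetric finite set of frequencies. -/
lemma exists_mem_VG {𝔾 : Finset (Freq d)} (h𝔾 : IsSymm 𝔾) (c : Freq d → ℂ)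
    (hc : ∀ G ∈ 𝔾, c (-G) = conj (c G)) :
    ∃ u ∈ VG 𝔾, ∀ G, fourierCoef u G = (𝔾 : Set (Freq d)).indicator c G := by
  obtain ⟨u, hu, huc⟩ := exists_mem_H1 (c := (𝔾 : Set (Freq d)).indicator c) (by
    refine ⟨summable_of_ne_finset_zero (s := 𝔾) fun G hG => ?_, fun G => ?_⟩
    · rw [Set.indicator_of_notMem (by exact_mod_cast hG)]
      simp
    · by_cases hG : G ∈ 𝔾
      · have hG' := (h𝔾 G).1 hG
        rw [Set.indicator_of_mem (Finset.mem_coe.2 hG'), Set.indicator_of_mem (Finset.mem_coe.2 hG),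
          hc G hG]
      · have hG' := fun h => hG ((h𝔾 G).2 h)
        rw [Set.indicator_of_notMem (fun h => hG' (Finset.mem_coe.1 h)),
          Set.indicator_of_notMem (fun h => hG (Finset.mem_coe.1 h)), map_zero])
  refine ⟨u, mem_VG_iff.2 ⟨hu, fun G hG => ?_⟩, huc⟩
  rw [huc, Set.indicator_of_notMem (by exact_mod_cast hG)]

instance finiteDimensional_VG (𝔾 : Finset (Freq d)) : FiniteDimensional ℝ (VG 𝔾) := by
  have h1 : FiniteDimensional ℂ (Submodule.span ℂ (planewaveL2 '' (𝔾 : Set (Freq d)))) :=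
    FiniteDimensional.span_of_finite ℂ (𝔾.finite_toSet.image _)
  have h2 : FiniteDimensional ℝ ((Submodule.span ℂ
      (planewaveL2 '' (𝔾 : Set (Freq d)))).restrictScalars ℝ) :=
    Module.Finite.trans (R := ℝ) ℂ (Submodule.span ℂ (planewaveL2 '' (𝔾 : Set (Freq d))))
  exact Submodule.finiteDimensional_of_le (inf_le_left : VG 𝔾 ≤ _)

variable {V : C(Torus d, ℝ)} {hV : ∀ x, 0 < V x}

/-- `V_𝔾` as a subspace of the energy space. -/
def pwSpace (hV : ∀ x, 0 < V x) (𝔾 : Finset (Freq d)) : Submodule ℝ (EnergySpace V hV) :=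
  (VG 𝔾).comap toL2

lemma mem_pwSpace {𝔾 : Finset (Freq d)} {u : EnergySpace V hV} :
    u ∈ pwSpace hV 𝔾 ↔ toL2 u ∈ VG 𝔾 := Iff.rfl

instance finiteDimensional_pwSpace (𝔾 : Finset (Freq d)) :
    FiniteDimensional ℝ (pwSpace hV 𝔾) := by
  let f : pwSpace hV 𝔾 →ₗ[ℝ] VG 𝔾 := toL2.restrict fun u hu => hu
  refine Module.Finite.of_injective f fun u v h => ?_
  exact Subtype.ext (toL2_injective (congrArg (fun w : VG 𝔾 => (w : L2 d)) h))

lemma pwSpace_mono {𝔾 𝔾' : Finset (Freq d)} (h : 𝔾 ⊆ 𝔾') : pwSpace hV 𝔾 ≤ pwSpace hV 𝔾' :=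
  fun _ hu => VG_mono h hu

lemma isSymm_ballFreq (M : ℕ) : IsSymm (ballFreq d M) := fun G => by
  rw [mem_ballFreq, mem_ballFreq, normSq_neg]

lemma ballFreq_mono {M M' : ℕ} (h : M ≤ M') : ballFreq d M ⊆ ballFreq d M' := fun G hG => by
  rw [mem_ballFreq] at hG ⊢
  exact hG.trans (by exact_mod_cast h)

lemma mulPotential_sub (V : C(Torus d, ℝ)) (u v : L2 d) :
    mulPotential V (u - v) = mulPotential V u - mulPotential V v := by
  apply Lp.ext
  filter_upwards [coeFn_mulPotential V (u - v), coeFn_mulPotential V u, coeFn_mulPotential V v,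
    Lp.coeFn_sub u v, Lp.coeFn_sub (mulPotential V u) (mulPotential V v)] with x h1 h2 h3 h4 h5
  simp only [h1, h5, h4, Pi.sub_apply, h2, h3, mul_sub]

/-- On the energy-orthogonal complement of `V_𝔾` the `L²` norm is small relative to the energy
norm. Testing the orthogonality with the truncation `Π_M u` bounds `Π_M u` by the tail
`u - Π_M u`. -/
lemma norm_le_of_mem_orthogonal {a b : ℝ} (ha : 0 < a) (hab : ∀ x, a ≤ V x ∧ V x ≤ b) {M : ℕ}
    {𝔾 : Finset (Freq d)} (hM : ballFreq d M ⊆ 𝔾) {u : EnergySpace V hV}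
    (hu : u ∈ (pwSpace hV 𝔾)ᗮ) :
    ‖incl V hV u‖ ≤ (1 + b / a) / (√(min a 1) * √(1 + (M : ℝ) ^ 2)) * ‖u‖ := by
  have hb : 0 < b := ha.trans_le ((hab 0).1.trans (hab 0).2)
  have hm : 0 < min a 1 := lt_min ha one_pos
  set w : L2 d := toL2 u with hw
  obtain ⟨p, hp, hpc⟩ := exists_mem_VG (isSymm_ballFreq M) (fourierCoef w)
    fun G _ => fourierCoef_neg_of_mem_H1 (toL2_mem u) G
  have hpH : p ∈ H1 d := VG_le_H1 _ hp
  set h : L2 d := w - p with hh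
  have horth : (energy V w p).re = 0 := by
    have h1 := (Submodule.mem_orthogonal' _ _).1 hu (of hV p hpH) (VG_mono hM hp)
    rwa [inner_eq] at h1
  -- `p = Π_M u` is the truncation and `h` the tail; they interact only through the potential
  have hVh : mulPotential V w = mulPotential V p + mulPotential V h := by
    rw [hh, mulPotential_sub]
    abel
  have hgrad : 0 ≤ (∑' G, (normSq G : ℂ) * (conj (fourierCoef w G) * fourierCoef p G)).re := by
    have : ∀ G, (normSq G : ℂ) * (conj (fourierCoef w G) * fourierCoef p G) =
        ((normSq G * ‖fourierCoef p G‖ ^ 2 : ℝ) : ℂ) := fun G => by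
      rw [Complex.ofReal_mul, ← conj_mul_self_eq, hpc]
      by_cases hG : G ∈ (ballFreq d M : Set (Freq d))
      · rw [Set.indicator_of_mem hG]
      · rw [Set.indicator_of_notMem hG]
        simp
    simp only [this, ← Complex.ofReal_tsum, Complex.ofReal_re]
    exact tsum_nonneg fun G => mul_nonneg (normSq_nonneg G) (sq_nonneg _)
  have hlow := (potential_self_bounds hab p).1
  have hcross : -(b * ‖h‖ * ‖p‖) ≤ (inner ℂ (mulPotential V h) p).re := by
    have h1 := norm_inner_le_norm (𝕜 := ℂ) (mulPotential V h) p
    have h2 := norm_mulPotential_le (c := b) (V := V)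
      (fun x => abs_le.2 ⟨by linarith [(hab x).1], (hab x).2⟩) h
    have h3 := (abs_le.1 (Complex.abs_re_le_norm (inner ℂ (mulPotential V h) p))).1
    have h4 := mul_le_mul_of_nonneg_right h2 (norm_nonneg p)
    linarith
  have hpb : ‖p‖ ≤ b / a * ‖h‖ := by
    rw [energy_eq, Complex.add_re, hVh, inner_add_left, Complex.add_re] at horth
    have h1 : a * ‖p‖ ^ 2 ≤ b * ‖h‖ * ‖p‖ := by linarith
    rcases (norm_nonneg p).eq_or_lt with h0 | h0
    · rw [← h0]
      positivity
    · rw [div_mul_eq_mul_div, le_div_iff₀ ha]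
      nlinarith
  -- the frequencies of the tail exceed `M`
  have htail : √(1 + (M : ℝ) ^ 2) * ‖h‖ ≤ (√(min a 1))⁻¹ * ‖u‖ := by
    refine abs_le_of_sq_le_sq' ?_ (by positivity) |>.2
    rw [mul_pow, mul_pow, inv_pow, Real.sq_sqrt hm.le, Real.sq_sqrt (by positivity),
      inv_mul_eq_div, le_div_iff₀' hm]
    refine le_trans ?_ (norm_sq_bounds hab u).1
    refine mul_le_mul_of_nonneg_left ?_ hm.le
    rw [← (hasSum_norm_fourierCoef_sq h).tsum_eq, ← tsum_mul_left, h1Sq]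
    refine Summable.tsum_le_tsum (fun G => ?_)
      ((hasSum_norm_fourierCoef_sq h).summable.mul_left _) (summable_of_mem_H1 (toL2_mem u))
    rw [hh, fourierCoef_sub, hpc]
    by_cases hG : G ∈ ballFreq d M
    · rw [Set.indicator_of_mem (Finset.mem_coe.2 hG), sub_self, norm_zero]
      have := normSq_nonneg G
      simp only [ne_eq, OfNat.ofNat_ne_zero, not_false_eq_true, zero_pow, mul_zero]
      positivity
    · rw [Set.indicator_of_notMem (fun h => hG (Finset.mem_coe.1 h)), sub_zero]
      rw [mem_ballFreq, Real.sqrt_le_left (Nat.cast_nonneg M)] at hG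
      refine mul_le_mul_of_nonneg_right ?_ (sq_nonneg _)
      linarith
  have hsum : ‖incl V hV u‖ ≤ (1 + b / a) * ‖h‖ := by
    have : incl V hV u = p + h := by rw [incl_apply, hh]; abel
    rw [this]
    linarith [norm_add_le p h]
  have hMpos : 0 < √(1 + (M : ℝ) ^ 2) := Real.sqrt_pos.2 (by positivity)
  have hh2 : ‖h‖ ≤ (√(min a 1))⁻¹ * ‖u‖ / √(1 + (M : ℝ) ^ 2) := by
    rwa [le_div_iff₀' hMpos]
  calc _ ≤ (1 + b / a) * ‖h‖ := hsum
    _ ≤ (1 + b / a) * ((√(min a 1))⁻¹ * ‖u‖ / √(1 + (M : ℝ) ^ 2)) := by gcongr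
    _ = _ := by
      have := Real.sqrt_pos.2 hm
      field_simp

/-- The space `V_𝔾` resolves the energy space up to any given accuracy, measured by the ratio of
the `L²` norm to the energy norm on its orthogonal complement, once `𝔾` contains a large ball. -/
lemma exists_ball_norm_le (hV : ∀ x, 0 < V x) {ε : ℝ} (hε : 0 < ε) :
    ∃ M : ℕ, ∀ 𝔾 : Finset (Freq d), ballFreq d M ⊆ 𝔾 →
      ∀ u ∈ (pwSpace hV 𝔾)ᗮ, ‖incl V hV u‖ ≤ ε * ‖u‖ := by
  obtain ⟨a, b, ha, hb, hab⟩ := exists_potential_bounds hV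
  have hm : 0 < √(min a 1) := Real.sqrt_pos.2 (lt_min ha one_pos)
  obtain ⟨M, hM⟩ := exists_nat_ge ((1 + b / a) / √(min a 1) / ε)
  refine ⟨M, fun 𝔾 h𝔾 u hu => (norm_le_of_mem_orthogonal ha hab h𝔾 hu).trans ?_⟩
  refine mul_le_mul_of_nonneg_right ?_ (norm_nonneg _)
  have h1 : (M : ℝ) ≤ √(1 + (M : ℝ) ^ 2) := Real.le_sqrt_of_sq_le (by linarith)
  have h2 : 0 < √(1 + (M : ℝ) ^ 2) := Real.sqrt_pos.2 (by positivity)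
  rw [← div_div, div_le_iff₀ h2]
  rw [div_le_iff₀ hε] at hM
  calc _ ≤ M * ε := hM
    _ ≤ _ := by
      rw [mul_comm]
      gcongr

lemma smallOffFinite_incl : SmallOffFinite (incl V hV) := fun ε hε => by
  obtain ⟨M, hM⟩ := exists_ball_norm_le hV hε
  exact ⟨pwSpace hV (ballFreq d M), inferInstance, hM _ subset_rfl⟩

lemma bestError_eq {𝔾 : Finset (Freq d)} (u : EnergySpace V hV) :
    bestError V (toL2 u) 𝔾 = ‖u - (pwSpace hV 𝔾).starProjection u‖ := by
  rw [bestError]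
  have hlow : ∀ v : VG 𝔾, ‖u - (pwSpace hV 𝔾).starProjection u‖ ≤
      energyNorm V (toL2 u - (v : L2 d)) := fun v => by
    have hv := VG_le_H1 _ v.2
    have e : toL2 u - (v : L2 d) = toL2 (u - of hV v hv) := by rw [map_sub, toL2_of]
    rw [e, energyNorm_eq, Submodule.starProjection_minimal]
    exact ciInf_le ⟨0, by rintro _ ⟨w, rfl⟩; exact norm_nonneg _⟩
      (⟨of hV v hv, v.2⟩ : pwSpace hV 𝔾)
  refine le_antisymm ?_ (le_ciInf hlow)
  refine (ciInf_le ⟨_, by rintro _ ⟨w, rfl⟩; exact hlow w⟩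
    (⟨toL2 ((pwSpace hV 𝔾).starProjection u), (pwSpace hV 𝔾).starProjection_apply_mem u⟩ :
      VG 𝔾)).trans_eq ?_
  rw [← energyNorm_eq, map_sub]

/-! ### The eigenvalue problems in the energy space -/

lemma inner_eq_inner_incl (u v : EnergySpace V hV) :
    inner ℂ (toL2 u) (toL2 v) = ((inner ℝ (incl V hV u) (incl V hV v) : ℝ) : ℂ) :=
  inner_eq_ofReal (toL2_mem u) (toL2_mem v)

lemma energy_eq_iff (u v : EnergySpace V hV) (μ : ℝ) :
    energy V (toL2 u) (toL2 v) = μ * inner ℂ (toL2 u) (toL2 v) ↔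
      inner ℝ u v = μ * inner ℝ (incl V hV u) (incl V hV v) := by
  rw [energy_eq_inner, inner_eq_inner_incl, ← Complex.ofReal_mul, Complex.ofReal_inj]

lemma toL2_mem_eigenspace_H1 {u : EnergySpace V hV} {μ : ℝ} :
    toL2 u ∈ eigenspace V (H1 d) μ ↔ u ∈ genEig (incl V hV) μ := by
  constructor
  · rintro ⟨-, h⟩ v
    exact (energy_eq_iff u v μ).1 (h _ ⟨toL2_mem v, toL2_mem v⟩)
  · intro h
    refine ⟨⟨toL2_mem u, toL2_mem u⟩, fun v hv => ?_⟩
    exact (energy_eq_iff u (of hV v hv.1) μ).2 (h _)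

lemma toL2_mem_eigenspace_VG {𝔾 : Finset (Freq d)} {u : EnergySpace V hV} {μ : ℝ} :
    toL2 u ∈ eigenspace V (VG 𝔾) μ ↔ u ∈ pwSpace hV 𝔾 ∧
      ∀ v ∈ pwSpace hV 𝔾, inner ℝ u v = μ * inner ℝ (incl V hV u) (incl V hV v) := by
  constructor
  · rintro ⟨h0, h⟩
    exact ⟨h0.1, fun v hv => (energy_eq_iff u v μ).1 (h _ ⟨hv, toL2_mem v⟩)⟩
  · rintro ⟨h0, h⟩
    refine ⟨⟨h0, toL2_mem u⟩, fun v hv => ?_⟩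
    exact (energy_eq_iff u (of hV v hv.2) μ).2 (h _ hv.1)

lemma eigenspace_le_H1 (W : Submodule ℝ (L2 d)) (μ : ℝ) : eigenspace V W μ ≤ H1 d :=
  fun _ hu => hu.1.2

lemma eigenspace_H1_eq_map (μ : ℝ) :
    eigenspace V (H1 d) μ = (genEig (incl V hV) μ).map toL2 := by
  ext u
  constructor
  · intro hu
    exact ⟨of hV u (eigenspace_le_H1 _ _ hu), toL2_mem_eigenspace_H1.1 hu, rfl⟩
  · rintro ⟨u, hu, rfl⟩
    exact toL2_mem_eigenspace_H1.2 hu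

/-- The restriction of the inclusion to `V_𝔾`. -/
def pwIncl (hV : ∀ x, 0 < V x) (𝔾 : Finset (Freq d)) : pwSpace hV 𝔾 →L[ℝ] L2 d :=
  incl V hV ∘L (pwSpace hV 𝔾).subtypeL

lemma pwIncl_injective (𝔾 : Finset (Freq d)) : Function.Injective (pwIncl hV 𝔾) :=
  incl_injective.comp Subtype.val_injective

lemma eigenspace_VG_eq_map (𝔾 : Finset (Freq d)) (μ : ℝ) :
    eigenspace V (VG 𝔾) μ = (genEig (pwIncl hV 𝔾) μ).map
      (toL2 ∘ₗ (pwSpace hV 𝔾).subtype) := by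
  ext u
  constructor
  · intro hu
    have h1 : of hV u (eigenspace_le_H1 _ _ hu) ∈ pwSpace hV 𝔾 := hu.1.1
    refine ⟨⟨_, h1⟩, fun v => ?_, rfl⟩
    have h2 : toL2 (of hV u (eigenspace_le_H1 _ _ hu)) ∈ eigenspace V (VG 𝔾) μ := hu
    exact (toL2_mem_eigenspace_VG.1 h2).2 v v.2
  · rintro ⟨u, hu, rfl⟩
    exact toL2_mem_eigenspace_VG.2 ⟨u.2, fun v hv => hu ⟨v, hv⟩⟩

lemma eigenCount_H1 (hV : ∀ x, 0 < V x) (μ : ℝ) :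
    eigenCount V (H1 d) μ = Module.finrank ℝ (eigSum (incl V hV) μ) := by
  have h : (⨆ ν : Set.Iic μ, eigenspace V (H1 d) ν) = (eigSum (incl V hV) μ).map toL2 := by
    rw [eigSum, Submodule.map_iSup]
    exact iSup_congr fun ν => eigenspace_H1_eq_map _
  rw [eigenCount, h]
  exact (Submodule.equivMapOfInjective _ toL2_injective _).finrank_eq.symm

lemma eigenCount_VG (hV : ∀ x, 0 < V x) (𝔾 : Finset (Freq d)) (μ : ℝ) :
    eigenCount V (VG 𝔾) μ = Module.finrank ℝ (eigSum (pwIncl hV 𝔾) μ) := by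
  have h : (⨆ ν : Set.Iic μ, eigenspace V (VG 𝔾) ν) =
      (eigSum (pwIncl hV 𝔾) μ).map (toL2 ∘ₗ (pwSpace hV 𝔾).subtype) := by
    rw [eigSum, Submodule.map_iSup]
    exact iSup_congr fun ν => eigenspace_VG_eq_map _ _
  rw [eigenCount, h]
  exact (Submodule.equivMapOfInjective _ (pwIncl_injective 𝔾) _).finrank_eq.symm

lemma finrank_eigenspace_H1 (hV : ∀ x, 0 < V x) (μ : ℝ) :
    Module.finrank ℝ (eigenspace V (H1 d) μ) = Module.finrank ℝ (genEig (incl V hV) μ) := by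
  rw [eigenspace_H1_eq_map (hV := hV)]
  exact (Submodule.equivMapOfInjective _ toL2_injective _).finrank_eq.symm

end PlaneWave

end

noncomputable section

namespace PlaneWave

variable {d : ℕ}

open EnergySpace

/-! ### Norms of tuples of coefficient families -/

/-- Square summability against the weight of `H_p^s`. -/
def HpSummable (s : ℝ) (c : Freq d → ℂ) : Prop :=
  Summable fun G => (1 + normSq G) ^ s * ‖c G‖ ^ 2

lemma weight_pos (s : ℝ) (G : Freq d) : 0 < (1 + normSq G) ^ s :=
  Real.rpow_pos_of_pos (by linarith [normSq_nonneg G]) s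

lemma norm_weight_mul_sq (s : ℝ) (c : Freq d → ℂ) (G : Freq d) :
    ‖((√((1 + normSq G) ^ s) : ℝ) : ℂ) * c G‖ ^ 2 = (1 + normSq G) ^ s * ‖c G‖ ^ 2 := by
  rw [norm_mul, Complex.norm_real, mul_pow, Real.norm_eq_abs, sq_abs,
    Real.sq_sqrt (weight_pos s G).le]

lemma HpSummable.memℓp {s : ℝ} {c : Freq d → ℂ} (hc : HpSummable s c) :
    Memℓp (fun G => ((√((1 + normSq G) ^ s) : ℝ) : ℂ) * c G) 2 := by
  rw [memℓp_gen_iff (by norm_num)]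
  simp only [ENNReal.toReal_ofNat, Real.rpow_ofNat, norm_weight_mul_sq]
  exact hc

/-- The weighted coefficients as an element of `ℓ²`. -/
def HpSummable.toLp {s : ℝ} {c : Freq d → ℂ} (hc : HpSummable s c) :
    lp (fun _ : Freq d => ℂ) 2 := ⟨_, hc.memℓp⟩

lemma HpSummable.norm_toLp_sq {s : ℝ} {c : Freq d → ℂ} (hc : HpSummable s c) :
    ‖hc.toLp‖ ^ 2 = ∑' G, (1 + normSq G) ^ s * ‖c G‖ ^ 2 := by
  have h1 := lp.norm_rpow_eq_tsum (p := 2) (by norm_num) hc.toLp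
  simp only [ENNReal.toReal_ofNat, Real.rpow_ofNat] at h1
  rw [h1]
  exact tsum_congr fun G => norm_weight_mul_sq s c G

variable {ι : Type*} [Fintype ι]

lemma hpNorm_eq_tupleNorm {s : ℝ} {c : ι → Freq d → ℂ} (hc : ∀ l, HpSummable s (c l)) :
    hpNorm s c = tupleNorm fun l => (hc l).toLp := by
  simp only [hpNorm, tupleNorm, HpSummable.norm_toLp_sq]

lemma hpNorm_nonneg (s : ℝ) (c : ι → Freq d → ℂ) : 0 ≤ hpNorm s c := Real.sqrt_nonneg _

lemma HpSummable.sub {s : ℝ} {a b : Freq d → ℂ} (ha : HpSummable s a) (hb : HpSummable s b) :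
    HpSummable s (a - b) := by
  have h := lp.memℓp (ha.toLp - hb.toLp)
  rw [memℓp_gen_iff (by norm_num)] at h
  refine h.congr fun G => ?_
  rw [← norm_weight_mul_sq, Pi.sub_apply, mul_sub]
  simp only [ENNReal.toReal_ofNat, Real.rpow_ofNat]
  rfl

lemma HpSummable.indicator {s : ℝ} {a : Freq d → ℂ} (ha : HpSummable s a) (S : Set (Freq d)) :
    HpSummable s (S.indicator a) := by
  refine Summable.of_nonneg_of_le (fun G => mul_nonneg (weight_pos s G).le (sq_nonneg _))
    (fun G => ?_) ha
  refine mul_le_mul_of_nonneg_left ?_ (weight_pos s G).le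
  gcongr
  exact norm_indicator_le_norm_self _ _

lemma hpNorm_le_add {s : ℝ} {a b : ι → Freq d → ℂ} (ha : ∀ l, HpSummable s (a l))
    (hb : ∀ l, HpSummable s (b l)) : hpNorm s a ≤ hpNorm s b + hpNorm s (fun l => a l - b l) := by
  rw [hpNorm_eq_tupleNorm ha, hpNorm_eq_tupleNorm hb,
    hpNorm_eq_tupleNorm fun l => (ha l).sub (hb l)]
  refine le_of_eq_of_le ?_ (tupleNorm_add_le _ _)
  congr 1
  funext l
  ext G
  change ((√((1 + normSq G) ^ s) : ℝ) : ℂ) * a l G = ((√((1 + normSq G) ^ s) : ℝ) : ℂ) * b l G +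
    ((√((1 + normSq G) ^ s) : ℝ) : ℂ) * (a l - b l) G
  rw [Pi.sub_apply]
  ring

lemma hpNorm_sub_comm (s : ℝ) (a b : ι → Freq d → ℂ) :
    hpNorm s (fun l => a l - b l) = hpNorm s (fun l => b l - a l) := by
  simp only [hpNorm, Pi.sub_apply, norm_sub_rev]

lemma hpNorm_proj_le {s : ℝ} {a : ι → Freq d → ℂ} (ha : ∀ l, HpSummable s (a l))
    (S : Set (Freq d)) : hpNorm s (proj S a) ≤ hpNorm s a := by
  refine Real.sqrt_le_sqrt (Finset.sum_le_sum fun l _ => ?_)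
  refine Summable.tsum_le_tsum (fun G => ?_) ((ha l).indicator S) (ha l)
  refine mul_le_mul_of_nonneg_left ?_ (weight_pos s G).le
  gcongr
  exact norm_indicator_le_norm_self _ _

lemma hpNorm_proj_le_add {s : ℝ} {a b : ι → Freq d → ℂ} (ha : ∀ l, HpSummable s (a l))
    (hb : ∀ l, HpSummable s (b l)) (S : Set (Freq d)) :
    hpNorm s (proj S a) ≤ hpNorm s (proj S b) + hpNorm s (fun l => a l - b l) := by
  refine (hpNorm_le_add (fun l => (ha l).indicator S) fun l => (hb l).indicator S).trans ?_
  refine add_le_add_right ?_ _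
  have h := hpNorm_proj_le (fun l => (ha l).sub (hb l)) S
  refine le_of_eq_of_le ?_ h
  congr 1
  funext l
  exact (Set.indicator_sub' S (a l) (b l)).symm

/-! ### The residual and the energy norm -/

variable {V : C(Torus d, ℝ)} {hV : ∀ x, 0 < V x}

lemma fourierCoef_neg_of_real {f : Torus d → ℂ} (hf : ∀ᵐ x, conj (f x) = f x) (G : Freq d) :
    fourierCoef f (-G) = conj (fourierCoef f G) := by
  rw [fourierCoef, fourierCoef, ← integral_conj]
  refine integral_congr_ae ?_
  filter_upwards [hf] with x hx
  rw [planewave_neg, map_mul, hx]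

lemma residual_neg (μ : ℝ) {u : L2 d} (hu : u ∈ H1 d) (G : Freq d) :
    residual V μ u (-G) = conj (residual V μ u G) := by
  have h : fourierCoef (fun x => (V x : ℂ) * u x) (-G) =
      conj (fourierCoef (fun x => (V x : ℂ) * u x) G) := by
    refine fourierCoef_neg_of_real ?_ G
    filter_upwards [conj_ae_eq_of_mem_H1 hu] with x hx
    rw [map_mul, hx, Complex.conj_ofReal]
  simp only [residual, normSq_neg, fourierCoef_neg_of_mem_H1 hu, h, map_sub, map_mul,
    Complex.conj_ofReal]

/-- The residual represents the functional `v ↦ μ (u, v) - a(u, v)`. -/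
lemma hasSum_residual (μ : ℝ) (u v : EnergySpace V hV) :
    HasSum (fun G => conj (residual V μ (toL2 u) G) * fourierCoef (toL2 v) G)
      ((μ * inner ℝ (incl V hV u) (incl V hV v) - inner ℝ u v : ℝ) : ℂ) := by
  have h1 := (hasSum_fourierCoef_mul (toL2 u) (toL2 v)).mul_left (μ : ℂ)
  have h2 := (summable_energy (toL2_mem u) (toL2_mem v)).hasSum
  have h3 := hasSum_fourierCoef_mul (mulPotential V (toL2 u)) (toL2 v)
  have h4 := (h1.sub h2).sub h3
  rw [Complex.ofReal_sub, Complex.ofReal_mul, ← inner_eq_inner_incl, ← energy_eq_inner, energy_eq,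
    ← sub_sub]
  refine h4.congr_fun fun G => ?_
  simp only [residual, fourierCoef_mulPotential, map_sub, map_mul, Complex.conj_ofReal]
  ring

variable {a b : ℝ} {μ : ℝ} {u t : EnergySpace V hV}

/-- The residual on a finite set `δ` is controlled by the projection of its Riesz representative
to any space containing `V_δ`. -/
lemma sum_residual_le (hab : ∀ x, a ≤ V x ∧ V x ≤ b)
    (ht : ∀ v, inner ℝ t v = μ * inner ℝ (incl V hV u) (incl V hV v) - inner ℝ u v)
    {δ : Finset (Freq d)} (hδ : IsSymm δ)
    {W : Submodule ℝ (EnergySpace V hV)} [W.HasOrthogonalProjection] (hW : pwSpace hV δ ≤ W) :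
    ∑ G ∈ δ, (1 + normSq G) ^ (-1 : ℝ) * ‖residual V μ (toL2 u) G‖ ^ 2 ≤
      max b 1 * ‖W.starProjection t‖ ^ 2 := by
  set r := residual V μ (toL2 u) with hr
  set s := ∑ G ∈ δ, (1 + normSq G) ^ (-1 : ℝ) * ‖r G‖ ^ 2 with hs
  have hs0 : 0 ≤ s := Finset.sum_nonneg fun G _ => mul_nonneg (weight_pos _ G).le (sq_nonneg _)
  -- test with the function whose coefficients on `δ` are `(1 + |G|²)⁻¹ r_G`
  obtain ⟨v, hv, hvc⟩ := exists_mem_VG hδ (fun G => (((1 + normSq G) ^ (-1 : ℝ) : ℝ) : ℂ) * r G)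
    fun G _ => by
      rw [normSq_neg, hr, residual_neg μ (toL2_mem u), map_mul, Complex.conj_ofReal]
  have hvH := VG_le_H1 _ hv
  set v' := of hV v hvH with hv'
  have h1 : inner ℝ t v' = s := by
    have e1 := hasSum_residual μ u v'
    rw [← ht] at e1
    have e2 : HasSum (fun G => conj (r G) * fourierCoef v G) (s : ℂ) := by
      rw [hs, Complex.ofReal_sum]
      have : ∀ G ∈ δ, (((1 + normSq G) ^ (-1 : ℝ) * ‖r G‖ ^ 2 : ℝ) : ℂ) =
          conj (r G) * fourierCoef v G := fun G hG => by
        rw [hvc, Set.indicator_of_mem (Finset.mem_coe.2 hG), Complex.ofReal_mul,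
          ← conj_mul_self_eq]
        ring
      rw [Finset.sum_congr rfl this]
      refine hasSum_sum_of_ne_finset_zero fun G hG => ?_
      rw [hvc, Set.indicator_of_notMem (fun h => hG (Finset.mem_coe.1 h)), mul_zero]
    exact_mod_cast e1.unique e2
  have h2 : ‖v'‖ ^ 2 ≤ max b 1 * s := by
    refine (norm_sq_bounds hab v').2.trans_eq ?_
    congr 1
    rw [h1Sq, tsum_eq_sum (s := δ), hs]
    · refine Finset.sum_congr rfl fun G hG => ?_
      have hpos : 0 < 1 + normSq G := by linarith [normSq_nonneg G]
      rw [hv', toL2_of, hvc, Set.indicator_of_mem (Finset.mem_coe.2 hG), norm_mul,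
        Complex.norm_real, mul_pow, Real.norm_eq_abs, sq_abs, Real.rpow_neg_one]
      field_simp
    · intro G hG
      rw [hv', toL2_of, hvc, Set.indicator_of_notMem (fun h => hG (Finset.mem_coe.1 h))]
      simp
  have h3 : s ≤ ‖W.starProjection t‖ * ‖v'‖ := by
    have hvW : v' ∈ W := hW hv
    rw [← h1, ← Submodule.starProjection_eq_self_iff.2 hvW,
      ← Submodule.inner_starProjection_left_eq_right, Submodule.starProjection_eq_self_iff.2 hvW]
    exact real_inner_le_norm _ _
  have h4 : s ^ 2 ≤ ‖W.starProjection t‖ ^ 2 * (max b 1 * s) := by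
    calc s ^ 2 ≤ (‖W.starProjection t‖ * ‖v'‖) ^ 2 := by gcongr
      _ = ‖W.starProjection t‖ ^ 2 * ‖v'‖ ^ 2 := by ring
      _ ≤ _ := by gcongr
  rcases hs0.eq_or_lt with h0 | h0
  · rw [← h0]
    have : 0 ≤ max b 1 := zero_le_one.trans (le_max_right _ _)
    positivity
  · refine le_of_mul_le_mul_right ?_ h0
    linarith

/-- The residual belongs to `H_p^{-1}`. -/
lemma summable_residual (hab : ∀ x, a ≤ V x ∧ V x ≤ b)
    (ht : ∀ v, inner ℝ t v = μ * inner ℝ (incl V hV u) (incl V hV v) - inner ℝ u v) :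
    HpSummable (-1) (residual V μ (toL2 u)) ∧
    ∑' G, (1 + normSq G) ^ (-1 : ℝ) * ‖residual V μ (toL2 u) G‖ ^ 2 ≤ max b 1 * ‖t‖ ^ 2 := by
  have hbd : ∀ s : Finset (Freq d),
      ∑ G ∈ s, (1 + normSq G) ^ (-1 : ℝ) * ‖residual V μ (toL2 u) G‖ ^ 2 ≤
        max b 1 * ‖t‖ ^ 2 := fun s => by
    -- only symmetric sets of frequencies carry real-valued test functions
    have hsym : IsSymm (s ∪ s.image Neg.neg) := fun G => by
      simp only [Finset.mem_union, Finset.mem_image]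
      constructor
      · rintro (h | ⟨G', h, rfl⟩)
        · exact Or.inr ⟨G, h, rfl⟩
        · exact Or.inl (by rwa [neg_neg])
      · rintro (h | ⟨G', h, h'⟩)
        · exact Or.inr ⟨-G, h, neg_neg G⟩
        · exact Or.inl (by rwa [← neg_injective h'])
    refine (Finset.sum_le_sum_of_subset_of_nonneg Finset.subset_union_left
      fun G _ _ => mul_nonneg (weight_pos _ G).le (sq_nonneg _)).trans
      ((sum_residual_le hab ht hsym (W := ⊤) le_top).trans_eq ?_)
    rw [Submodule.starProjection_eq_self_iff.2 (Submodule.mem_top)]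
  have hs : HpSummable (-1) (residual V μ (toL2 u)) :=
    summable_of_sum_le (fun G => mul_nonneg (weight_pos _ G).le (sq_nonneg _)) hbd
  exact ⟨hs, hs.tsum_le_of_sum_le hbd⟩

/-- Duality between the residual and `H_p^1`, localized to a set `D` of frequencies. -/
lemma inner_sq_le_residual (hab : ∀ x, a ≤ V x ∧ V x ≤ b)
    (ht : ∀ v, inner ℝ t v = μ * inner ℝ (incl V hV u) (incl V hV v) - inner ℝ u v)
    {D : Set (Freq d)} {v : EnergySpace V hV}
    (hD : ∀ G ∉ D, residual V μ (toL2 u) G = 0 ∨ fourierCoef (toL2 v) G = 0) :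
    inner ℝ t v ^ 2 ≤
      (∑' G, (1 + normSq G) ^ (-1 : ℝ) * ‖D.indicator (residual V μ (toL2 u)) G‖ ^ 2) *
        h1Sq (toL2 v) := by
  set r := residual V μ (toL2 u) with hr
  have hsum := (summable_residual hab ht).1.indicator D
  set A := ∑' G, (1 + normSq G) ^ (-1 : ℝ) * ‖D.indicator r G‖ ^ 2 with hA
  have h1 := hasSum_residual μ u v
  rw [← ht] at h1
  have hfin : ∀ s : Finset (Freq d),
      ‖∑ G ∈ s, conj (r G) * fourierCoef (toL2 v) G‖ ^ 2 ≤ A * h1Sq (toL2 v) := fun s => by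
    have h2 : ‖∑ G ∈ s, conj (r G) * fourierCoef (toL2 v) G‖ ≤
        ∑ G ∈ s, (√((1 + normSq G) ^ (-1 : ℝ)) * ‖D.indicator r G‖) *
          (√(1 + normSq G) * ‖fourierCoef (toL2 v) G‖) := by
      refine (norm_sum_le _ _).trans (Finset.sum_le_sum fun G _ => ?_)
      have hpos : 0 < 1 + normSq G := by linarith [normSq_nonneg G]
      have e : √((1 + normSq G) ^ (-1 : ℝ)) * √(1 + normSq G) = 1 := by
        rw [← Real.sqrt_mul (weight_pos _ G).le, Real.rpow_neg_one, inv_mul_cancel₀ hpos.ne',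
          Real.sqrt_one]
      rw [norm_mul, RCLike.norm_conj, mul_mul_mul_comm, e, one_mul]
      by_cases hG : G ∈ D
      · rw [Set.indicator_of_mem hG]
      · rcases hD G hG with h | h
        · rw [h, norm_zero, zero_mul]
          positivity
        · rw [h, norm_zero, mul_zero, mul_zero]
    calc _ ≤ _ := pow_le_pow_left₀ (norm_nonneg _) h2 2
      _ ≤ _ := Finset.sum_mul_sq_le_sq_mul_sq _ _ _
      _ ≤ A * h1Sq (toL2 v) := by
        have e1 : ∀ G : Freq d, (√((1 + normSq G) ^ (-1 : ℝ)) * ‖D.indicator r G‖) ^ 2 =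
            (1 + normSq G) ^ (-1 : ℝ) * ‖D.indicator r G‖ ^ 2 := fun G => by
          rw [mul_pow, Real.sq_sqrt (weight_pos _ G).le]
        have e2 : ∀ G : Freq d, (√(1 + normSq G) * ‖fourierCoef (toL2 v) G‖) ^ 2 =
            (1 + normSq G) * ‖fourierCoef (toL2 v) G‖ ^ 2 := fun G => by
          rw [mul_pow, Real.sq_sqrt (by linarith [normSq_nonneg G])]
        simp only [e1, e2]
        refine mul_le_mul
          (hsum.sum_le_tsum s fun G _ => mul_nonneg (weight_pos _ G).le (sq_nonneg _))
          ((summable_of_mem_H1 (toL2_mem v)).sum_le_tsum s fun G _ =>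
            mul_nonneg (by linarith [normSq_nonneg G]) (sq_nonneg _))
          (Finset.sum_nonneg fun G _ => mul_nonneg (by linarith [normSq_nonneg G]) (sq_nonneg _))
          (tsum_nonneg fun G => mul_nonneg (weight_pos _ G).le (sq_nonneg _))
  have h3 : ‖((inner ℝ t v : ℝ) : ℂ)‖ ^ 2 ≤ A * h1Sq (toL2 v) :=
    le_of_tendsto (h1.norm.pow 2) (Filter.Eventually.of_forall hfin)
  rwa [Complex.norm_real, Real.norm_eq_abs, sq_abs] at h3

/-- The energy norm of a function `v` on which the Riesz representative `t` of the residual acts by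
`⟪t, v⟫ = ‖v‖²` is controlled by the residual on the relevant frequencies. -/
lemma norm_sq_le_residual (hab : ∀ x, a ≤ V x ∧ V x ≤ b)
    (ht : ∀ v, inner ℝ t v = μ * inner ℝ (incl V hV u) (incl V hV v) - inner ℝ u v)
    (ha : 0 < a) {D : Set (Freq d)} {v : EnergySpace V hV} (hv : inner ℝ t v = ‖v‖ ^ 2)
    (hD : ∀ G ∉ D, residual V μ (toL2 u) G = 0 ∨ fourierCoef (toL2 v) G = 0) :
    min a 1 * ‖v‖ ^ 2 ≤
      ∑' G, (1 + normSq G) ^ (-1 : ℝ) * ‖D.indicator (residual V μ (toL2 u)) G‖ ^ 2 := by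
  have h1 := inner_sq_le_residual hab ht hD
  set A := ∑' G, (1 + normSq G) ^ (-1 : ℝ) * ‖D.indicator (residual V μ (toL2 u)) G‖ ^ 2 with hA
  have hA0 : 0 ≤ A := tsum_nonneg fun G => mul_nonneg (weight_pos _ G).le (sq_nonneg _)
  have hm : 0 < min a 1 := lt_min ha one_pos
  have h2 := (norm_sq_bounds hab v).1
  rw [hv] at h1
  rcases (sq_nonneg ‖v‖).eq_or_lt with h0 | h0
  · rw [← h0, mul_zero]
    exact hA0
  · refine le_of_mul_le_mul_right ?_ h0
    calc min a 1 * ‖v‖ ^ 2 * ‖v‖ ^ 2 = min a 1 * (‖v‖ ^ 2) ^ 2 := by ring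
      _ ≤ min a 1 * (A * h1Sq (toL2 v)) := by gcongr
      _ = A * (min a 1 * h1Sq (toL2 v)) := by ring
      _ ≤ A * ‖v‖ ^ 2 := by gcongr

/-! ### Residuals of discrete eigenfunctions -/

section Discrete

variable {κ : Type*} {𝔾 : Finset (Freq d)} {u : κ → EnergySpace V hV} {lam : κ → ℝ}

/-- The solution `T` of the source problem `a(T, v) = λ (u, v)` with right-hand side `λ u`. If `u`
is a discrete eigenfunction, then its Galerkin approximation is `u`, and `T - u` is the Riesz
representative of the residual of `u`. -/
def lift (u : EnergySpace V hV) (lam : ℝ) : EnergySpace V hV := lam • solOp (incl V hV) u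

lemma inner_lift (u v : EnergySpace V hV) (lam : ℝ) :
    inner ℝ (lift u lam) v = lam * inner ℝ (incl V hV u) (incl V hV v) := by
  rw [lift, inner_smul_left, inner_solOp]
  simp

lemma inner_lift_sub (u v : EnergySpace V hV) (lam : ℝ) :
    inner ℝ (lift u lam - u) v = lam * inner ℝ (incl V hV u) (incl V hV v) - inner ℝ u v := by
  rw [inner_sub_left, inner_lift]

lemma IsGalerkinFamily.starProjection_lift (h : IsGalerkinFamily (incl V hV) (pwSpace hV 𝔾) u lam)
    (l : κ) : (pwSpace hV 𝔾).starProjection (lift (u l) (lam l)) = u l := by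
  refine Submodule.eq_starProjection_of_mem_of_inner_eq_zero (h.mem l) fun w hw => ?_
  rw [inner_lift_sub, h.eq l w hw, sub_self]

lemma IsGalerkinFamily.residual_eq_zero (h : IsGalerkinFamily (incl V hV) (pwSpace hV 𝔾) u lam)
    (h𝔾 : IsSymm 𝔾) (l : κ) {G : Freq d} (hG : G ∈ 𝔾) :
    residual V (lam l) (toL2 (u l)) G = 0 := by
  obtain ⟨a, b, -, -, hab⟩ := exists_potential_bounds hV
  have h1 := sum_residual_le hab (fun v => inner_lift_sub (u l) v (lam l)) h𝔾
    (W := pwSpace hV 𝔾) le_rfl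
  rw [map_sub, h.starProjection_lift, Submodule.starProjection_eq_self_iff.2 (h.mem l), sub_self,
    norm_zero, zero_pow two_ne_zero, mul_zero] at h1
  have h2 := (Finset.sum_eq_zero_iff_of_nonneg fun G _ =>
    mul_nonneg (weight_pos (-1) G).le (sq_nonneg ‖residual V (lam l) (toL2 (u l)) G‖)).1
    (le_antisymm h1 (Finset.sum_nonneg fun G _ =>
      mul_nonneg (weight_pos (-1) G).le (sq_nonneg _))) G hG
  simpa [(weight_pos (-1) G).ne'] using h2

lemma summable_residual_lift (u : EnergySpace V hV) (lam : ℝ) :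
    HpSummable (-1) (residual V lam (toL2 u)) := by
  obtain ⟨a, b, -, -, hab⟩ := exists_potential_bounds hV
  exact (summable_residual hab fun v => inner_lift_sub u v lam).1

lemma hpNorm_residual_le {a b : ℝ} (hab : ∀ x, a ≤ V x ∧ V x ≤ b) [Fintype κ]
    (u : κ → EnergySpace V hV) (lam : κ → ℝ) :
    hpNorm (-1) (fun l => residual V (lam l) (toL2 (u l))) ≤
      √(max b 1) * tupleNorm fun l => lift (u l) (lam l) - u l := by
  have hb : 0 ≤ max b 1 := zero_le_one.trans (le_max_right _ _)
  rw [hpNorm, tupleNorm, ← Real.sqrt_mul hb, Finset.mul_sum]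
  exact Real.sqrt_le_sqrt (Finset.sum_le_sum fun l _ =>
    (summable_residual hab fun v => inner_lift_sub (u l) v (lam l)).2)

lemma tupleNorm_le_hpNorm_residual {a b : ℝ} (ha : 0 < a) (hab : ∀ x, a ≤ V x ∧ V x ≤ b)
    [Fintype κ] (u : κ → EnergySpace V hV) (lam : κ → ℝ) :
    √(min a 1) * tupleNorm (fun l => lift (u l) (lam l) - u l) ≤
      hpNorm (-1) (fun l => residual V (lam l) (toL2 (u l))) := by
  have hm : 0 ≤ min a 1 := (lt_min ha one_pos).le
  rw [hpNorm, tupleNorm, ← Real.sqrt_mul hm, Finset.mul_sum]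
  refine Real.sqrt_le_sqrt (Finset.sum_le_sum fun l _ => ?_)
  have := norm_sq_le_residual hab (fun v => inner_lift_sub (u l) v (lam l)) ha (D := Set.univ)
    (real_inner_self_eq_norm_sq _) (by simp)
  simpa using this

/-- The residual on new frequencies is a lower bound for the energy gained by the refinement. -/
lemma IsGalerkinFamily.hpNorm_proj_residual_le [Fintype κ] {a b : ℝ} (hab : ∀ x, a ≤ V x ∧ V x ≤ b)
    (h : IsGalerkinFamily (incl V hV) (pwSpace hV 𝔾) u lam) {δ 𝔾' : Finset (Freq d)}
    (hδ : IsSymm δ) (hδ' : δ ⊆ 𝔾') (h𝔾 : 𝔾 ⊆ 𝔾') :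
    hpNorm (-1) (proj (δ : Set (Freq d)) fun l => residual V (lam l) (toL2 (u l))) ≤
      √(max b 1) * tupleNorm fun l =>
        (pwSpace hV 𝔾').starProjection (lift (u l) (lam l)) - u l := by
  have hb : 0 ≤ max b 1 := zero_le_one.trans (le_max_right _ _)
  rw [hpNorm, tupleNorm, ← Real.sqrt_mul hb, Finset.mul_sum]
  refine Real.sqrt_le_sqrt (Finset.sum_le_sum fun l _ => ?_)
  have h1 := sum_residual_le hab (fun v => inner_lift_sub (u l) v (lam l)) hδ
    (W := pwSpace hV 𝔾') (pwSpace_mono hδ')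
  rw [map_sub, Submodule.starProjection_eq_self_iff.2 (pwSpace_mono h𝔾 (h.mem l))] at h1
  refine le_trans (le_of_eq ?_) h1
  rw [tsum_eq_sum (s := δ)]
  · refine Finset.sum_congr rfl fun G hG => ?_
    rw [proj, Set.indicator_of_mem (Finset.mem_coe.2 hG)]
  · intro G hG
    rw [proj, Set.indicator_of_notMem (fun h => hG (Finset.mem_coe.1 h))]
    simp

/-- The residual on new frequencies is an upper bound for the energy gained by the refinement. -/
lemma IsGalerkinFamily.tupleNorm_le_hpNorm_proj [Fintype κ] {a b : ℝ} (ha : 0 < a)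
    (hab : ∀ x, a ≤ V x ∧ V x ≤ b)
    (h : IsGalerkinFamily (incl V hV) (pwSpace hV 𝔾) u lam) (h𝔾 : IsSymm 𝔾)
    {𝔾' : Finset (Freq d)} (h𝔾' : 𝔾 ⊆ 𝔾') :
    √(min a 1) * tupleNorm (fun l =>
        (pwSpace hV 𝔾').starProjection (lift (u l) (lam l)) - u l) ≤
      hpNorm (-1) (proj ((𝔾' \ 𝔾 : Finset (Freq d)) : Set (Freq d))
        fun l => residual V (lam l) (toL2 (u l))) := by
  have hm : 0 ≤ min a 1 := (lt_min ha one_pos).le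
  rw [hpNorm, tupleNorm, ← Real.sqrt_mul hm, Finset.mul_sum]
  refine Real.sqrt_le_sqrt (Finset.sum_le_sum fun l _ => ?_)
  set P := (pwSpace hV 𝔾').starProjection with hP
  have he : P (lift (u l) (lam l)) - u l = P (lift (u l) (lam l) - u l) := by
    rw [map_sub, hP, Submodule.starProjection_eq_self_iff.2 (pwSpace_mono h𝔾' (h.mem l))]
  rw [he]
  refine norm_sq_le_residual hab (fun v => inner_lift_sub (u l) v (lam l)) ha ?_ ?_
  · rw [← real_inner_self_eq_norm_sq, hP, Submodule.inner_starProjection_left_eq_right,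
      Submodule.starProjection_eq_self_iff.2 (Submodule.starProjection_apply_mem _ _),
      real_inner_comm]
  · intro G hG
    rw [Finset.mem_coe, Finset.mem_sdiff, not_and_not_right] at hG
    by_cases hG' : G ∈ 𝔾'
    · exact Or.inl (h.residual_eq_zero h𝔾 l (hG hG'))
    · exact Or.inr ((mem_VG_iff.1 (Submodule.starProjection_apply_mem (pwSpace hV 𝔾') _)).2 G hG')

end Discrete

end PlaneWave

end

noncomputable section

namespace PlaneWave

/-! ### Riesz projections -/

section Resolvent

variable {A : Type*} [NormedRing A] [NormedAlgebra ℂ A] {ι : Type*} [Fintype ι]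

lemma sum_smul_mul_sum_smul {P : ι → A} (hP : CompleteOrthogonalIdempotents P) (a b : ι → ℂ) :
    (∑ o, a o • P o) * (∑ o, b o • P o) = ∑ o, (a o * b o) • P o := by
  classical
  simp only [Finset.sum_mul_sum, smul_mul_smul_comm]
  refine Finset.sum_congr rfl fun o _ => ?_
  rw [Finset.sum_eq_single o]
  · rw [(hP.idem o).eq]
  · intro o' _ ho
    rw [hP.ortho (Ne.symm ho), smul_zero]
  · simp

/-- Partial fraction decomposition of the resolvent of a diagonalizable element. -/
lemma resolvent_eq_sum {P : ι → A} (hP : CompleteOrthogonalIdempotents P) (κ : ι → ℂ) {z : ℂ}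
    (hz : ∀ o, z ≠ κ o) :
    resolvent (∑ o, κ o • P o) z = ∑ o, (z - κ o)⁻¹ • P o := by
  have h1 : algebraMap ℂ A z - ∑ o, κ o • P o = ∑ o, (z - κ o) • P o := by
    rw [Algebra.algebraMap_eq_smul_one, ← hP.complete, Finset.smul_sum, ← Finset.sum_sub_distrib]
    exact Finset.sum_congr rfl fun o _ => (sub_smul _ _ _).symm
  have h2 : ∀ o, (z - κ o) * (z - κ o)⁻¹ = 1 := fun o => mul_inv_cancel₀ (sub_ne_zero.2 (hz o))
  have h3 : (∑ o, (z - κ o) • P o) * ∑ o, (z - κ o)⁻¹ • P o = 1 := by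
    rw [sum_smul_mul_sum_smul hP]
    simp only [h2, one_smul, hP.complete]
  have h4 : (∑ o, (z - κ o)⁻¹ • P o) * ∑ o, (z - κ o) • P o = 1 := by
    rw [sum_smul_mul_sum_smul hP]
    simp only [mul_comm _ (_ - _), h2, one_smul, hP.complete]
  rw [resolvent, h1]
  exact Ring.inverse_unit ⟨_, _, h3, h4⟩

lemma circleIntegral_sub_inv_of_lt {c w : ℂ} {R : ℝ} (hR : 0 ≤ R) (hw : R < ‖w - c‖) :
    ∮ z in C(c, R), (z - w)⁻¹ = 0 := by
  refine DiffContOnCl.circleIntegral_eq_zero hR ?_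
  have hne : ∀ z ∈ Metric.closedBall c R, z - w ≠ 0 := fun z hz h => by
    rw [sub_eq_zero] at h
    rw [h, mem_closedBall_iff_norm] at hz
    exact absurd hz (not_le.2 hw)
  refine DifferentiableOn.diffContOnCl fun z hz => ?_
  have hz' := hne z (Metric.closure_ball_subset_closedBall hz)
  exact ((differentiableAt_id.sub_const w).inv hz').differentiableWithinAt

/-- The Riesz projection of a diagonalizable element is the sum of the idempotents whose
eigenvalues lie inside the circle. -/
lemma circleIntegral_resolvent_eq_sum [CompleteSpace A] {P : ι → A}
    (hP : CompleteOrthogonalIdempotents P) (κ : ι → ℂ) {c : ℂ} {R : ℝ} (hR : 0 < R)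
    (S : Finset ι) (hS : ∀ o ∈ S, ‖κ o - c‖ < R)
    (hS' : ∀ o ∉ S, R < ‖κ o - c‖) :
    (2 * π * Complex.I : ℂ)⁻¹ • ∮ z in C(c, R), resolvent (∑ o, κ o • P o) z = ∑ o ∈ S, P o := by
  classical
  have hoff : ∀ o, κ o ∉ Metric.sphere c |R| := fun o ho => by
    rw [mem_sphere_iff_norm, abs_of_pos hR] at ho
    by_cases h : o ∈ S
    · exact (hS o h).ne ho
    · exact (hS' o h).ne' ho
  have h1 : Set.EqOn (resolvent (∑ o, κ o • P o)) (fun z => ∑ o, (z - κ o)⁻¹ • P o)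
      (Metric.sphere c R) := fun z hz => by
    refine resolvent_eq_sum hP κ fun o ho => hoff o ?_
    rw [abs_of_pos hR, ← ho]
    exact hz
  have hint : ∀ o, CircleIntegrable (fun z => (z - κ o)⁻¹) c R := fun o =>
    circleIntegrable_sub_inv_iff.2 (Or.inr (hoff o))
  have hint' : ∀ o ∈ Finset.univ, CircleIntegrable (fun z => (z - κ o)⁻¹ • P o) c R := fun o _ =>
    (hint o).smul_continuousOn continuousOn_const
  rw [circleIntegral.integral_congr hR.le h1, circleIntegral.integral_fun_sum hint']
  simp only [circleIntegral.integral_smul_const]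
  rw [Finset.smul_sum, ← Finset.sum_subset (Finset.subset_univ S)]
  · refine Finset.sum_congr rfl fun o ho => ?_
    rw [circleIntegral.integral_sub_inv_of_mem_ball (mem_ball_iff_norm.2 (hS o ho)), smul_smul,
      inv_mul_cancel₀ Complex.two_pi_I_ne_zero, one_smul]
  · intro o _ ho
    rw [circleIntegral_sub_inv_of_lt hR.le (hS' o ho), zero_smul, smul_zero]

end Resolvent

section RankOne

variable {E : Type*} [NormedAddCommGroup E] [InnerProductSpace ℂ E] {ι : Type*}

/-- The orthogonal projection `w ↦ ⟪x, w⟫ x` onto the line through a unit vector `x`. -/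
def rankOneProj (x : E) : E →L[ℂ] E := (innerSL ℂ x).smulRight x

lemma rankOneProj_apply (x w : E) : rankOneProj x w = inner ℂ x w • x := rfl

lemma orthogonalIdempotents_rankOneProj {ψ : ι → E} (hψ : Orthonormal ℂ ψ) :
    OrthogonalIdempotents fun j => rankOneProj (ψ j) where
  idem j := by
    ext w
    simp [rankOneProj_apply, inner_self_eq_norm_sq_to_K, hψ.1 j]
  ortho j k hjk := by
    ext w
    simp [rankOneProj_apply, hψ.2 hjk]

end RankOne

variable {d : ℕ}

open EnergySpace

/-- For symmetric `𝔾`, the complex span of the planewaves is the complexification of `V_𝔾`. -/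
lemma exists_real_imaginary_parts {𝔾 : Finset (Freq d)} (h𝔾 : IsSymm 𝔾) {v : L2 d}
    (hv : v ∈ Submodule.span ℂ (planewaveL2 '' (𝔾 : Set (Freq d)))) :
    ∃ v₁ ∈ VG 𝔾, ∃ v₂ ∈ VG 𝔾, v = v₁ + Complex.I • v₂ := by
  obtain ⟨v₁, h₁, hc₁⟩ := exists_mem_VG h𝔾
    (fun G => (fourierCoef v G + conj (fourierCoef v (-G))) / 2) (fun G _ => by
      simp only [neg_neg, map_div₀, map_add, Complex.conj_conj, map_ofNat]
      ring)
  obtain ⟨v₂, h₂, hc₂⟩ := exists_mem_VG h𝔾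
    (fun G => (fourierCoef v G - conj (fourierCoef v (-G))) / (2 * Complex.I)) (fun G _ => by
      simp only [neg_neg, map_div₀, map_sub, Complex.conj_conj, map_ofNat, map_mul, Complex.conj_I]
      rw [mul_neg, div_neg, ← neg_div, neg_sub])
  refine ⟨v₁, h₁, v₂, h₂, ext_fourierCoef fun G => ?_⟩
  rw [fourierCoef_add, fourierCoef_smul, hc₁, hc₂]
  by_cases hG : G ∈ 𝔾
  · rw [Set.indicator_of_mem (Finset.mem_coe.2 hG), Set.indicator_of_mem (Finset.mem_coe.2 hG)]
    have := Complex.I_ne_zero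
    field_simp
    ring
  · rw [Set.indicator_of_notMem (fun h => hG (Finset.mem_coe.1 h)),
      Set.indicator_of_notMem (fun h => hG (Finset.mem_coe.1 h)), mem_span_planewave_iff.1 hv G hG,
      mul_zero, add_zero]

lemma energy_add_I_smul_left (V : C(Torus d, ℝ)) {v₁ v₂ w : L2 d} (h₁ : v₁ ∈ H1 d) (h₂ : v₂ ∈ H1 d)
    (hw : w ∈ H1 d) :
    energy V (v₁ + Complex.I • v₂) w = energy V v₁ w - Complex.I * energy V v₂ w := by
  rw [energy_add_left_aux V (summable_energy h₁ hw), energy_smul_left, Complex.conj_I]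
  · ring
  · refine ((summable_energy h₂ hw).mul_left (-Complex.I)).congr fun G => ?_
    rw [fourierCoef_smul, map_mul, Complex.conj_I]
    ring

variable {V : C(Torus d, ℝ)} {hV : ∀ x, 0 < V x} {ι : Type*} {𝔾 : Finset (Freq d)}
  {φ : ι → EnergySpace V hV} {lam : ι → ℝ}

lemma orthonormal_toL2 (h : Orthonormal ℝ fun j => incl V hV (φ j)) :
    Orthonormal ℂ fun j => (toL2 (φ j) : L2 d) := by
  classical
  rw [orthonormal_iff_ite] at h ⊢
  intro i j
  rw [inner_eq_inner_incl, h i j]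
  split_ifs <;> simp

lemma IsGalerkinFamily.energy_left (h : IsGalerkinFamily (incl V hV) (pwSpace hV 𝔾) φ lam)
    (h𝔾 : IsSymm 𝔾) (j : ι) {v : L2 d}
    (hv : v ∈ Submodule.span ℂ (planewaveL2 '' (𝔾 : Set (Freq d)))) :
    energy V v (toL2 (φ j)) = lam j * inner ℂ v (toL2 (φ j)) := by
  have key : ∀ w ∈ VG 𝔾, energy V w (toL2 (φ j)) = lam j * inner ℂ w (toL2 (φ j)) := fun w hw => by
    have := (energy_eq_iff (of hV w (VG_le_H1 _ hw)) (φ j) (lam j)).2 (by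
      rw [real_inner_comm, h.eq j _ (mem_pwSpace.2 (by rwa [toL2_of])), real_inner_comm])
    simpa only [toL2_of] using this
  obtain ⟨v₁, h₁, v₂, h₂, rfl⟩ := exists_real_imaginary_parts h𝔾 hv
  rw [energy_add_I_smul_left V (VG_le_H1 _ h₁) (VG_le_H1 _ h₂) (toL2_mem _), key _ h₁, key _ h₂,
    inner_add_left, inner_smul_left, Complex.conj_I]
  ring

lemma toL2_mem_span {u : EnergySpace V hV} (hu : u ∈ pwSpace hV 𝔾) :
    toL2 u ∈ Submodule.span ℂ (planewaveL2 '' (𝔾 : Set (Freq d))) :=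
  mem_span_planewave_iff.2 (mem_VG_iff.1 hu).2

lemma mem_span_toL2 [Fintype ι] (h𝔾 : IsSymm 𝔾)
    (hspan : pwSpace hV 𝔾 ≤ Submodule.span ℝ (Set.range φ))
    {v : L2 d} (hv : v ∈ Submodule.span ℂ (planewaveL2 '' (𝔾 : Set (Freq d)))) :
    ∃ c : ι → ℂ, v = ∑ j, c j • (toL2 (φ j) : L2 d) := by
  have key : ∀ w ∈ VG 𝔾, ∃ c : ι → ℂ, w = ∑ j, c j • (toL2 (φ j) : L2 d) := fun w hw => by
    have hw' : of hV w (VG_le_H1 _ hw) ∈ pwSpace hV 𝔾 := mem_pwSpace.2 (by rwa [toL2_of])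
    obtain ⟨c, hc⟩ := (Submodule.mem_span_range_iff_exists_fun ℝ).1 (hspan hw')
    refine ⟨fun j => c j, ?_⟩
    have := congrArg toL2 hc
    rw [toL2_of, map_sum] at this
    rw [← this]
    exact Finset.sum_congr rfl fun j _ => by rw [map_smul, Complex.coe_smul]; rfl
  obtain ⟨v₁, h₁, v₂, h₂, rfl⟩ := exists_real_imaginary_parts h𝔾 hv
  obtain ⟨c₁, e₁⟩ := key v₁ h₁
  obtain ⟨c₂, e₂⟩ := key v₂ h₂
  refine ⟨fun j => c₁ j + Complex.I * c₂ j, ?_⟩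
  simp only [add_smul, mul_smul, Finset.sum_add_distrib, ← Finset.smul_sum]
  rw [← e₁, ← e₂]

/-- The discrete solution operator is diagonal in a basis of discrete eigenfunctions. -/
lemma IsGalerkinFamily.galerkin_eq [Fintype ι]
    (h : IsGalerkinFamily (incl V hV) (pwSpace hV 𝔾) φ lam)
    (h𝔾 : IsSymm 𝔾) (hspan : pwSpace hV 𝔾 ≤ Submodule.span ℝ (Set.range φ))
    (hpos : ∀ j, 0 < lam j) :
    galerkin V 𝔾 = ∑ j, (((lam j)⁻¹ : ℝ) : ℂ) • rankOneProj (toL2 (φ j) : L2 d) := by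
  classical
  ext1 w
  obtain ⟨hmem, hspec⟩ := galerkin_spec hV 𝔾 w
  have hψ := orthonormal_toL2 h.orthonormal
  have hcoef : ∀ j, inner ℂ (toL2 (φ j)) (galerkin V 𝔾 w) =
      (((lam j)⁻¹ : ℝ) : ℂ) * inner ℂ (toL2 (φ j)) w := fun j => by
    have e1 := hspec _ (toL2_mem_span (h.mem j))
    rw [energy_symm, h.energy_left h𝔾 j hmem, map_mul, Complex.conj_ofReal, inner_conj_symm] at e1
    rw [← e1, ← mul_assoc, ← Complex.ofReal_mul, inv_mul_cancel₀ (hpos j).ne', Complex.ofReal_one,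
      one_mul]
  obtain ⟨c, hc⟩ := mem_span_toL2 h𝔾 hspan hmem
  rw [hc]
  simp only [_root_.sum_apply, _root_.smul_apply, rankOneProj_apply, smul_smul, ← hcoef]
  refine Finset.sum_congr rfl fun j _ => ?_
  congr 1
  rw [hc, hψ.inner_right_fintype]

/-- The spectral projection of a real function is the part of its expansion in discrete
eigenfunctions that belongs to the eigenvalues inside the circle. -/
lemma IsGalerkinFamily.spectralProj_eq [Fintype ι]
    (h : IsGalerkinFamily (incl V hV) (pwSpace hV 𝔾) φ lam)
    (h𝔾 : IsSymm 𝔾) (hspan : pwSpace hV 𝔾 ≤ Submodule.span ℝ (Set.range φ))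
    (hpos : ∀ j, 0 < lam j) {Λ r : ℝ} (hr : 0 < r) (hrΛ : r < Λ⁻¹) (S : Finset ι)
    (hS : ∀ j ∈ S, |(lam j)⁻¹ - Λ⁻¹| < r) (hS' : ∀ j ∉ S, r < |(lam j)⁻¹ - Λ⁻¹|)
    (u : EnergySpace V hV) :
    spectralProj V 𝔾 Λ r (toL2 u) = toL2 (specPart (incl V hV) φ S u) := by
  classical
  have hP := CompleteOrthogonalIdempotents.option
    (orthogonalIdempotents_rankOneProj (orthonormal_toL2 h.orthonormal))
  -- the extra index stands for the kernel of the operator, whose eigenvalue `0` is outside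
  let κ : Option ι → ℂ := fun o => o.elim 0 fun j => (((lam j)⁻¹ : ℝ) : ℂ)
  have hK : galerkin V 𝔾 = ∑ o, κ o • Option.elim o
      (1 - ∑ j, rankOneProj (toL2 (φ j) : L2 d)) fun j => rankOneProj (toL2 (φ j) : L2 d) := by
    rw [h.galerkin_eq h𝔾 hspan hpos, Fintype.sum_option]
    simp [κ]
  have hnorm : ∀ j, ‖(((lam j)⁻¹ : ℝ) : ℂ) - ((Λ⁻¹ : ℝ) : ℂ)‖ = |(lam j)⁻¹ - Λ⁻¹| := fun j => by
    rw [← Complex.ofReal_sub, Complex.norm_real, Real.norm_eq_abs]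
  rw [spectralProj, hK, circleIntegral_resolvent_eq_sum hP κ hr (S.map Function.Embedding.some)]
  · rw [Finset.sum_map]
    simp only [Function.Embedding.some_apply, Option.elim_some, _root_.sum_apply,
      rankOneProj_apply, specPart, map_sum, map_smul, inner_eq_inner_incl, Complex.coe_smul]
    rfl
  · intro o ho
    obtain ⟨j, hj, rfl⟩ := Finset.mem_map.1 ho
    exact (hnorm j).trans_lt (hS j hj)
  · intro o ho
    cases o with
    | none =>
      have : ‖κ none - ((Λ⁻¹ : ℝ) : ℂ)‖ = Λ⁻¹ := by
        rw [show κ none = 0 from rfl, zero_sub, norm_neg, Complex.norm_real, Real.norm_eq_abs,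
          abs_of_pos (hr.trans hrΛ)]
      rwa [this]
    | some j =>
      refine (hS' j fun hj => ho ?_).trans_eq (hnorm j).symm
      exact Finset.mem_map_of_mem _ hj

end PlaneWave

end

namespace PlaneWave

/-! ### Counting eigenvalues -/

section Counting

variable {H L : Type*} [NormedAddCommGroup H] [InnerProductSpace ℝ H]
  [NormedAddCommGroup L] [InnerProductSpace ℝ L] {J : H →L[ℝ] L}

/-- The count of eigenvalues increases at `μ` at least by the multiplicity of `μ`. -/
lemma finrank_eigSum_add_le (hinj : Function.Injective J) (hJ : SmallOffFinite J) {μ' μ : ℝ}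
    (h : μ' < μ) : Module.finrank ℝ (eigSum J μ') + Module.finrank ℝ (genEig J μ) ≤
      Module.finrank ℝ (eigSum J μ) := by
  have hfd := finiteDimensional_eigSum hJ μ
  have hle := eigSum_mono (J := J) h.le
  have hle' := genEig_le_eigSum (J := J) (le_refl μ)
  have h1 := Submodule.finiteDimensional_of_le hle
  have h2 := Submodule.finiteDimensional_of_le hle'
  have hdisj : eigSum J μ' ⊓ genEig J μ = ⊥ := by
    rw [Submodule.eq_bot_iff]
    rintro u ⟨hu, hu'⟩
    have e1 := eigSum_norm_sq_le hu
    rw [genEig_norm_sq hu'] at e1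
    have e2 : ‖J u‖ ^ 2 ≤ 0 := by nlinarith [sq_nonneg ‖J u‖]
    have e3 : J u = 0 := by simpa using e2
    exact hinj (by rw [e3, map_zero])
  have h3 := Submodule.finrank_sup_add_finrank_inf_eq (eigSum J μ') (genEig J μ)
  rw [hdisj, finrank_bot, add_zero] at h3
  rw [← h3]
  exact Submodule.finrank_mono (sup_le hle hle')

lemma finrank_genEig_pos (hJ : SmallOffFinite J) {μ : ℝ} (h : genEig J μ ≠ ⊥) :
    0 < Module.finrank ℝ (genEig J μ) := by
  have hfd := finiteDimensional_eigSum hJ μ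
  have := Submodule.finiteDimensional_of_le (genEig_le_eigSum (J := J) (le_refl μ))
  exact Submodule.one_le_finrank_iff.2 h

/-- The counting function is constant to the left of a point that is not an eigenvalue. -/
lemma exists_lt_finrank_eigSum_eq (hinj : Function.Injective J) (hJ : SmallOffFinite J) {μ : ℝ}
    (h : genEig J μ = ⊥) :
    ∃ μ' < μ, Module.finrank ℝ (eigSum J μ') = Module.finrank ℝ (eigSum J μ) := by
  -- choose `μ' < μ` with the largest count
  let s : Set ℕ := (fun μ' => Module.finrank ℝ (eigSum J μ')) '' Set.Iio μ
  have hne : s.Nonempty := ⟨_, μ - 1, by simp, rfl⟩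
  have hb : BddAbove s := ⟨Module.finrank ℝ (eigSum J μ), by
    rintro _ ⟨ν, hν, rfl⟩
    exact finrank_eigSum_mono hJ hν.le⟩
  obtain ⟨μ', hμ', he⟩ := Nat.sSup_mem hne hb
  refine ⟨μ', hμ', ?_⟩
  have hgap : ∀ ν, μ' < ν → ν < μ → genEig J ν = ⊥ := fun ν h1 h2 => by
    by_contra h3
    have h4 := finrank_genEig_pos hJ h3
    have h5 := finrank_eigSum_add_le hinj hJ h1
    have h6 : Module.finrank ℝ (eigSum J ν) ≤ sSup s := le_csSup hb ⟨ν, h2, rfl⟩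
    rw [← he] at h6
    simp only at h6
    omega
  rw [finrank_eigSum_step hJ hμ' hgap, h, finrank_bot, add_zero]

/-- The `k`-th eigenvalue, counted with multiplicity. -/
noncomputable def kthEig (J : H →L[ℝ] L) (k : ℕ) : ℝ :=
  sInf {μ : ℝ | k ≤ Module.finrank ℝ (eigSum J μ)}

lemma pos_of_finrank_pos {μ : ℝ} (h : 0 < Module.finrank ℝ (eigSum J μ)) : 0 < μ := by
  by_contra h'
  rw [eigSum_eq_bot (not_lt.1 h'), finrank_bot] at h
  exact lt_irrefl _ h

lemma kthEig_nonneg {k : ℕ} (hk : 0 < k) : 0 ≤ kthEig J k :=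
  Real.sInf_nonneg fun _ hμ => (pos_of_finrank_pos (hk.trans_le hμ)).le

lemma bddBelow_kthEig {k : ℕ} (hk : 0 < k) :
    BddBelow {μ : ℝ | k ≤ Module.finrank ℝ (eigSum J μ)} :=
  ⟨0, fun _ hμ => (pos_of_finrank_pos (hk.trans_le hμ)).le⟩

/-- The infimum defining the `k`-th eigenvalue is attained, as the counting function is continuous
from the right, unless it is the infimum of the empty set. -/
lemma kthEig_le_iff (hJ : SmallOffFinite J) {k : ℕ} (hk : 0 < k)
    (hne : ∃ μ, k ≤ Module.finrank ℝ (eigSum J μ)) {μ : ℝ} :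
    kthEig J k ≤ μ ↔ k ≤ Module.finrank ℝ (eigSum J μ) := by
  refine ⟨fun h => ?_, fun h => csInf_le (bddBelow_kthEig hk) h⟩
  obtain ⟨μ', hμ', he⟩ := exists_eigSum_eq hJ (kthEig J k)
  obtain ⟨t, ht, hlt⟩ := exists_lt_of_csInf_lt hne hμ'
  have h1 : k ≤ Module.finrank ℝ (eigSum J μ') :=
    le_trans ht (finrank_eigSum_mono hJ hlt.le)
  rw [he] at h1
  exact h1.trans (finrank_eigSum_mono hJ h)

lemma genEig_kthEig_ne_bot (hinj : Function.Injective J) (hJ : SmallOffFinite J) {k : ℕ}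
    (hk : 0 < k) (hne : ∃ μ, k ≤ Module.finrank ℝ (eigSum J μ)) :
    genEig J (kthEig J k) ≠ ⊥ := fun h => by
  obtain ⟨μ', hμ', he⟩ := exists_lt_finrank_eigSum_eq hinj hJ h
  have h1 := (kthEig_le_iff hJ hk hne).1 le_rfl
  rw [← he, ← kthEig_le_iff hJ hk hne] at h1
  exact absurd hμ' (not_lt.2 h1)

lemma kthEig_finrank_eigSum (hinj : Function.Injective J) (hJ : SmallOffFinite J) {ν : ℝ}
    (h : genEig J ν ≠ ⊥) : kthEig J (Module.finrank ℝ (eigSum J ν)) = ν := by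
  have hpos := finrank_genEig_pos hJ h
  have hk : 0 < Module.finrank ℝ (eigSum J ν) := by
    have := finrank_eigSum_add_le hinj hJ (sub_one_lt ν)
    omega
  have hne : ∃ μ, Module.finrank ℝ (eigSum J ν) ≤ Module.finrank ℝ (eigSum J μ) := ⟨ν, le_rfl⟩
  refine le_antisymm ((kthEig_le_iff hJ hk hne).2 le_rfl) (not_lt.1 fun hlt => ?_)
  have h1 := (kthEig_le_iff hJ hk hne).1 le_rfl
  have h2 := finrank_eigSum_add_le hinj hJ hlt
  omega

/-- The discrete counting function is at most the exact one. -/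
lemma finrank_eigSum_restrict_le [CompleteSpace H] [CompleteSpace L] (hinj : Function.Injective J)
    (hJ : SmallOffFinite J) (W : Submodule ℝ H) (μ : ℝ) :
    Module.finrank ℝ (eigSum (J ∘L W.subtypeL) μ) ≤ Module.finrank ℝ (eigSum J μ) := by
  rw [← Submodule.finrank_map_subtype_eq W (eigSum (J ∘L W.subtypeL) μ)]
  refine finrank_le_finrank_eigSum hinj hJ ?_
  rintro _ ⟨u, hu, rfl⟩
  exact eigSum_norm_sq_le (J := J ∘L W.subtypeL) hu

/-- The discrete counting function catches up with the exact one on good trial spaces: the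
orthogonal projections of the exact eigenvectors have nearly the same Rayleigh quotients. -/
lemma exists_finrank_eigSum_le_restrict [CompleteSpace L] (hinj : Function.Injective J)
    {μ η : ℝ} (hμ : 0 ≤ μ) (hη : 0 < η) : ∃ ν > 0, ∀ W : Submodule ℝ H, FiniteDimensional ℝ W →
      (∀ w ∈ Wᗮ, ‖J w‖ ≤ ν * ‖w‖) →
      Module.finrank ℝ (eigSum J μ) ≤ Module.finrank ℝ (eigSum (J ∘L W.subtypeL) (μ + η)) := by
  have hlim : Filter.Tendsto (fun ν : ℝ => (μ + η) * (1 - ν * √μ) ^ 2) (nhds 0)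
      (nhds ((μ + η) * (1 - 0 * √μ) ^ 2)) := Continuous.tendsto (by fun_prop) 0
  have hlim' : Filter.Tendsto (fun ν : ℝ => ν * √μ) (nhds 0) (nhds (0 * √μ)) :=
    Continuous.tendsto (by fun_prop) 0
  have h1 := hlim.eventually (lt_mem_nhds (show μ < (μ + η) * (1 - 0 * √μ) ^ 2 by simp [hη]))
  have h2 := hlim'.eventually (gt_mem_nhds (show 0 * √μ < 1 by simp))
  obtain ⟨ν, ⟨hν1, hν2⟩, hν⟩ := (((h1.and h2).filter_mono nhdsWithin_le_nhds).and
    (self_mem_nhdsWithin (a := (0 : ℝ)) (s := Set.Ioi 0))).exists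
  refine ⟨ν, hν, fun W hW hWν => ?_⟩
  have hν0 : 0 ≤ ν := le_of_lt hν
  let p : H →ₗ[ℝ] W := (W.orthogonalProjectionOnto : H →L[ℝ] W).toLinearMap
  -- the projection does not increase the energy and nearly preserves `‖J u‖`
  have key : ∀ u ∈ eigSum J μ, ‖J u‖ * (1 - ν * √μ) ≤ ‖J (p u)‖ ∧
      ‖p u‖ ^ 2 ≤ μ * ‖J u‖ ^ 2 := fun u hu => by
    have e1 := eigSum_norm_sq_le hu
    have e2 : ‖u‖ ≤ √μ * ‖J u‖ := by
      refine abs_le_of_sq_le_sq' ?_ (by positivity) |>.2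
      rwa [mul_pow, Real.sq_sqrt hμ]
    have e3 : u - W.starProjection u ∈ Wᗮ := Submodule.sub_starProjection_mem_orthogonal u
    have e4 := hWν _ e3
    have e5 := Submodule.norm_sq_eq_add_norm_sq_starProjection u W
    rw [W.starProjection_orthogonal_val] at e5
    have e6 : ‖u - W.starProjection u‖ ≤ ‖u‖ := by
      refine abs_le_of_sq_le_sq' ?_ (norm_nonneg u) |>.2
      nlinarith [sq_nonneg ‖W.starProjection u‖]
    have e7 : ‖J u‖ ≤ ‖J (W.starProjection u)‖ + ‖J (u - W.starProjection u)‖ := by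
      rw [map_sub]
      have := norm_add_le (J (W.starProjection u)) (J u - J (W.starProjection u))
      rwa [add_sub_cancel] at this
    have e8 : ‖p u‖ ^ 2 = ‖W.starProjection u‖ ^ 2 := rfl
    have e9 : J (p u) = J (W.starProjection u) := rfl
    rw [e8, e9]
    constructor
    · nlinarith [mul_le_mul_of_nonneg_left (e6.trans e2) hν0]
    · nlinarith [sq_nonneg ‖u - W.starProjection u‖]
  have hinjp : ∀ u ∈ eigSum J μ, p u = 0 → u = 0 := fun u hu h0 => by
    have e1 := (key u hu).1
    rw [h0, Submodule.coe_zero, map_zero, norm_zero] at e1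
    have e2 : ‖J u‖ = 0 := by
      by_contra hne
      have : 0 < ‖J u‖ := lt_of_le_of_ne (norm_nonneg _) (Ne.symm hne)
      nlinarith [mul_pos this (sub_pos.2 hν2)]
    exact hinj (by rw [norm_eq_zero.1 e2, map_zero])
  have hp : Function.Injective (p ∘ₗ (eigSum J μ).subtype) := by
    rw [← LinearMap.ker_eq_bot, LinearMap.ker_eq_bot']
    exact fun u hu => Subtype.ext (hinjp u u.2 hu)
  have hr : Module.finrank ℝ (eigSum J μ) =
      Module.finrank ℝ (LinearMap.range (p ∘ₗ (eigSum J μ).subtype)) :=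
    (LinearEquiv.ofInjective _ hp).finrank_eq
  have hinjW : Function.Injective (J ∘L W.subtypeL) := hinj.comp Subtype.val_injective
  rw [hr]
  refine finrank_le_finrank_eigSum hinjW smallOffFinite_of_finiteDimensional ?_
  rintro _ ⟨u, rfl⟩
  obtain ⟨e1, e2⟩ := key u u.2
  have e3 : (‖J (u : H)‖ * (1 - ν * √μ)) ^ 2 ≤ ‖J (p u)‖ ^ 2 := by
    have : 0 ≤ ‖J (u : H)‖ * (1 - ν * √μ) := mul_nonneg (norm_nonneg _) (sub_pos.2 hν2).le
    gcongr
  have e4 : (μ + η) * (‖J (u : H)‖ * (1 - ν * √μ)) ^ 2 ≤ (μ + η) * ‖J (p u)‖ ^ 2 := by gcongr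
  refine e2.trans (le_trans ?_ e4)
  rw [mul_pow, mul_left_comm, mul_comm μ]
  gcongr

variable {W : Submodule ℝ H}

lemma IsGalerkinFamily.isEigenFamily {ι : Type*} {φ : ι → H} {lam : ι → ℝ}
    (h : IsGalerkinFamily J W φ lam) :
    IsEigenFamily (J ∘L W.subtypeL) (fun j => (⟨φ j, h.mem j⟩ : W)) lam where
  orthonormal := h.orthonormal
  mem j v := h.eq j v v.2

lemma IsGalerkinFamily.lam_pos {ι : Type*} {φ : ι → H} {lam : ι → ℝ}
    (h : IsGalerkinFamily J W φ lam) (j : ι) : 0 < lam j := by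
  classical
  have h1 := h.inner_eq j j
  rw [if_pos rfl, real_inner_self_eq_norm_sq] at h1
  rw [← h1]
  have h2 := h.orthonormal.1 j
  have h3 : φ j ≠ 0 := fun h0 => by simp [h0] at h2
  positivity

lemma IsGalerkinFamily.finrank_eigSum {ι : Type*} [Fintype ι] {φ : ι → H} {lam : ι → ℝ}
    (h : IsGalerkinFamily J W φ lam) (hspan : W ≤ Submodule.span ℝ (Set.range φ)) (μ : ℝ) :
    Module.finrank ℝ (eigSum (J ∘L W.subtypeL) μ) =
      (Finset.univ.filter fun j => lam j ≤ μ).card := by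
  refine h.isEigenFamily.finrank_eigSum (Submodule.map_injective_of_injective
    (f := W.subtype) Subtype.val_injective ?_) μ
  rw [Submodule.map_top, Submodule.range_subtype, Submodule.map_span, ← Set.range_comp]
  refine le_antisymm (Submodule.span_le.2 ?_) hspan
  rintro _ ⟨j, rfl⟩
  exact h.mem j

/-- A family of discrete eigenvectors extends to an eigenbasis of the trial space. -/
lemma IsGalerkinFamily.exists_extension [FiniteDimensional ℝ W] (hinj : Function.Injective J)
    {κ : Type*} [Fintype κ] {u : κ → H} {l : κ → ℝ} (h : IsGalerkinFamily J W u l) :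
    ∃ (p : ℕ) (φ : Fin p → H) (lam : Fin p → ℝ),
      IsGalerkinFamily J W (Sum.elim u φ) (Sum.elim l lam) ∧
        W ≤ Submodule.span ℝ (Set.range (Sum.elim u φ)) := by
  classical
  -- diagonalize on the complement of the given family
  let X : Submodule ℝ W :=
    { carrier := {w | ∀ k, inner ℝ (J (u k)) (J w) = 0}
      zero_mem' := fun k => by simp
      add_mem' := fun {a b} ha hb k => by
        have h1 := ha k
        have h2 := hb k
        simp only [Submodule.coe_add, map_add, inner_add_right, h1, h2, add_zero]
      smul_mem' := fun c a ha k => by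
        have h1 := ha k
        simp only [Submodule.coe_smul, map_smul, inner_smul_right, h1, mul_zero] }
  have hX : ∀ w : X, ∀ k, inner ℝ (J (u k)) (J (w : W)) = 0 := fun w => w.2
  let JX : X →L[ℝ] L := (J ∘L W.subtypeL) ∘L X.subtypeL
  have hinjX : Function.Injective JX :=
    (hinj.comp Subtype.val_injective).comp Subtype.val_injective
  obtain ⟨p, φ, lam, hφ, hspan⟩ := exists_eigenbasis (H := X) (L := L) (J := JX) hinjX
  have hdec : ∀ v ∈ W, ∃ x : X, v = (x : W) + ∑ k, inner ℝ (J (u k)) (J v) • u k := fun v hv => by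
    have hm : v - ∑ k, inner ℝ (J (u k)) (J v) • u k ∈ W :=
      sub_mem hv (Submodule.sum_mem _ fun k _ => Submodule.smul_mem _ _ (h.mem k))
    have hmX : (⟨_, hm⟩ : W) ∈ X := fun k => by
      simp only [map_sub, map_sum, map_smul, inner_sub_right]
      rw [h.orthonormal.inner_right_fintype, sub_self]
    exact ⟨⟨_, hmX⟩, by simp⟩
  refine ⟨p, fun j => ((φ j : W) : H), lam, ⟨?_, ?_, ?_⟩, ?_⟩
  · rw [orthonormal_iff_ite]
    have h1 := orthonormal_iff_ite.1 h.orthonormal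
    have h2 := orthonormal_iff_ite.1 hφ.orthonormal
    rintro (i | i) (j | j)
    · simpa using h1 i j
    · simpa using hX (φ j) i
    · rw [real_inner_comm]
      simpa using hX (φ i) j
    · simpa using! h2 i j
  · rintro (i | i)
    · exact h.mem i
    · exact (φ i : W).2
  · rintro (i | i) v hv
    · exact h.eq i v hv
    · obtain ⟨x, hx⟩ := hdec v hv
      have e1 : inner ℝ ((φ i : W) : H) ((x : W) : H) =
          lam i * inner ℝ (J (φ i : W)) (J (x : W)) := hφ.mem i x
      have e2 : ∀ k, inner ℝ ((φ i : W) : H) (u k) = 0 := fun k => by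
        rw [real_inner_comm, h.eq k _ (φ i : W).2, hX (φ i) k, mul_zero]
      have e3 : ∀ k, inner ℝ (J (φ i : W)) (J (u k)) = 0 := fun k => by
        rw [real_inner_comm]
        exact hX (φ i) k
      rw [hx]
      simp only [Sum.elim_inr, map_add, map_sum, map_smul, inner_add_right, inner_sum,
        inner_smul_right, e2, e3, mul_zero, Finset.sum_const_zero, add_zero]
      exact e1
  · intro v hv
    obtain ⟨x, hx⟩ := hdec v hv
    have hx' : x ∈ Submodule.span ℝ (Set.range φ) := hspan ▸ Submodule.mem_top
    obtain ⟨c, hc⟩ := (Submodule.mem_span_range_iff_exists_fun ℝ).1 hx'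
    rw [hx]
    refine add_mem ?_ (Submodule.sum_mem _ fun k _ => Submodule.smul_mem _ _
      (Submodule.subset_span ⟨Sum.inl k, rfl⟩))
    have hc' : ((x : W) : H) = ∑ j, c j • ((φ j : W) : H) := by
      rw [← hc]
      simp
    rw [hc']
    exact Submodule.sum_mem _ fun k _ => Submodule.smul_mem _ _
      (Submodule.subset_span ⟨Sum.inr k, rfl⟩)

end Counting

variable {d : ℕ}

open EnergySpace

/-! ### The cluster and its discrete counterpart -/

section Cluster

variable {V : C(Torus d, ℝ)} {k₀ N m : ℕ} {Λ : Fin m → ℝ} {q : Fin m → ℕ}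

lemma eigenvalue_H1 (hV : ∀ x, 0 < V x) (k : ℕ) :
    eigenvalue V (H1 d) k = kthEig (incl V hV) k := by
  simp only [eigenvalue, kthEig, eigenCount_H1 hV]

lemma eigenvalue_VG (hV : ∀ x, 0 < V x) (𝔾 : Finset (Freq d)) (k : ℕ) :
    eigenvalue V (VG 𝔾) k = kthEig (pwIncl hV 𝔾) k := by
  simp only [eigenvalue, kthEig, eigenCount_VG hV]

/-- The eigenvalue below the cluster, or `0` if there is none. -/
noncomputable def clusterLo (V : C(Torus d, ℝ)) (k₀ : ℕ) : ℝ :=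
  if k₀ = 0 then 0 else eigenvalue V (H1 d) k₀

/-- The eigenvalue above the cluster. -/
noncomputable def clusterHi (V : C(Torus d, ℝ)) (k₀ N : ℕ) : ℝ :=
  eigenvalue V (H1 d) (k₀ + N + 1)

/-- A cluster is followed by a further eigenvalue, so there are at least `k₀ + N + 1` eigenvalues.
-/
lemma IsCluster.exists_le_finrank (hcl : IsCluster V k₀ N m Λ q) (hV : ∀ x, 0 < V x) {k : ℕ}
    (hk : k ≤ k₀ + N + 1) : ∃ μ, k ≤ Module.finrank ℝ (eigSum (incl V hV) μ) := by
  have h : ∃ μ, k₀ + N + 1 ≤ Module.finrank ℝ (eigSum (incl V hV) μ) := by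
    by_contra h0
    have h1 := hcl.gap_right
    have hpos := hcl.pos
    -- the infimum of the empty set is `0`
    have h2 : eigenvalue V (H1 d) (k₀ + N + 1) = 0 := by
      have h3 : {μ : ℝ | k₀ + N + 1 ≤ Module.finrank ℝ (eigSum (incl V hV) μ)} = ∅ :=
        Set.eq_empty_iff_forall_notMem.2 fun μ hμ => h0 ⟨μ, hμ⟩
      rw [eigenvalue_H1 hV, kthEig, h3, Real.sInf_empty]
    rw [h2, eigenvalue_H1 hV] at h1
    exact absurd (kthEig_nonneg (J := incl V hV) (k := k₀ + N) (by omega)) (not_le.2 h1)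
  exact h.imp fun μ hμ => hk.trans hμ

lemma IsCluster.eigenvalue_le_iff (hcl : IsCluster V k₀ N m Λ q) (hV : ∀ x, 0 < V x) {k : ℕ}
    (hk0 : 0 < k) (hk : k ≤ k₀ + N + 1) {μ : ℝ} :
    eigenvalue V (H1 d) k ≤ μ ↔ k ≤ Module.finrank ℝ (eigSum (incl V hV) μ) := by
  rw [eigenvalue_H1 hV]
  exact kthEig_le_iff smallOffFinite_incl hk0 (hcl.exists_le_finrank hV hk)

lemma IsCluster.eigenvalue_mono (hcl : IsCluster V k₀ N m Λ q) (hV : ∀ x, 0 < V x) {k k' : ℕ}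
    (hk0 : 0 < k) (hkk : k ≤ k') (hk : k' ≤ k₀ + N + 1) :
    eigenvalue V (H1 d) k ≤ eigenvalue V (H1 d) k' :=
  (hcl.eigenvalue_le_iff hV hk0 (hkk.trans hk)).2
    (hkk.trans ((hcl.eigenvalue_le_iff hV (hk0.trans_le hkk) hk).1 le_rfl))

lemma IsCluster.clusterLo_nonneg (hV : ∀ x, 0 < V x) : 0 ≤ clusterLo V k₀ := by
  rw [clusterLo]
  split_ifs with h
  · exact le_rfl
  · rw [eigenvalue_H1 hV]
    exact kthEig_nonneg (Nat.pos_of_ne_zero h)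

lemma IsCluster.clusterLo_lt (hcl : IsCluster V k₀ N m Λ q) (hV : ∀ x, 0 < V x) (i : Fin m) :
    clusterLo V k₀ < Λ i := by
  obtain ⟨j, hj, e⟩ : Λ i ∈ {μ | ∃ j ∈ Finset.Icc 1 N, μ = eigenvalue V (H1 d) (k₀ + j)} :=
    hcl.range_eq ▸ Set.mem_range_self i
  rw [Finset.mem_Icc] at hj
  rw [e]
  exact hcl.gap_left.trans_le (hcl.eigenvalue_mono hV (by omega) (by omega) (by omega))

lemma IsCluster.lt_clusterHi (hcl : IsCluster V k₀ N m Λ q) (hV : ∀ x, 0 < V x) (i : Fin m) :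
    Λ i < clusterHi V k₀ N := by
  obtain ⟨j, hj, e⟩ : Λ i ∈ {μ | ∃ j ∈ Finset.Icc 1 N, μ = eigenvalue V (H1 d) (k₀ + j)} :=
    hcl.range_eq ▸ Set.mem_range_self i
  rw [Finset.mem_Icc] at hj
  rw [e]
  exact (hcl.eigenvalue_mono hV (by omega) (by omega) (by omega)).trans_lt hcl.gap_right

lemma IsCluster.pos_of_index (hcl : IsCluster V k₀ N m Λ q) (hV : ∀ x, 0 < V x) (i : Fin m) :
    0 < Λ i :=
  (IsCluster.clusterLo_nonneg hV).trans_lt (hcl.clusterLo_lt hV i)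

lemma IsCluster.clusterLo_eq (hcl : IsCluster V k₀ N m Λ q) (hV : ∀ x, 0 < V x) :
    clusterLo V k₀ = 0 ∨ genEig (incl V hV) (clusterLo V k₀) ≠ ⊥ := by
  rw [clusterLo]
  split_ifs with h
  · exact Or.inl rfl
  · right
    rw [eigenvalue_H1 hV]
    exact genEig_kthEig_ne_bot incl_injective smallOffFinite_incl (Nat.pos_of_ne_zero h)
      (hcl.exists_le_finrank hV (by omega))

lemma IsCluster.genEig_clusterHi (hcl : IsCluster V k₀ N m Λ q) (hV : ∀ x, 0 < V x) :
    genEig (incl V hV) (clusterHi V k₀ N) ≠ ⊥ := by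
  rw [clusterHi, eigenvalue_H1 hV]
  exact genEig_kthEig_ne_bot incl_injective smallOffFinite_incl (by omega)
    (hcl.exists_le_finrank hV le_rfl)

lemma IsCluster.finrank_clusterLo (hcl : IsCluster V k₀ N m Λ q) (hV : ∀ x, 0 < V x) :
    Module.finrank ℝ (eigSum (incl V hV) (clusterLo V k₀)) = k₀ := by
  have hgap := hcl.gap_left
  change clusterLo V k₀ < _ at hgap
  refine le_antisymm (Nat.lt_succ_iff.1 (not_le.1 fun h => ?_)) ?_
  · rw [← hcl.eigenvalue_le_iff hV (by omega) (by omega)] at h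
    exact absurd hgap (not_lt.2 h)
  · rcases Nat.eq_zero_or_pos k₀ with h | h
    · rw [h]
      exact Nat.zero_le _
    · refine (hcl.eigenvalue_le_iff hV h (by omega)).1 (le_of_eq ?_)
      rw [clusterLo, if_neg h.ne']

lemma IsCluster.finrank_le_of_lt_clusterHi (hcl : IsCluster V k₀ N m Λ q) (hV : ∀ x, 0 < V x)
    {μ : ℝ} (h : μ < clusterHi V k₀ N) :
    Module.finrank ℝ (eigSum (incl V hV) μ) ≤ k₀ + N := by
  by_contra h'
  have h2 : k₀ + N + 1 ≤ Module.finrank ℝ (eigSum (incl V hV) μ) := by omega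
  rw [← hcl.eigenvalue_le_iff hV (by omega) le_rfl] at h2
  exact absurd h (not_lt.2 h2)

/-- Every eigenvalue strictly between the neighbours of the cluster belongs to the cluster. -/
lemma IsCluster.exists_eq (hcl : IsCluster V k₀ N m Λ q) (hV : ∀ x, 0 < V x) {μ : ℝ}
    (h1 : clusterLo V k₀ < μ) (h2 : μ < clusterHi V k₀ N) (h : genEig (incl V hV) μ ≠ ⊥) :
    ∃ i, μ = Λ i := by
  have e1 := kthEig_finrank_eigSum incl_injective smallOffFinite_incl h
  have e2 := finrank_eigSum_add_le (incl_injective (hV := hV)) smallOffFinite_incl h1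
  have e3 := finrank_genEig_pos smallOffFinite_incl h
  have e4 := hcl.finrank_le_of_lt_clusterHi hV h2
  rw [hcl.finrank_clusterLo hV] at e2
  have e5 : μ ∈ {μ | ∃ j ∈ Finset.Icc 1 N, μ = eigenvalue V (H1 d) (k₀ + j)} := by
    refine ⟨Module.finrank ℝ (eigSum (incl V hV) μ) - k₀, Finset.mem_Icc.2 (by omega), ?_⟩
    rw [Nat.add_sub_cancel' (by omega), eigenvalue_H1 hV, e1]
  rw [← hcl.range_eq] at e5
  obtain ⟨i, hi⟩ := e5
  exact ⟨i, hi.symm⟩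

lemma IsCluster.finrank_genEig (hcl : IsCluster V k₀ N m Λ q) (hV : ∀ x, 0 < V x) (i : Fin m) :
    Module.finrank ℝ (genEig (incl V hV) (Λ i)) = q i := by
  rw [hcl.mult i, finrank_eigenspace_H1 hV]

/-- The number of eigenvalues up to `Λ i`. -/
lemma IsCluster.finrank_eigSum (hcl : IsCluster V k₀ N m Λ q) (hV : ∀ x, 0 < V x) (i : Fin m) :
    Module.finrank ℝ (eigSum (incl V hV) (Λ i)) = k₀ + offset q i + q i := by
  obtain ⟨n, hn⟩ := i
  induction n with
  | zero =>
    rw [finrank_eigSum_step smallOffFinite_incl (hcl.clusterLo_lt hV ⟨0, hn⟩) fun ν h1 h2 => ?_,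
      hcl.finrank_clusterLo hV, hcl.finrank_genEig hV]
    · have : offset q ⟨0, hn⟩ = 0 := by
        refine Finset.sum_eq_zero fun j hj => ?_
        exact absurd (Finset.mem_filter.1 hj).2 (by simp [Fin.lt_def])
      omega
    · by_contra h3
      obtain ⟨j, rfl⟩ := hcl.exists_eq hV h1 (h2.trans (hcl.lt_clusterHi hV _)) h3
      exact absurd (hcl.strictMono.lt_iff_lt.1 h2) (by simp [Fin.lt_def])
  | succ n ih =>
    have hn' : n < m := by omega
    have hlt : (⟨n, hn'⟩ : Fin m) < ⟨n + 1, hn⟩ := by simp [Fin.lt_def]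
    rw [finrank_eigSum_step smallOffFinite_incl (hcl.strictMono hlt) fun ν h1 h2 => ?_, ih hn',
      hcl.finrank_genEig hV]
    · have : offset q ⟨n + 1, hn⟩ = offset q ⟨n, hn'⟩ + q ⟨n, hn'⟩ := by
        have e : Finset.univ.filter (· < (⟨n + 1, hn⟩ : Fin m)) =
            insert ⟨n, hn'⟩ (Finset.univ.filter (· < (⟨n, hn'⟩ : Fin m))) := by
          ext j
          simp only [Finset.mem_filter, Finset.mem_univ, true_and, Finset.mem_insert, Fin.lt_def,
            Fin.ext_iff]
          omega
        rw [offset, e, Finset.sum_insert (by simp), add_comm]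
        rfl
      omega
    · by_contra h3
      obtain ⟨j, rfl⟩ := hcl.exists_eq hV ((hcl.clusterLo_lt hV _).trans h1)
        (h2.trans (hcl.lt_clusterHi hV _)) h3
      have h4 := hcl.strictMono.lt_iff_lt.1 h1
      have h5 := hcl.strictMono.lt_iff_lt.1 h2
      simp only [Fin.lt_def] at h4 h5
      omega

lemma IsCluster.finrank_le_of_lt (hcl : IsCluster V k₀ N m Λ q) (hV : ∀ x, 0 < V x) {i : Fin m}
    {μ : ℝ} (h : μ < Λ i) : Module.finrank ℝ (eigSum (incl V hV) μ) ≤ k₀ + offset q i := by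
  have h1 := finrank_eigSum_add_le (incl_injective (hV := hV)) smallOffFinite_incl h
  rw [hcl.finrank_eigSum hV, hcl.finrank_genEig hV] at h1
  omega

/-- The position `k_i + l` in the cluster of the `l`-th member of the `i`-th block. -/
noncomputable def blockEquiv (h : N = ∑ i, q i) : (Σ i, Fin (q i)) ≃ Fin N :=
  finSigmaFinEquiv.trans (finCongr h.symm)

lemma blockEquiv_val (h : N = ∑ i, q i) (i : Fin m) (l : Fin (q i)) :
    (blockEquiv h ⟨i, l⟩ : ℕ) = offset q i + l := by
  rw [blockEquiv, Equiv.trans_apply, finCongr_apply, Fin.val_cast, finSigmaFinEquiv_apply]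
  congr 1
  refine Finset.sum_bij (fun (j : Fin i) _ => Fin.castLE i.2.le j) (fun j _ => ?_)
    (fun j _ j' _ h => ?_) (fun j hj => ?_) fun _ _ => rfl
  · exact Finset.mem_filter.2 ⟨Finset.mem_univ _, Fin.lt_def.2 j.2⟩
  · simpa [Fin.ext_iff] using h
  · exact ⟨⟨j, (Finset.mem_filter.1 hj).2⟩, Finset.mem_univ _, rfl⟩

/-- The block to which a member of the cluster belongs. -/
noncomputable def block (h : N = ∑ i, q i) (l : Fin N) : Fin m := ((blockEquiv h).symm l).1

/-- The block of a member of an eigenbasis that extends the discrete cluster. -/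
noncomputable def blockOption (h : N = ∑ i, q i) {p : ℕ} : Fin N ⊕ Fin p → Option (Fin m) :=
  Sum.elim (fun l => some (block h l)) fun _ => none

/-- A discrete eigenbasis `φ`, whose first `N` members belong to the discrete cluster, with
discrete eigenvalues `lam` that are separated from the exact cluster blockwise: quantitatively, by
means of `c`, and by the circles with centres `(Λ i)⁻¹` and radii `r i`. -/
structure IsClusterBasis (hV : ∀ x, 0 < V x) (hN : N = ∑ i, q i) (𝔾 : Finset (Freq d))
    (Λ r : Fin m → ℝ) (c : ℝ) {p : ℕ} (φ : Fin N ⊕ Fin p → EnergySpace V hV)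
    (lam : Fin N ⊕ Fin p → ℝ) : Prop where
  galerkin : IsGalerkinFamily (incl V hV) (pwSpace hV 𝔾) φ lam
  span_le : pwSpace hV 𝔾 ≤ Submodule.span ℝ (Set.range φ)
  lower : ∀ l, Λ (block hN l) ≤ lam (Sum.inl l)
  upper : ∀ l, lam (Sum.inl l) ≤ c
  sep : ∀ j i, blockOption hN j ≠ some i → lam j ≠ Λ i ∧ lam j * Λ i ^ 2 ≤ c * (lam j - Λ i) ^ 2
  inside : ∀ j i, blockOption hN j = some i → |(lam j)⁻¹ - (Λ i)⁻¹| < r i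
  outside : ∀ j i, blockOption hN j ≠ some i → r i < |(lam j)⁻¹ - (Λ i)⁻¹|

/-- Smallness of `g` compared with the distances of the eigenvalues of the cluster from one
another, from the remaining spectrum, and from the circles. -/
structure IsGap (V : C(Torus d, ℝ)) (k₀ N : ℕ) (Λ r : Fin m → ℝ) (g : ℝ) : Prop where
  pos : 0 < g
  inner : ∀ i k, k ≠ i → 2 * g ≤ |Λ k - Λ i|
  left : ∀ i, 2 * g ≤ Λ i - clusterLo V k₀
  right : ∀ i, 2 * g ≤ clusterHi V k₀ N - Λ i
  inside : ∀ i x, Λ i ≤ x → x ≤ Λ i + g → |x⁻¹ - (Λ i)⁻¹| < r i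
  outside : ∀ i k, k ≠ i → ∀ x, Λ k ≤ x → x ≤ Λ k + g → r i < |x⁻¹ - (Λ i)⁻¹|
  outside_left : ∀ i, (clusterLo V k₀ + g) * ((Λ i)⁻¹ + r i) < 1
  outside_right : ∀ i, (clusterHi V k₀ N)⁻¹ + r i < (Λ i)⁻¹

lemma eventually_two_mul_le {a : ℝ} (ha : 0 < a) : ∀ᶠ g in nhdsWithin (0 : ℝ) (Set.Ioi 0),
    2 * g ≤ a := by
  filter_upwards [Ioo_mem_nhdsGT (show (0 : ℝ) < a / 2 by positivity)] with g hg
  linarith [hg.2]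

lemma eventually_forall_Icc {a : ℝ} {P : ℝ → Prop} (h : ∀ᶠ x in nhds a, P x) :
    ∀ᶠ g in nhdsWithin (0 : ℝ) (Set.Ioi 0), ∀ x, a ≤ x → x ≤ a + g → P x := by
  obtain ⟨ε, hε, hP⟩ := Metric.eventually_nhds_iff.1 h
  filter_upwards [Ioo_mem_nhdsGT hε] with g hg x h1 h2
  refine hP ?_
  rw [Real.dist_eq, abs_of_nonneg (by linarith)]
  linarith [hg.2]

/-- All conditions hold for sufficiently small `g`. -/
lemma IsCluster.exists_isGap (hcl : IsCluster V k₀ N m Λ q) (hV : ∀ x, 0 < V x) {r : Fin m → ℝ}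
    (hr : ∀ i, 0 < r i ∧
      ∀ μ : ℝ, eigenspace V (H1 d) μ ≠ ⊥ → μ ≠ Λ i → r i < |μ⁻¹ - (Λ i)⁻¹|) :
    ∃ g, IsGap V k₀ N Λ r g := by
  have heig : ∀ μ, genEig (incl V hV) μ ≠ ⊥ → eigenspace V (H1 d) μ ≠ ⊥ := fun μ h h' => by
    rw [eigenspace_H1_eq_map (hV := hV)] at h'
    exact h (Submodule.map_injective_of_injective toL2_injective
      (h'.trans (Submodule.map_bot _).symm))
  have hΛ : ∀ i, 0 < Λ i := hcl.pos_of_index hV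
  have hq : ∀ k, eigenspace V (H1 d) (Λ k) ≠ ⊥ := fun k => by
    refine heig _ fun h0 => ?_
    have h1 : Λ k ∈ {μ | ∃ j ∈ Finset.Icc 1 N, μ = eigenvalue V (H1 d) (k₀ + j)} :=
      hcl.range_eq ▸ Set.mem_range_self k
    obtain ⟨j, hj, e⟩ := h1
    rw [Finset.mem_Icc] at hj
    rw [e, eigenvalue_H1 hV] at h0
    exact genEig_kthEig_ne_bot incl_injective smallOffFinite_incl (by omega)
      (hcl.exists_le_finrank hV (by omega)) h0
  have hcont : ∀ i k, ContinuousAt (fun x : ℝ => |x⁻¹ - (Λ i)⁻¹|) (Λ k) := fun i k =>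
    ((continuousAt_inv₀ (hΛ k).ne').sub continuousAt_const).abs
  have hlo : ∀ i, clusterLo V k₀ * ((Λ i)⁻¹ + r i) < 1 := fun i => by
    rcases hcl.clusterLo_eq hV with h | h
    · rw [h, zero_mul]
      exact one_pos
    · have h1 := (hr i).2 _ (heig _ h) (hcl.clusterLo_lt hV i).ne
      have h2 : 0 < clusterLo V k₀ := by
        refine lt_of_le_of_ne (IsCluster.clusterLo_nonneg hV) fun h0 => h ?_
        rw [← h0]
        exact genEig_eq_bot le_rfl
      rw [abs_of_nonneg (sub_nonneg.2 (inv_anti₀ h2 (hcl.clusterLo_lt hV i).le)),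
        lt_sub_iff_add_lt'] at h1
      calc _ < clusterLo V k₀ * (clusterLo V k₀)⁻¹ := by gcongr
        _ = 1 := mul_inv_cancel₀ h2.ne'
  have hhi : ∀ i, (clusterHi V k₀ N)⁻¹ + r i < (Λ i)⁻¹ := fun i => by
    have h1 := (hr i).2 _ (heig _ (hcl.genEig_clusterHi hV)) (hcl.lt_clusterHi hV i).ne'
    rw [abs_sub_comm, abs_of_nonneg (sub_nonneg.2 (inv_anti₀ (hΛ i)
      (hcl.lt_clusterHi hV i).le))] at h1
    linarith
  have e0 : ∀ᶠ g in nhdsWithin (0 : ℝ) (Set.Ioi 0), 0 < g := self_mem_nhdsWithin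
  have e1 : ∀ᶠ g in nhdsWithin (0 : ℝ) (Set.Ioi 0), ∀ i k, k ≠ i → 2 * g ≤ |Λ k - Λ i| :=
    Filter.eventually_all.2 fun i => Filter.eventually_all.2 fun k =>
      Filter.eventually_imp_distrib_left.2 fun hk => eventually_two_mul_le
        (abs_pos.2 (sub_ne_zero.2 fun h => hk (hcl.strictMono.injective h)))
  have e2 : ∀ᶠ g in nhdsWithin (0 : ℝ) (Set.Ioi 0), ∀ i, 2 * g ≤ Λ i - clusterLo V k₀ :=
    Filter.eventually_all.2 fun i => eventually_two_mul_le (sub_pos.2 (hcl.clusterLo_lt hV i))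
  have e3 : ∀ᶠ g in nhdsWithin (0 : ℝ) (Set.Ioi 0), ∀ i, 2 * g ≤ clusterHi V k₀ N - Λ i :=
    Filter.eventually_all.2 fun i => eventually_two_mul_le (sub_pos.2 (hcl.lt_clusterHi hV i))
  have e4 : ∀ᶠ g in nhdsWithin (0 : ℝ) (Set.Ioi 0), ∀ i x, Λ i ≤ x → x ≤ Λ i + g →
      |x⁻¹ - (Λ i)⁻¹| < r i := Filter.eventually_all.2 fun i =>
    eventually_forall_Icc ((hcont i i).eventually (gt_mem_nhds (by simpa using (hr i).1)))
  have e5 : ∀ᶠ g in nhdsWithin (0 : ℝ) (Set.Ioi 0), ∀ i k, k ≠ i → ∀ x, Λ k ≤ x → x ≤ Λ k + g →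
      r i < |x⁻¹ - (Λ i)⁻¹| := Filter.eventually_all.2 fun i => Filter.eventually_all.2 fun k =>
    Filter.eventually_imp_distrib_left.2 fun hk => eventually_forall_Icc
      ((hcont i k).eventually (lt_mem_nhds ((hr i).2 _ (hq k)
        fun h => hk (hcl.strictMono.injective h))))
  have e6 : ∀ᶠ g in nhdsWithin (0 : ℝ) (Set.Ioi 0),
      ∀ i, (clusterLo V k₀ + g) * ((Λ i)⁻¹ + r i) < 1 := Filter.eventually_all.2 fun i => by
    have hlim : Filter.Tendsto (fun g : ℝ => (clusterLo V k₀ + g) * ((Λ i)⁻¹ + r i)) (nhds 0)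
        (nhds ((clusterLo V k₀ + 0) * ((Λ i)⁻¹ + r i))) := Continuous.tendsto (by fun_prop) 0
    rw [add_zero] at hlim
    exact (hlim.eventually (gt_mem_nhds (hlo i))).filter_mono nhdsWithin_le_nhds
  obtain ⟨g, ⟨⟨⟨⟨⟨⟨h0, h1⟩, h2⟩, h3⟩, h4⟩, h5⟩, h6⟩⟩ :=
    ((((((e0.and e1).and e2).and e3).and e4).and e5).and e6).exists
  exact ⟨g, h0, h1, h2, h3, h4, h5, h6, hhi⟩

/-- The quotient `x a² / (x - a)²` is bounded in `x ≥ 0` away from `a`, in particular as `x → ∞`. -/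
lemma mul_sq_le_of_le_abs {x a g : ℝ} (hx : 0 ≤ x) (ha : 0 ≤ a) (hg : 0 < g)
    (h : g ≤ |x - a|) : x * a ^ 2 ≤ a ^ 2 * (a + g) / g ^ 2 * (x - a) ^ 2 := by
  have key : x * g ^ 2 ≤ (a + g) * (x - a) ^ 2 := by
    rcases le_abs.1 h with h1 | h1
    · obtain ⟨t, rfl⟩ : ∃ t, x = a + g + t := ⟨x - a - g, by ring⟩
      have ht : 0 ≤ t := by linarith
      have : (a + g) * (a + g + t - a) ^ 2 - (a + g + t) * g ^ 2 =
          t * (2 * a * g + a * t + g ^ 2 + g * t) := by ring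
      have : 0 ≤ t * (2 * a * g + a * t + g ^ 2 + g * t) := by positivity
      linarith
    · have h2 : g ^ 2 ≤ (x - a) ^ 2 := by nlinarith
      have h3 : x ≤ a + g := by linarith
      calc x * g ^ 2 ≤ (a + g) * g ^ 2 := by gcongr
        _ ≤ _ := by gcongr
  have hg2 : 0 < g ^ 2 := by positivity
  rw [div_mul_eq_mul_div, le_div_iff₀ hg2]
  nlinarith [mul_le_mul_of_nonneg_left key (sq_nonneg a)]

/-- On sufficiently rich planewave spaces, the discrete eigenvalues of the cluster lie in narrow
intervals to the right of the exact ones. -/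
lemma IsCluster.exists_cutoff (hcl : IsCluster V k₀ N m Λ q) (hV : ∀ x, 0 < V x) {g : ℝ}
    (hg : 0 < g) : ∃ M : ℕ, ∀ 𝔾 : Finset (Freq d), ballFreq d M ⊆ 𝔾 →
      k₀ ≤ Module.finrank ℝ (eigSum (pwIncl hV 𝔾) (clusterLo V k₀ + g)) ∧
      ∀ i, k₀ + offset q i + q i ≤ Module.finrank ℝ (eigSum (pwIncl hV 𝔾) (Λ i + g)) := by
  have key : ∀ μ : ℝ, 0 ≤ μ → ∃ M : ℕ, ∀ 𝔾 : Finset (Freq d), ballFreq d M ⊆ 𝔾 →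
      Module.finrank ℝ (eigSum (incl V hV) μ) ≤
        Module.finrank ℝ (eigSum (pwIncl hV 𝔾) (μ + g)) := fun μ hμ => by
    obtain ⟨ν, hν, h⟩ := exists_finrank_eigSum_le_restrict (incl_injective (hV := hV)) hμ hg
    obtain ⟨M, hM⟩ := exists_ball_norm_le hV hν
    exact ⟨M, fun 𝔾 h𝔾 => h _ (finiteDimensional_pwSpace 𝔾) (hM 𝔾 h𝔾)⟩
  obtain ⟨M₁, h₁⟩ := key _ (IsCluster.clusterLo_nonneg (k₀ := k₀) hV)
  choose M₂ h₂ using fun i => key (Λ i) (hcl.pos_of_index hV i).le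
  refine ⟨M₁ + ∑ i, M₂ i, fun 𝔾 h𝔾 => ⟨?_, fun i => ?_⟩⟩
  · have := h₁ 𝔾 ((ballFreq_mono (Nat.le_add_right _ _)).trans h𝔾)
    rwa [hcl.finrank_clusterLo hV] at this
  · have hi : M₂ i ≤ ∑ i, M₂ i := Finset.single_le_sum (fun _ _ => Nat.zero_le _)
      (Finset.mem_univ i)
    have := h₂ i 𝔾 ((ballFreq_mono (hi.trans (Nat.le_add_left _ _))).trans h𝔾)
    rwa [hcl.finrank_eigSum hV] at this

/-- The discrete eigenvalues are bounded below by the exact ones, and above as soon as the discrete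
counting function has caught up. -/
lemma IsCluster.eigenvalue_VG_mem (hcl : IsCluster V k₀ N m Λ q) (hV : ∀ x, 0 < V x) {g : ℝ}
    {𝔾 : Finset (Freq d)}
    (h𝔾 : ∀ i, k₀ + offset q i + q i ≤ Module.finrank ℝ (eigSum (pwIncl hV 𝔾) (Λ i + g)))
    (l : Fin N) : Λ (block hcl.sum_mult l) ≤ eigenvalue V (VG 𝔾) (k₀ + l + 1) ∧
      eigenvalue V (VG 𝔾) (k₀ + l + 1) ≤ Λ (block hcl.sum_mult l) + g := by
  obtain ⟨⟨i, l'⟩, rfl⟩ := (blockEquiv hcl.sum_mult).surjective l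
  rw [block, Equiv.symm_apply_apply, blockEquiv_val, eigenvalue_VG hV]
  dsimp only
  have hl := l'.2
  have hne : ∃ μ, k₀ + (offset q i + l') + 1 ≤ Module.finrank ℝ (eigSum (pwIncl hV 𝔾) μ) :=
    ⟨_, le_trans (by omega) (h𝔾 i)⟩
  have hiff := fun μ => kthEig_le_iff (μ := μ)
    (smallOffFinite_of_finiteDimensional (J := pwIncl hV 𝔾)) (by omega) hne
  refine ⟨not_lt.1 fun hlt => ?_, (hiff _).2 (le_trans (by omega) (h𝔾 i))⟩
  have h1 := (hiff _).1 le_rfl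
  have h2 := hcl.finrank_le_of_lt hV hlt
  have h3 := finrank_eigSum_restrict_le (incl_injective (hV := hV)) smallOffFinite_incl
    (pwSpace hV 𝔾) (kthEig (pwIncl hV 𝔾) (k₀ + (offset q i + l') + 1))
  have h4 := h1.trans (h3.trans h2)
  omega

end Cluster

/-! ### Discrete eigenbases adapted to the cluster -/

section ClusterBasis

variable {V : C(Torus d, ℝ)} {k₀ N m : ℕ} {Λ : Fin m → ℝ} {q : Fin m → ℕ}

/-- Counting shows that the complementary discrete eigenvalues stay away from the cluster. -/
lemma IsCluster.le_or_le_of_inr (hcl : IsCluster V k₀ N m Λ q) (hV : ∀ x, 0 < V x) {r : Fin m → ℝ}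
    {g : ℝ} (hg : IsGap V k₀ N Λ r g) {𝔾 : Finset (Freq d)}
    (h𝔾 : k₀ ≤ Module.finrank ℝ (eigSum (pwIncl hV 𝔾) (clusterLo V k₀ + g)))
    {p : ℕ} {φ : Fin N ⊕ Fin p → EnergySpace V hV} {lam : Fin N ⊕ Fin p → ℝ}
    (h : IsGalerkinFamily (incl V hV) (pwSpace hV 𝔾) φ lam)
    (hspan : pwSpace hV 𝔾 ≤ Submodule.span ℝ (Set.range φ))
    (hl : ∀ l, Λ (block hcl.sum_mult l) ≤ lam (Sum.inl l))
    (hl' : ∀ l, lam (Sum.inl l) ≤ Λ (block hcl.sum_mult l) + g) (j : Fin p) :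
    lam (Sum.inr j) ≤ clusterLo V k₀ + g ∨ clusterHi V k₀ N ≤ lam (Sum.inr j) := by
  by_contra hj
  rw [not_or, not_le, not_le] at hj
  obtain ⟨hj1, hj2⟩ := hj
  have hgpos := hg.pos
  set μ := max (lam (Sum.inr j)) (clusterHi V k₀ N - g) with hμ
  have hμhi : μ < clusterHi V k₀ N := max_lt hj2 (by linarith)
  have hcount : ∀ t, Module.finrank ℝ (eigSum (pwIncl hV 𝔾) t) =
      (Finset.univ.filter fun l => lam (Sum.inl l) ≤ t).card +
        (Finset.univ.filter fun l => lam (Sum.inr l) ≤ t).card := fun t => by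
    rw [pwIncl, h.finrank_eigSum hspan t, Finset.card_filter, Fintype.sum_sum_type,
      Finset.card_filter, Finset.card_filter]
  have e1 : (Finset.univ.filter fun l => lam (Sum.inl l) ≤ μ).card = N := by
    rw [Finset.filter_true_of_mem, Finset.card_univ, Fintype.card_fin]
    intro l _
    have := hg.right (block hcl.sum_mult l)
    exact le_max_of_le_right (by linarith [hl' l])
  have e2 : (Finset.univ.filter fun l => lam (Sum.inl l) ≤ clusterLo V k₀ + g).card = 0 := by
    rw [Finset.card_eq_zero, Finset.filter_eq_empty_iff]
    intro l _ hle
    have := hg.left (block hcl.sum_mult l)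
    linarith [hl l]
  have e3 : (Finset.univ.filter fun l => lam (Sum.inr l) ≤ clusterLo V k₀ + g).card <
      (Finset.univ.filter fun l => lam (Sum.inr l) ≤ μ).card := by
    refine Finset.card_lt_card ((Finset.ssubset_iff_of_subset fun l hl => ?_).2 ⟨j, ?_, ?_⟩)
    · rw [Finset.mem_filter] at hl ⊢
      exact ⟨hl.1, hl.2.trans (hj1.le.trans (le_max_left _ _))⟩
    · exact Finset.mem_filter.2 ⟨Finset.mem_univ _, le_max_left _ _⟩
    · exact fun hmem => absurd (Finset.mem_filter.1 hmem).2 (not_le.2 hj1)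
  -- `k₀` discrete eigenvalues below the cluster, `N` in it and one more exceed the exact count
  have e4 : Module.finrank ℝ (eigSum (pwIncl hV 𝔾) μ) ≤ k₀ + N :=
    (finrank_eigSum_restrict_le (incl_injective (hV := hV)) smallOffFinite_incl
      (pwSpace hV 𝔾) μ).trans (hcl.finrank_le_of_lt_clusterHi hV hμhi)
  rw [hcount] at h𝔾 e4
  omega

/-- On sufficiently rich planewave spaces, discrete eigenvectors of the cluster extend to an
eigenbasis with uniform spectral separation. -/
theorem IsCluster.exists_clusterBasis (hcl : IsCluster V k₀ N m Λ q) (hV : ∀ x, 0 < V x)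
    {r : Fin m → ℝ} (hr : ∀ i, 0 < r i ∧
      ∀ μ : ℝ, eigenspace V (H1 d) μ ≠ ⊥ → μ ≠ Λ i → r i < |μ⁻¹ - (Λ i)⁻¹|) :
    (∀ i, r i < (Λ i)⁻¹) ∧ ∃ c : ℝ, 0 ≤ c ∧ ∃ M : ℕ, ∀ 𝔾 : Finset (Freq d), ballFreq d M ⊆ 𝔾 →
      ∀ u : Fin N → EnergySpace V hV, IsGalerkinFamily (incl V hV) (pwSpace hV 𝔾) u
        (fun l => eigenvalue V (VG 𝔾) (k₀ + l + 1)) →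
      ∃ (p : ℕ) (φ : Fin p → EnergySpace V hV) (lam : Fin p → ℝ),
        IsClusterBasis hV hcl.sum_mult 𝔾 Λ r c (Sum.elim u φ)
          (Sum.elim (fun l => eigenvalue V (VG 𝔾) (k₀ + l + 1)) lam) := by
  obtain ⟨g, hg⟩ := hcl.exists_isGap hV hr
  have hgpos := hg.pos
  have hΛ : ∀ i, 0 < Λ i := hcl.pos_of_index hV
  have hhi : ∀ i, 0 < (clusterHi V k₀ N)⁻¹ := fun i =>
    inv_pos.2 ((hΛ i).trans (hcl.lt_clusterHi hV i))
  refine ⟨fun i => by linarith [hg.outside_right i, hhi i], ?_⟩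
  obtain ⟨M, hM⟩ := hcl.exists_cutoff hV hgpos
  let b : Fin m → ℝ := fun i => Λ i + g + Λ i ^ 2 * (Λ i + g) / g ^ 2
  have hb : ∀ i, 0 ≤ b i := fun i => by
    have := hΛ i
    positivity
  have hbs : ∀ i, b i ≤ ∑ i, b i := fun i =>
    Finset.single_le_sum (fun i _ => hb i) (Finset.mem_univ i)
  refine ⟨∑ i, b i, Finset.sum_nonneg fun i _ => hb i, M, fun 𝔾 h𝔾 u hu => ?_⟩
  obtain ⟨h1, h2⟩ := hM 𝔾 h𝔾
  obtain ⟨p, φ, lam', hφ, hspan⟩ := hu.exists_extension incl_injective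
  refine ⟨p, φ, lam', ?_⟩
  set lam : Fin N ⊕ Fin p → ℝ :=
    Sum.elim (fun l => eigenvalue V (VG 𝔾) (k₀ + l + 1)) lam' with hlam
  have hl := fun l => (hcl.eigenvalue_VG_mem hV h2 l).1
  have hl' := fun l => (hcl.eigenvalue_VG_mem hV h2 l).2
  have hinr := hcl.le_or_le_of_inr hV hg h1 hφ hspan hl hl'
  have hpos := hφ.lam_pos
  -- distances on the scale of the eigenvalues
  have hdist : ∀ j i, blockOption hcl.sum_mult j ≠ some i → g ≤ |lam j - Λ i| := by
    rintro (l | j) i hj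
    · have hk : block hcl.sum_mult l ≠ i := fun h => hj (congrArg some h)
      have e1 := hg.inner i _ hk
      have e2 := hl l
      have e3 := hl' l
      have e4 : |Λ (block hcl.sum_mult l) - Λ i| ≤ |lam (Sum.inl l) - Λ i| +
          |lam (Sum.inl l) - Λ (block hcl.sum_mult l)| := by
        rw [abs_sub_comm (lam (Sum.inl l)) (Λ (block hcl.sum_mult l)), add_comm]
        exact abs_sub_le _ _ _
      have e5 : |lam (Sum.inl l) - Λ (block hcl.sum_mult l)| ≤ g := by
        have e6 : 0 ≤ lam (Sum.inl l) - Λ (block hcl.sum_mult l) := sub_nonneg.2 e2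
        rw [abs_of_nonneg e6]
        exact sub_le_iff_le_add'.2 e3
      linarith
    · rcases hinr j with h | h
      · have := hg.left i
        exact le_abs.2 (Or.inr (by linarith))
      · have := hg.right i
        exact le_abs.2 (Or.inl (by linarith))
  refine ⟨hφ, hspan, hl, fun l => (hl' l).trans (le_trans ?_ (hbs (block hcl.sum_mult l))),
    fun j i hj => ⟨fun h => ?_, ?_⟩, ?_, ?_⟩
  · have := hΛ (block hcl.sum_mult l)
    exact le_add_of_nonneg_right (by positivity)
  · have := hdist j i hj
    rw [h, sub_self, abs_zero] at this
    linarith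
  · refine (mul_sq_le_of_le_abs (hpos j).le (hΛ i).le hgpos (hdist j i hj)).trans ?_
    refine mul_le_mul_of_nonneg_right (le_trans ?_ (hbs i)) (sq_nonneg _)
    have := hΛ i
    exact le_add_of_nonneg_left (by positivity)
  · rintro (l | j) i hj
    · have hk : block hcl.sum_mult l = i := Option.some_injective _ hj
      subst hk
      exact hg.inside _ _ (hl l) (hl' l)
    · exact absurd hj (by simp [blockOption])
  · rintro (l | j) i hj
    · exact hg.outside i _ (fun h => hj (congrArg some h)) _ (hl l) (hl' l)
    · have hp : 0 < lam (Sum.inr j) := hpos _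
      rcases hinr j with h | h
      · have e1 := hg.outside_left i
        have e2 : 0 < (Λ i)⁻¹ + r i := add_pos (inv_pos.2 (hΛ i)) (hr i).1
        have e3 : lam (Sum.inr j) * ((Λ i)⁻¹ + r i) < 1 :=
          lt_of_le_of_lt (mul_le_mul_of_nonneg_right h e2.le) e1
        have e4 : (Λ i)⁻¹ + r i < (lam (Sum.inr j))⁻¹ := by
          rw [inv_eq_one_div (lam _), lt_div_iff₀ hp]
          linarith
        exact lt_abs.2 (Or.inl (by linarith))
      · have e1 := hg.outside_right i
        have e2 : (lam (Sum.inr j))⁻¹ ≤ (clusterHi V k₀ N)⁻¹ :=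
          inv_anti₀ ((hΛ i).trans (hcl.lt_clusterHi hV i)) h
        exact lt_abs.2 (Or.inr (by linarith))

end ClusterBasis

/-! ### Exact and lifted discrete eigenfunctions -/

section Comparison

variable {V : C(Torus d, ℝ)} {k₀ N m : ℕ} {Λ : Fin m → ℝ} {q : Fin m → ℕ}

/-- The distance of a tuple from a planewave space in the energy norm. -/
noncomputable def pwDist {hV : ∀ x, 0 < V x} {κ : Type*} [Fintype κ] (ψ : κ → EnergySpace V hV)
    (𝔾 : Finset (Freq d)) : ℝ := tupleNorm fun j => ψ j - (pwSpace hV 𝔾).starProjection (ψ j)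

lemma pwDist_nonneg {hV : ∀ x, 0 < V x} {κ : Type*} [Fintype κ] (ψ : κ → EnergySpace V hV)
    (𝔾 : Finset (Freq d)) : 0 ≤ pwDist ψ 𝔾 := tupleNorm_nonneg _

lemma norm_sub_starProjection_le {H : Type*} [NormedAddCommGroup H] [InnerProductSpace ℝ H]
    (W : Submodule ℝ H) [W.HasOrthogonalProjection] (x : H) :
    ‖x - W.starProjection x‖ ≤ ‖x‖ := by
  rw [← W.starProjection_orthogonal_val]
  exact Wᗮ.norm_starProjection_apply_le x

lemma pwDist_le_tupleNorm {hV : ∀ x, 0 < V x} {κ : Type*} [Fintype κ]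
    (ψ : κ → EnergySpace V hV) (𝔾 : Finset (Freq d)) : pwDist ψ 𝔾 ≤ tupleNorm ψ := by
  have := tupleNorm_mono (a := fun j => ψ j - (pwSpace hV 𝔾).starProjection (ψ j)) (b := ψ)
    zero_le_one fun j => (norm_sub_starProjection_le _ _).trans_eq (one_mul _).symm
  rwa [one_mul] at this

section Basis

variable {hV : ∀ x, 0 < V x} {hN : N = ∑ i, q i} {𝔾 : Finset (Freq d)} {r : Fin m → ℝ} {c : ℝ}
  {p : ℕ} {u : Fin N → EnergySpace V hV} {ℓ : Fin N → ℝ} {φ : Fin p → EnergySpace V hV}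
  {lam : Fin p → ℝ} {ψ : (Σ i, Fin (q i)) → EnergySpace V hV}

lemma IsClusterBasis.le_of_block {φ : Fin N ⊕ Fin p → EnergySpace V hV}
    {lam : Fin N ⊕ Fin p → ℝ} (hb : IsClusterBasis hV hN 𝔾 Λ r c φ lam) {j : Fin N ⊕ Fin p}
    {i : Fin m} (hj : blockOption hN j = some i) : lam j ≤ c := by
  rcases j with l | j
  · exact hb.upper l
  · exact absurd hj (by simp [blockOption])

lemma IsClusterBasis.sep_cluster {φ : Fin N ⊕ Fin p → EnergySpace V hV}
    {lam : Fin N ⊕ Fin p → ℝ} (hb : IsClusterBasis hV hN 𝔾 Λ r c φ lam) (i : Fin m) :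
    ∀ j ∉ Finset.univ.map (Function.Embedding.inl : Fin N ↪ Fin N ⊕ Fin p),
      lam j ≠ Λ i ∧ lam j * Λ i ^ 2 ≤ c * (lam j - Λ i) ^ 2 := by
  intro j hj
  refine hb.sep j i ?_
  rcases j with l | j
  · exact absurd (Finset.mem_map_of_mem _ (Finset.mem_univ l)) hj
  · simp [blockOption]

lemma IsClusterBasis.le_cluster {φ : Fin N ⊕ Fin p → EnergySpace V hV}
    {lam : Fin N ⊕ Fin p → ℝ} (hb : IsClusterBasis hV hN 𝔾 Λ r c φ lam) :
    ∀ j ∈ Finset.univ.map (Function.Embedding.inl : Fin N ↪ Fin N ⊕ Fin p), lam j ≤ c := by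
  intro j hj
  obtain ⟨l, -, rfl⟩ := Finset.mem_map.1 hj
  exact hb.upper l

/-- The errors of exact eigenfunctions and of the lifted discrete eigenfunctions are equivalent up
to perturbations of higher order. -/
lemma IsClusterBasis.comparison
    (hb : IsClusterBasis hV hN 𝔾 Λ r c (Sum.elim u φ) (Sum.elim ℓ lam)) (hc : 0 ≤ c)
    (hψ : IsEigenFamily (incl V hV) ψ fun j => Λ j.1) {ν : ℝ}
    (hν0 : 0 ≤ ν) (hν : ∀ w ∈ (pwSpace hV 𝔾)ᗮ, ‖incl V hV w‖ ≤ ν * ‖w‖) {κ : ℝ} (hκ1 : κ ≤ 1)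
    (hA : ‖incl V hV‖ * ((∑ i, |Λ i|) * (1 + ‖incl V hV‖ * √c) + c) * ν ≤ κ)
    (hB : (1 + ‖incl V hV‖ * √c) * ν * tupleNorm ψ ≤ κ) (𝔾' : Finset (Freq d)) :
    pwDist ψ 𝔾' ≤ pwDist (fun l => lift (u l) (ℓ l)) 𝔾' + κ * pwDist ψ 𝔾 ∧
      (1 - κ) * pwDist (fun l => lift (u l) (ℓ l)) 𝔾' ≤ pwDist ψ 𝔾' + κ * pwDist ψ 𝔾 := by
  set J := incl V hV
  have hD := pwDist_nonneg ψ 𝔾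
  have hκ0 : 0 ≤ κ := le_trans (by have := tupleNorm_nonneg ψ; positivity) hB
  have ha : Orthonormal ℝ fun l => J (u l) := by
    have := hb.galerkin.orthonormal.comp Sum.inl Sum.inl_injective
    exact this
  have hcard : Fintype.card (Fin N) = Fintype.card (Σ i, Fin (q i)) :=
    (Fintype.card_congr (blockEquiv hN)).symm
  have h1 : ∀ j, ‖J (ψ j) - ∑ l, inner ℝ (J (u l)) (J (ψ j)) • J (u l)‖ ≤
      (1 + ‖J‖ * √c) * ν * ‖ψ j - (pwSpace hV 𝔾).starProjection (ψ j)‖ := fun j => by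
    have := norm_map_sub_specPart_le hb.galerkin hb.span_le (hψ.mem j) hc hb.le_cluster
      (hb.sep_cluster j.1) hν
    rw [map_sub, specPart, Finset.sum_map, map_sum] at this
    simpa only [Function.Embedding.inl_apply, Sum.elim_inl, map_smul] using this
  have h2 : ∀ j, ‖ψ j - ∑ l, inner ℝ (J (u l)) (J (ψ j)) • lift (u l) (ℓ l)‖ ≤
      κ * ‖ψ j - (pwSpace hV 𝔾).starProjection (ψ j)‖ := fun j => by
    have := norm_sub_sum_solOp_le hb.galerkin hb.span_le (hψ.mem j) hc hb.le_cluster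
      (hb.sep_cluster j.1) hν
    rw [Finset.sum_map] at this
    simp only [Function.Embedding.inl_apply, Sum.elim_inl] at this
    refine this.trans (mul_le_mul_of_nonneg_right (le_trans ?_ hA) (norm_nonneg _))
    have : |Λ j.1| ≤ ∑ i, |Λ i| :=
      Finset.single_le_sum (f := fun i => |Λ i|) (fun i _ => abs_nonneg _) (Finset.mem_univ j.1)
    gcongr
  have hR : tupleNorm (fun j => ψ j - ∑ l, inner ℝ (J (u l)) (J (ψ j)) • lift (u l) (ℓ l)) ≤
      κ * pwDist ψ 𝔾 := tupleNorm_mono hκ0 h2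
  have hdef : ∑ j, ‖J (ψ j) - ∑ l, inner ℝ (J (u l)) (J (ψ j)) • J (u l)‖ ^ 2 ≤ κ ^ 2 := by
    rw [← tupleNorm_sq]
    have e1 := tupleNorm_mono (by positivity) h1
    have e2 : (1 + ‖J‖ * √c) * ν * pwDist ψ 𝔾 ≤ κ :=
      (mul_le_mul_of_nonneg_left (pwDist_le_tupleNorm ψ 𝔾) (by positivity)).trans hB
    exact pow_le_pow_left₀ (tupleNorm_nonneg _) (e1.trans e2) 2
  -- the projection onto the complement of `V_𝔾'` measures the errors on `𝔾'`
  have h3 := tupleNorm_map_le ha hψ.orthonormal hcard hR ((pwSpace hV 𝔾')ᗮ.starProjection)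
    (fun x => (pwSpace hV 𝔾')ᗮ.norm_starProjection_apply_le x)
  simp only [Submodule.starProjection_orthogonal_val] at h3
  refine ⟨h3.1, le_trans (mul_le_mul_of_nonneg_right ?_ (pwDist_nonneg _ _)) h3.2⟩
  refine Real.le_sqrt_of_sq_le ?_
  nlinarith

end Basis

/-- Uniform comparison of exact and lifted discrete eigenfunctions on rich planewave spaces. -/
lemma IsCluster.exists_comparison (hcl : IsCluster V k₀ N m Λ q) (hV : ∀ x, 0 < V x)
    {r : Fin m → ℝ} (hr : ∀ i, 0 < r i ∧
      ∀ μ : ℝ, eigenspace V (H1 d) μ ≠ ⊥ → μ ≠ Λ i → r i < |μ⁻¹ - (Λ i)⁻¹|)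
    {ψ : (Σ i, Fin (q i)) → EnergySpace V hV}
    (hψ : IsEigenFamily (incl V hV) ψ fun j => Λ j.1) {κ : ℝ} (hκ : 0 < κ) (hκ1 : κ ≤ 1) :
    ∃ M : ℕ, ∀ 𝔾 : Finset (Freq d), ballFreq d M ⊆ 𝔾 → ∀ u : Fin N → EnergySpace V hV,
      IsGalerkinFamily (incl V hV) (pwSpace hV 𝔾) u
        (fun l => eigenvalue V (VG 𝔾) (k₀ + l + 1)) → ∀ 𝔾' : Finset (Freq d),
      pwDist ψ 𝔾' ≤ pwDist (fun l => lift (u l) (eigenvalue V (VG 𝔾) (k₀ + l + 1))) 𝔾' +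
          κ * pwDist ψ 𝔾 ∧
        (1 - κ) * pwDist (fun l => lift (u l) (eigenvalue V (VG 𝔾) (k₀ + l + 1))) 𝔾' ≤
          pwDist ψ 𝔾' + κ * pwDist ψ 𝔾 := by
  obtain ⟨-, c, hc, M₁, hM₁⟩ := hcl.exists_clusterBasis hV hr
  have hψ0 := tupleNorm_nonneg ψ
  have hΛ : 0 ≤ ∑ i, |Λ i| := Finset.sum_nonneg fun i _ => abs_nonneg _
  set A := ‖incl V hV‖ * ((∑ i, |Λ i|) * (1 + ‖incl V hV‖ * √c) + c) with hA
  set B := (1 + ‖incl V hV‖ * √c) * tupleNorm ψ with hB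
  have hA0 : 0 ≤ A := by positivity
  have hB0 : 0 ≤ B := by positivity
  obtain ⟨ν, hν0, hνA, hνB⟩ : ∃ ν : ℝ, 0 < ν ∧ A * ν ≤ κ ∧ B * ν ≤ κ := by
    refine ⟨κ / (A + B + 1), by positivity, ?_, ?_⟩
    · rw [mul_div_assoc', div_le_iff₀ (by positivity)]
      nlinarith
    · rw [mul_div_assoc', div_le_iff₀ (by positivity)]
      nlinarith
  obtain ⟨M₂, hM₂⟩ := exists_ball_norm_le hV hν0
  refine ⟨max M₁ M₂, fun 𝔾 h𝔾 u hu 𝔾' => ?_⟩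
  obtain ⟨p, φ, lam, hb⟩ := hM₁ 𝔾 ((ballFreq_mono (le_max_left _ _)).trans h𝔾) u hu
  refine hb.comparison hc hψ hν0.le (hM₂ 𝔾 ((ballFreq_mono (le_max_right _ _)).trans h𝔾)) hκ1 hνA
    (le_trans (le_of_eq ?_) hνB) 𝔾'
  rw [hB]
  ring

end Comparison

/-! ### A priori error bounds -/

section ErrorBounds

variable {V : C(Torus d, ℝ)} {k₀ N m : ℕ} {Λ : Fin m → ℝ} {q : Fin m → ℕ}
  {hV : ∀ x, 0 < V x} {ψ : (Σ i, Fin (q i)) → EnergySpace V hV}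

lemma IsEigenFamily.block {H L : Type*} [NormedAddCommGroup H] [InnerProductSpace ℝ H]
    [NormedAddCommGroup L] [InnerProductSpace ℝ L] {J : H →L[ℝ] L}
    {ψ : (Σ i, Fin (q i)) → H} (hψ : IsEigenFamily J ψ fun j => Λ j.1) (i : Fin m) :
    IsEigenFamily J (fun l => ψ ⟨i, l⟩) fun _ => Λ i where
  orthonormal := hψ.orthonormal.comp (Sigma.mk i) sigma_mk_injective
  mem l := hψ.mem ⟨i, l⟩

lemma tupleNorm_block_le {E : Type*} [NormedAddCommGroup E] (x : (Σ i, Fin (q i)) → E)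
    (i : Fin m) : tupleNorm (fun l => x ⟨i, l⟩) ≤ tupleNorm x := by
  refine Real.sqrt_le_sqrt ?_
  rw [Fintype.sum_sigma]
  exact Finset.single_le_sum (f := fun i => ∑ l, ‖x ⟨i, l⟩‖ ^ 2)
    (fun i _ => Finset.sum_nonneg fun _ _ => sq_nonneg _) (Finset.mem_univ i)

/-- A reference basis controls the distance of all normalized eigenfunctions from the planewave
space. -/
lemma IsCluster.norm_sub_le_pwDist (hcl : IsCluster V k₀ N m Λ q)
    (hψ : IsEigenFamily (incl V hV) ψ fun j => Λ j.1) {i : Fin m} {w : EnergySpace V hV}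
    (hw : w ∈ genEig (incl V hV) (Λ i)) (hw1 : ‖incl V hV w‖ = 1) (𝔾 : Finset (Freq d)) :
    ‖w - (pwSpace hV 𝔾).starProjection w‖ ≤ pwDist ψ 𝔾 := by
  have hψi := hψ.block i
  have hfd := finiteDimensional_eigSum (J := incl V hV) smallOffFinite_incl (Λ i)
  have hfd' := Submodule.finiteDimensional_of_le (genEig_le_eigSum (J := incl V hV) (le_refl (Λ i)))
  have hle : Submodule.span ℝ (Set.range fun l => ψ ⟨i, l⟩) ≤ genEig (incl V hV) (Λ i) := by
    refine Submodule.span_le.2 ?_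
    rintro _ ⟨l, rfl⟩
    exact hψi.mem l
  have heq := Submodule.eq_of_le_of_finrank_eq hle (by
    rw [finrank_span_eq_card hψi.linearIndependent, hcl.finrank_genEig hV, Fintype.card_fin])
  have hexp := hψi.expand (u := w) (heq ▸ hw)
  have hsum : ∑ l, inner ℝ (incl V hV (ψ ⟨i, l⟩)) (incl V hV w) ^ 2 ≤ 1 := by
    have := sum_inner_sq_le hψi.orthonormal Finset.univ (incl V hV w)
    rwa [hw1, one_pow] at this
  have e : w - (pwSpace hV 𝔾).starProjection w =
      ∑ l, inner ℝ (incl V hV (ψ ⟨i, l⟩)) (incl V hV w) •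
        (ψ ⟨i, l⟩ - (pwSpace hV 𝔾).starProjection (ψ ⟨i, l⟩)) := by
    conv_lhs => rw [hexp]
    simp only [map_sum, map_smul, smul_sub, Finset.sum_sub_distrib]
  rw [e]
  exact (norm_sum_smul_le _ hsum _).trans
    (tupleNorm_block_le (fun j => ψ j - (pwSpace hV 𝔾).starProjection (ψ j)) i)

variable {hN : N = ∑ i, q i} {𝔾 : Finset (Freq d)} {r : Fin m → ℝ} {c : ℝ}
  {p : ℕ} {u : Fin N → EnergySpace V hV} {ℓ : Fin N → ℝ} {φ : Fin p → EnergySpace V hV}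
  {lam : Fin p → ℝ}

lemma filter_blockOption_eq (hN : N = ∑ i, q i) (i : Fin m) :
    (Finset.univ.filter fun j : Fin N ⊕ Fin p => blockOption hN j = some i) =
      Finset.univ.map (((Function.Embedding.sigmaMk i).trans
        (blockEquiv hN).toEmbedding).trans Function.Embedding.inl) := by
  ext j
  simp only [Finset.mem_filter, Finset.mem_univ, true_and, Finset.mem_map,
    Function.Embedding.trans_apply, Function.Embedding.sigmaMk_apply, Equiv.coe_toEmbedding,
    Function.Embedding.inl_apply]
  constructor
  · intro h
    rcases j with l | j
    · obtain ⟨⟨i', l'⟩, rfl⟩ := (blockEquiv hN).surjective l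
      have h1 : block hN (blockEquiv hN ⟨i', l'⟩) = i := Option.some_injective _ h
      rw [block, Equiv.symm_apply_apply] at h1
      subst h1
      exact ⟨l', rfl⟩
    · exact absurd h (by simp [blockOption])
  · rintro ⟨l, rfl⟩
    simp [blockOption, block]

/-- The spectral projection of an exact eigenfunction is as good as its best approximation. -/
lemma IsClusterBasis.norm_sub_spectralProj_le
    {φ : Fin N ⊕ Fin p → EnergySpace V hV} {lam : Fin N ⊕ Fin p → ℝ}
    (hb : IsClusterBasis hV hN 𝔾 Λ r c φ lam) (hc : 0 ≤ c) (h𝔾 : IsSymm 𝔾) {i : Fin m}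
    (hr : 0 < r i) (hrΛ : r i < (Λ i)⁻¹) {ν : ℝ}
    (hν : ∀ w ∈ (pwSpace hV 𝔾)ᗮ, ‖incl V hV w‖ ≤ ν * ‖w‖) {w : EnergySpace V hV}
    (hw : w ∈ genEig (incl V hV) (Λ i)) :
    energyNorm V (toL2 w - spectralProj V 𝔾 (Λ i) (r i) (toL2 w)) ≤
      (1 + √c * ν) * ‖w - (pwSpace hV 𝔾).starProjection w‖ := by
  classical
  rw [hb.galerkin.spectralProj_eq h𝔾 hb.span_le hb.galerkin.lam_pos hr hrΛ
    (Finset.univ.filter fun j => blockOption hN j = some i)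
    (fun j hj => hb.inside j i (Finset.mem_filter.1 hj).2)
    (fun j hj => hb.outside j i fun h => hj (Finset.mem_filter.2 ⟨Finset.mem_univ _, h⟩)),
    ← map_sub, energyNorm_eq]
  exact norm_sub_specPart_le hb.galerkin hb.span_le hw hc
    (fun j hj => hb.le_of_block (Finset.mem_filter.1 hj).2)
    (fun j hj => hb.sep j i fun h => hj (Finset.mem_filter.2 ⟨Finset.mem_univ _, h⟩)) hν

/-- Each discrete eigenfunction of a block is close to the exact eigenspace of that block. Exact
eigenfunctions are close to the discrete ones, and the total defects agree. -/
lemma IsClusterBasis.defect_le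
    (hb : IsClusterBasis hV hN 𝔾 Λ r c (Sum.elim u φ) (Sum.elim ℓ lam)) (hc : 0 ≤ c)
    (hψ : IsEigenFamily (incl V hV) ψ fun j => Λ j.1) {ν : ℝ} (hν0 : 0 ≤ ν)
    (hν : ∀ w ∈ (pwSpace hV 𝔾)ᗮ, ‖incl V hV w‖ ≤ ν * ‖w‖) (i : Fin m) (l : Fin (q i)) :
    ‖incl V hV (u (blockEquiv hN ⟨i, l⟩)) - ∑ j, inner ℝ (incl V hV (u (blockEquiv hN ⟨i, l⟩)))
        (incl V hV (ψ ⟨i, j⟩)) • incl V hV (ψ ⟨i, j⟩)‖ ≤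
      (1 + ‖incl V hV‖ * √c) * ν * pwDist ψ 𝔾 := by
  classical
  set J := incl V hV
  have ha : Orthonormal ℝ fun l : Fin (q i) => J (u (blockEquiv hN ⟨i, l⟩)) :=
    hb.galerkin.orthonormal.comp (fun l : Fin (q i) => Sum.inl (blockEquiv hN ⟨i, l⟩))
      fun l l' h => eq_of_heq (Sigma.mk.inj_iff.1
        ((blockEquiv hN).injective (Sum.inl_injective h))).2
  have h1 : ∀ j, ‖J (ψ ⟨i, j⟩) - ∑ l, inner ℝ (J (u (blockEquiv hN ⟨i, l⟩))) (J (ψ ⟨i, j⟩)) •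
      J (u (blockEquiv hN ⟨i, l⟩))‖ ≤
        (1 + ‖J‖ * √c) * ν * ‖ψ ⟨i, j⟩ - (pwSpace hV 𝔾).starProjection (ψ ⟨i, j⟩)‖ := fun j => by
    have := norm_map_sub_specPart_le hb.galerkin hb.span_le (hψ.mem ⟨i, j⟩) hc
      (S := Finset.univ.filter fun j => blockOption hN j = some i)
      (fun j hj => hb.le_of_block (Finset.mem_filter.1 hj).2)
      (fun j hj => hb.sep j i fun h => hj (Finset.mem_filter.2 ⟨Finset.mem_univ _, h⟩)) hν
    rw [map_sub, specPart, filter_blockOption_eq, Finset.sum_map, map_sum] at this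
    simpa only [Function.Embedding.trans_apply, Function.Embedding.sigmaMk_apply,
      Equiv.coe_toEmbedding, Function.Embedding.inl_apply, Sum.elim_inl, map_smul] using this
  have h2 := tupleNorm_mono (by positivity) h1
  have h3 := tupleNorm_block_le (fun j => ψ j - (pwSpace hV 𝔾).starProjection (ψ j)) i
  refine le_trans ?_ (h2.trans (mul_le_mul_of_nonneg_left h3 (by positivity)))
  refine Real.le_sqrt_of_sq_le ?_
  rw [← sum_defect_eq ha (hψ.block i).orthonormal rfl]
  exact Finset.single_le_sum (f := fun l : Fin (q i) => ‖J (u (blockEquiv hN ⟨i, l⟩)) -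
    ∑ j, inner ℝ (J (u (blockEquiv hN ⟨i, l⟩))) (J (ψ ⟨i, j⟩)) • J (ψ ⟨i, j⟩)‖ ^ 2)
    (fun _ _ => sq_nonneg _) (Finset.mem_univ l)

/-- A priori bounds: the spectral projection error is of the order of the best approximation error,
the eigenvalue errors are of the order of its square. -/
theorem IsCluster.exists_error_bounds (hcl : IsCluster V k₀ N m Λ q) (hr : ∀ i, 0 < r i ∧
      ∀ μ : ℝ, eigenspace V (H1 d) μ ≠ ⊥ → μ ≠ Λ i → r i < |μ⁻¹ - (Λ i)⁻¹|)
    (hψ : IsEigenFamily (incl V hV) ψ fun j => Λ j.1) :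
    ∃ C : ℝ, 0 ≤ C ∧ ∃ M : ℕ, ∀ 𝔾 : Finset (Freq d), ballFreq d M ⊆ 𝔾 → IsSymm 𝔾 →
      ∀ u : Fin N → EnergySpace V hV, IsGalerkinFamily (incl V hV) (pwSpace hV 𝔾) u
        (fun l => eigenvalue V (VG 𝔾) (k₀ + l + 1)) →
      (∀ U : (i : Fin m) → Fin (q i) → L2 d, (∀ i, Orthonormal ℂ (U i) ∧
          Submodule.span ℝ (Set.range (U i)) = eigenspace V (H1 d) (Λ i)) →
        projError V Λ r U 𝔾 ≤ C * pwDist ψ 𝔾) ∧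
      ∀ (i : Fin m) (l : Fin (q i)),
        eigenvalue V (VG 𝔾) (k₀ + offset q i + l + 1) - Λ i ≤ C * pwDist ψ 𝔾 ^ 2 := by
  obtain ⟨hrΛ, c, hc, M₁, hM₁⟩ := hcl.exists_clusterBasis hV hr
  have hψ0 := tupleNorm_nonneg ψ
  have hΛ := hcl.pos_of_index hV
  set B := 1 + ‖incl V hV‖ * √c with hB
  have hB0 : 0 ≤ B := by positivity
  obtain ⟨ν, hν0, hνB⟩ : ∃ ν : ℝ, 0 < ν ∧ B * ν * tupleNorm ψ ≤ 1 / 2 := by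
    refine ⟨1 / 2 / (B * tupleNorm ψ + 1), by positivity, ?_⟩
    rw [mul_right_comm, mul_div_assoc', div_le_iff₀ (by positivity)]
    nlinarith [mul_nonneg hB0 hψ0]
  obtain ⟨M₂, hM₂⟩ := exists_ball_norm_le hV hν0
  have hΛs : ∀ i, (Λ i)⁻¹ ≤ ∑ i, (Λ i)⁻¹ := fun i =>
    Finset.single_le_sum (f := fun i => (Λ i)⁻¹) (fun i _ => (inv_pos.2 (hΛ i)).le)
      (Finset.mem_univ i)
  have hΛ0 : 0 ≤ ∑ i, (Λ i)⁻¹ := Finset.sum_nonneg fun i _ => (inv_pos.2 (hΛ i)).le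
  refine ⟨√N * (1 + √c * ν) + 2 * c * (B * ν * ν + ∑ i, (Λ i)⁻¹), by positivity, max M₁ M₂,
    fun 𝔾 h𝔾 hsymm u hu => ?_⟩
  obtain ⟨p, φ, lam, hb⟩ := hM₁ 𝔾 ((ballFreq_mono (le_max_left _ _)).trans h𝔾) u hu
  have hν := hM₂ 𝔾 ((ballFreq_mono (le_max_right _ _)).trans h𝔾)
  have hD := pwDist_nonneg ψ 𝔾
  refine ⟨fun U hU => ?_, fun i l => ?_⟩
  · have h1 : ∀ i l, energyNorm V (U i l - spectralProj V 𝔾 (Λ i) (r i) (U i l)) ^ 2 ≤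
        ((1 + √c * ν) * pwDist ψ 𝔾) ^ 2 := fun i l => by
      have hmem : U i l ∈ eigenspace V (H1 d) (Λ i) :=
        (hU i).2 ▸ Submodule.subset_span (Set.mem_range_self l)
      set w := of hV (U i l) (eigenspace_le_H1 _ _ hmem) with hw
      have hUw : U i l = toL2 w := (toL2_of _ _).symm
      have hw1 : ‖incl V hV w‖ = 1 := (hU i).1.1 l
      rw [hUw] at hmem ⊢
      have hwe := toL2_mem_eigenspace_H1.1 hmem
      have e1 := hb.norm_sub_spectralProj_le hc hsymm (hr i).1 (hrΛ i) hν hwe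
      have e2 := hcl.norm_sub_le_pwDist hψ hwe hw1 𝔾
      exact pow_le_pow_left₀ (Real.sqrt_nonneg _)
        (e1.trans (mul_le_mul_of_nonneg_left e2 (by positivity))) 2
    have h2 : projError V Λ r U 𝔾 ≤ √N * ((1 + √c * ν) * pwDist ψ 𝔾) := by
      rw [projError, ← Real.sqrt_sq (show 0 ≤ (1 + √c * ν) * pwDist ψ 𝔾 by positivity),
        ← Real.sqrt_mul (Nat.cast_nonneg N)]
      refine Real.sqrt_le_sqrt ((Finset.sum_le_sum fun i _ =>
        Finset.sum_le_sum fun l _ => h1 i l).trans_eq ?_)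
      simp only [Finset.sum_const, Finset.card_univ, Fintype.card_fin, nsmul_eq_mul,
        ← Finset.sum_mul, ← Nat.cast_sum, ← hcl.sum_mult]
    refine h2.trans ?_
    rw [← mul_assoc]
    refine mul_le_mul_of_nonneg_right (le_add_of_nonneg_right (by positivity)) hD
  · have hidx : k₀ + offset q i + l + 1 = k₀ + (blockEquiv hcl.sum_mult ⟨i, l⟩ : ℕ) + 1 := by
      rw [blockEquiv_val]
      omega
    rw [hidx]
    set k := blockEquiv hcl.sum_mult ⟨i, l⟩ with hk
    set ℓ := eigenvalue V (VG 𝔾) (k₀ + (k : ℕ) + 1) with hℓ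
    have hlow := hb.lower k
    rw [block, hk, Equiv.symm_apply_apply, ← hk] at hlow
    have hlow' : Λ i ≤ ℓ := hlow
    have hup : ℓ ≤ c := hb.upper k
    have hη : B * ν * pwDist ψ 𝔾 ≤ 1 / 2 :=
      (mul_le_mul_of_nonneg_left (pwDist_le_tupleNorm ψ 𝔾) (by positivity)).trans hνB
    have hη0 : 0 ≤ B * ν * pwDist ψ 𝔾 := by positivity
    have e1 := eigenvalue_sub_le (hΛ i) (hu.orthonormal.1 k) (hu.mem k) (hu.eq k) hlow'
      (hψ.block i).mem (hψ.block i).orthonormal hν0.le hν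
      (tupleNorm_block_le (fun j => ψ j - (pwSpace hV 𝔾).starProjection (ψ j)) i)
      (hb.defect_le hc hψ hν0.le hν i l) (by nlinarith)
    refine e1.trans ?_
    have e2 : B * ν * pwDist ψ 𝔾 * (ν * pwDist ψ 𝔾) + (Λ i)⁻¹ * pwDist ψ 𝔾 ^ 2 ≤
        (B * ν * ν + ∑ i, (Λ i)⁻¹) * pwDist ψ 𝔾 ^ 2 := by
      have := mul_le_mul_of_nonneg_right (hΛs i) (sq_nonneg (pwDist ψ 𝔾))
      nlinarith
    have e3 : 0 ≤ (B * ν * ν + ∑ i, (Λ i)⁻¹) * pwDist ψ 𝔾 ^ 2 := by positivity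
    have hℓ0 : 0 ≤ ℓ := (hΛ i).le.trans hlow'
    calc _ ≤ 2 * c * ((B * ν * ν + ∑ i, (Λ i)⁻¹) * pwDist ψ 𝔾 ^ 2) := by
          refine (mul_le_mul_of_nonneg_left e2 (by positivity)).trans
            (mul_le_mul_of_nonneg_right (by linarith) e3)
      _ ≤ _ := by
          have : 0 ≤ √N * (1 + √c * ν) * pwDist ψ 𝔾 ^ 2 := by positivity
          refine (le_add_of_nonneg_left this).trans_eq ?_
          ring

end ErrorBounds

/-! ### Dörfler marking -/

section Marking

variable {V : C(Torus d, ℝ)} {hV : ∀ x, 0 < V x} {N : ℕ} {𝔾 𝔾' : Finset (Freq d)}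
  {u : Fin N → EnergySpace V hV} {ℓ : Fin N → ℝ}

lemma IsGalerkinFamily.pwDist_lift
    (h : IsGalerkinFamily (incl V hV) (pwSpace hV 𝔾) u ℓ) :
    pwDist (fun l => lift (u l) (ℓ l)) 𝔾 = tupleNorm fun l => lift (u l) (ℓ l) - u l := by
  rw [pwDist]
  congr 1
  funext l
  rw [h.starProjection_lift l]

/-- Pythagoras for the two successive projections of the lifted eigenfunctions. -/
lemma IsGalerkinFamily.pwDist_sq_eq (h : IsGalerkinFamily (incl V hV) (pwSpace hV 𝔾) u ℓ)
    (h𝔾 : 𝔾 ⊆ 𝔾') : pwDist (fun l => lift (u l) (ℓ l)) 𝔾 ^ 2 =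
      tupleNorm (fun l => (pwSpace hV 𝔾').starProjection (lift (u l) (ℓ l)) - u l) ^ 2 +
        pwDist (fun l => lift (u l) (ℓ l)) 𝔾' ^ 2 := by
  rw [h.pwDist_lift, pwDist, tupleNorm_sq, tupleNorm_sq, tupleNorm_sq, ← Finset.sum_add_distrib]
  refine Finset.sum_congr rfl fun l _ => ?_
  set T := lift (u l) (ℓ l)
  set W := pwSpace hV 𝔾'
  have h1 : W.starProjection T - u l ∈ W :=
    sub_mem (W.starProjection_apply_mem T) (pwSpace_mono h𝔾 (h.mem l))
  have h2 := (Submodule.mem_orthogonal _ _).1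
    (Submodule.sub_starProjection_mem_orthogonal (K := W) T) _ h1
  have h3 := norm_add_sq_eq_norm_sq_add_norm_sq_of_inner_eq_zero _ _ h2
  rw [add_comm, sub_add_sub_cancel] at h3
  nlinarith

variable {a b : ℝ} {rt : Fin N → Freq d → ℂ} {θ ζ : ℝ}

/-- The error reduction in terms of the norms involved: `τ` and `τ'` are the errors before and after
the refinement, `t` is the difference of the approximations, `R` and `Rt` are the norms of the exact
and approximate residuals with marked parts `P` and `Pt`, and `δ` is the norm of their difference.
-/
lemma le_sqrt_mul_of_marking {α β τ τ' t R Rt P Pt δ θ ζ : ℝ} (hα : 0 ≤ α) (hβ : 0 < β)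
    (hτ : 0 ≤ τ) (hζ : 0 ≤ ζ) (hζθ : ζ ≤ θ) (hδ : δ ≤ ζ * Rt) (hmark : θ * Rt ≤ Pt)
    (h1 : Pt ≤ P + δ) (h2 : R ≤ Rt + δ) (h3 : P ≤ β * t) (h4 : α * τ ≤ R)
    (h5 : τ ^ 2 = t ^ 2 + τ' ^ 2) :
    τ' ≤ √(1 - ((θ - ζ) / (1 + ζ) * (α / β)) ^ 2) * τ := by
  have f1 : (θ - ζ) * Rt ≤ β * t := by linarith
  have f2 : R ≤ (1 + ζ) * Rt := by linarith
  have f0 : 0 ≤ θ - ζ := by linarith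
  have f3 : (θ - ζ) / (1 + ζ) * (α / β) * τ ≤ t := by
    rw [div_mul_div_comm, div_mul_eq_mul_div, div_le_iff₀ (by positivity)]
    have e1 : (θ - ζ) * (α * τ) ≤ (θ - ζ) * ((1 + ζ) * Rt) :=
      mul_le_mul_of_nonneg_left (h4.trans f2) f0
    have e2 : (1 + ζ) * ((θ - ζ) * Rt) ≤ (1 + ζ) * (β * t) :=
      mul_le_mul_of_nonneg_left f1 (by linarith)
    linarith
  have f4 : 0 ≤ (θ - ζ) / (1 + ζ) * (α / β) * τ := by positivity
  have f5 := pow_le_pow_left₀ f4 f3 2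
  rw [mul_pow] at f5
  rw [← Real.sqrt_sq hτ, ← Real.sqrt_mul' _ (sq_nonneg τ)]
  refine Real.le_sqrt_of_sq_le ?_
  linarith

/-- The converse implication from error reduction to the Dörfler criterion, in the same notation. A
reduction of the squared error by a third gives `t² ≥ τ² / 3`, whence the factor `3`. -/
lemma marking_of_le {α β τ τ' t R Rt P Pt δ θ ζ : ℝ} (hα : 0 ≤ α) (hβ : 0 < β)
    (ht : 0 ≤ t) (hR : 0 ≤ R) (hRt : 0 ≤ Rt)
    (hθ : ζ * (1 + √(α / (3 * β))) ≤ √(α / (3 * β)) - θ) (hδ : δ ≤ ζ * Rt) (h1 : P ≤ Pt + δ)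
    (h2 : Rt ≤ R + δ) (h3 : √α * t ≤ P) (h4 : R ≤ √β * τ) (h5 : τ ^ 2 = t ^ 2 + τ' ^ 2)
    (hred : 3 * τ' ^ 2 ≤ 2 * τ ^ 2) : θ * Rt ≤ Pt := by
  have hs0 : 0 ≤ √(α / (3 * β)) := Real.sqrt_nonneg _
  have f1 : √(α / (3 * β)) * R ≤ √α * t := by
    have hp : 0 ≤ √α * t := by positivity
    refine (abs_le_of_sq_le_sq' ?_ hp).2
    have g1 : R ^ 2 ≤ β * τ ^ 2 := by
      have := pow_le_pow_left₀ hR h4 2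
      rwa [mul_pow, Real.sq_sqrt hβ.le] at this
    have g2 : τ ^ 2 ≤ 3 * t ^ 2 := by linarith
    rw [mul_pow, mul_pow, Real.sq_sqrt (by positivity), Real.sq_sqrt hα,
      div_mul_eq_mul_div, div_le_iff₀ (by positivity)]
    calc α * R ^ 2 ≤ α * (β * (3 * t ^ 2)) :=
          mul_le_mul_of_nonneg_left (g1.trans (mul_le_mul_of_nonneg_left g2 hβ.le)) hα
      _ = _ := by ring
  have f2 : (1 - ζ) * Rt ≤ R := by linarith
  have f3 := mul_le_mul_of_nonneg_left f2 hs0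
  have f4 := mul_le_mul_of_nonneg_right hθ hRt
  linarith

/-- Dörfler marking for the approximate residual reduces the error of the lifted eigenfunctions by
a fixed factor. -/
lemma IsGalerkinFamily.pwDist_le_of_dorfler (ha : 0 < a) (hab : ∀ x, a ≤ V x ∧ V x ≤ b)
    (h : IsGalerkinFamily (incl V hV) (pwSpace hV 𝔾) u ℓ) (hζ : 0 ≤ ζ) (hζθ : ζ ≤ θ)
    (hrt : ∀ l, HpSummable (-1) (rt l))
    (happ : hpNorm (-1) (fun l => rt l - residual V (ℓ l) (toL2 (u l))) ≤ ζ * hpNorm (-1) rt)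
    {δ : Finset (Freq d)} (hδ : IsDorfler rt θ 𝔾 δ) :
    pwDist (fun l => lift (u l) (ℓ l)) (𝔾 ∪ δ) ≤
      √(1 - ((θ - ζ) / (1 + ζ) * (√(min a 1) / √(max b 1))) ^ 2) *
        pwDist (fun l => lift (u l) (ℓ l)) 𝔾 := by
  have hβ : 0 < √(max b 1) := Real.sqrt_pos.2 (lt_max_of_lt_right one_pos)
  have hr : ∀ l, HpSummable (-1) (residual V (ℓ l) (toL2 (u l))) := fun l =>
    summable_residual_lift (u l) (ℓ l)
  have e1 := hpNorm_proj_le_add hrt hr (δ : Set (Freq d))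
  have e2 := hpNorm_le_add hr hrt
  rw [hpNorm_sub_comm] at e2
  have e3 := h.hpNorm_proj_residual_le hab hδ.2.1
    (Finset.subset_union_right : δ ⊆ 𝔾 ∪ δ) Finset.subset_union_left
  have e4 := tupleNorm_le_hpNorm_residual ha hab u ℓ
  rw [← h.pwDist_lift] at e4
  exact le_sqrt_mul_of_marking (Real.sqrt_nonneg _) hβ (pwDist_nonneg _ _) hζ hζθ happ hδ.2.2
    e1 e2 e3 e4 (h.pwDist_sq_eq Finset.subset_union_left)

/-- Any enlargement of `𝔾` that removes a third of the squared error of the lifted eigenfunctions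
satisfies the Dörfler criterion. -/
lemma IsGalerkinFamily.isDorfler_sdiff (ha : 0 < a) (hab : ∀ x, a ≤ V x ∧ V x ≤ b)
    (h : IsGalerkinFamily (incl V hV) (pwSpace hV 𝔾) u ℓ) (hsymm : IsSymm 𝔾)
    (hsymm' : IsSymm 𝔾') (h𝔾 : 𝔾 ⊆ 𝔾')
    (hθζ : ζ * (1 + √(min a 1 / (3 * max b 1))) ≤ √(min a 1 / (3 * max b 1)) - θ)
    (hrt : ∀ l, HpSummable (-1) (rt l))
    (happ : hpNorm (-1) (fun l => rt l - residual V (ℓ l) (toL2 (u l))) ≤ ζ * hpNorm (-1) rt)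
    (hred : 3 * pwDist (fun l => lift (u l) (ℓ l)) 𝔾' ^ 2 ≤
      2 * pwDist (fun l => lift (u l) (ℓ l)) 𝔾 ^ 2) :
    IsDorfler rt θ 𝔾 (𝔾' \ 𝔾) := by
  refine ⟨Finset.sdiff_disjoint, fun G => ?_, ?_⟩
  · rw [Finset.mem_sdiff, Finset.mem_sdiff, ← hsymm G, ← hsymm' G]
  have hα : 0 ≤ min a 1 := (lt_min ha one_pos).le
  have hβ : 0 < max b 1 := lt_max_of_lt_right one_pos
  have hr : ∀ l, HpSummable (-1) (residual V (ℓ l) (toL2 (u l))) := fun l =>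
    summable_residual_lift (u l) (ℓ l)
  have e1 := hpNorm_proj_le_add hr hrt ((𝔾' \ 𝔾 : Finset (Freq d)) : Set (Freq d))
  have e2 := hpNorm_le_add hrt hr
  rw [hpNorm_sub_comm] at e1
  have e3 := h.tupleNorm_le_hpNorm_proj ha hab hsymm h𝔾
  have e4 := hpNorm_residual_le hab u ℓ
  rw [← h.pwDist_lift] at e4
  exact marking_of_le hα hβ (tupleNorm_nonneg _) (hpNorm_nonneg _ _) (hpNorm_nonneg _ _) hθζ happ
    e1 e2 e3 e4 (h.pwDist_sq_eq h𝔾) hred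

end Marking

/-! ### Approximation classes -/

section Approximation

variable {V : C(Torus d, ℝ)} {hV : ∀ x, 0 < V x} {s : ℝ}

/-- The infimum in the definition of the approximation class is nearly attained. -/
lemma exists_bestError_le_of_approxSeminorm {𝔾₀ : Finset (Freq d)} {v : L2 d}
    (hv : approxSeminorm V 𝔾₀ s v < ∞) {ε : ℝ} (hε : 0 < ε) :
    ∃ 𝔾 : Finset (Freq d), 𝔾₀ ⊆ 𝔾 ∧ IsSymm 𝔾 ∧ bestError V v 𝔾 ≤ ε ∧
      (((𝔾.card : ℝ) - 𝔾₀.card) ^ s) ≤ ((approxSeminorm V 𝔾₀ s v).toReal + 1) / ε := by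
  set A := (approxSeminorm V 𝔾₀ s v).toReal with hA
  by_contra hcon
  push Not at hcon
  have h1 : ENNReal.ofReal ((A + 1) / ε) ≤
      ⨅ (𝔾 : Finset (Freq d)) (_ : 𝔾₀ ⊆ 𝔾 ∧ IsSymm 𝔾 ∧ bestError V v 𝔾 ≤ ε),
        ENNReal.ofReal (((𝔾.card : ℝ) - 𝔾₀.card) ^ s) :=
    le_iInf₂ fun 𝔾 h => ENNReal.ofReal_le_ofReal (hcon 𝔾 h.1 h.2.1 h.2.2).le
  have h2 : ENNReal.ofReal ε * ENNReal.ofReal ((A + 1) / ε) ≤ approxSeminorm V 𝔾₀ s v :=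
    (mul_le_mul_right h1 _).trans (le_iSup₂_of_le ε hε le_rfl)
  rw [← ENNReal.ofReal_mul hε.le, mul_div_cancel₀ _ hε.ne', ← ENNReal.ofReal_toReal hv.ne,
    ENNReal.ofReal_le_ofReal_iff ENNReal.toReal_nonneg] at h2
  linarith

lemma isSymm_union {𝔾 𝔾' : Finset (Freq d)} (h : IsSymm 𝔾) (h' : IsSymm 𝔾') :
    IsSymm (𝔾 ∪ 𝔾') := fun G => by
  rw [Finset.mem_union, Finset.mem_union, ← h G, ← h' G]

lemma isSymm_biUnion {κ : Type*} [Fintype κ] {F : κ → Finset (Freq d)}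
    (h : ∀ j, IsSymm (F j)) : IsSymm (Finset.univ.biUnion F) := fun G => by
  simp only [Finset.mem_biUnion, Finset.mem_univ, true_and]
  exact exists_congr fun j => h j G

lemma tupleNorm_le_of_forall {E : Type*} [NormedAddCommGroup E] {κ : Type*} [Fintype κ]
    {x : κ → E} {ε : ℝ} (hε : 0 ≤ ε) (h : ∀ j, ‖x j‖ ≤ ε) :
    tupleNorm x ≤ √(Fintype.card κ) * ε := by
  rw [tupleNorm, ← Real.sqrt_sq hε, ← Real.sqrt_mul (Nat.cast_nonneg _)]
  refine Real.sqrt_le_sqrt ((Finset.sum_le_sum fun j _ =>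
    pow_le_pow_left₀ (norm_nonneg _) (h j) 2).trans_eq ?_)
  rw [Finset.sum_const, Finset.card_univ, nsmul_eq_mul]

lemma norm_sub_starProjection_anti {H : Type*} [NormedAddCommGroup H] [InnerProductSpace ℝ H]
    {W W' : Submodule ℝ H} [W.HasOrthogonalProjection] [W'.HasOrthogonalProjection] (h : W ≤ W')
    (x : H) : ‖x - W'.starProjection x‖ ≤ ‖x - W.starProjection x‖ := by
  have h1 : x - W'.starProjection x = (x - W.starProjection x) -
      W'.starProjection (x - W.starProjection x) := by
    rw [map_sub, Submodule.starProjection_eq_self_iff.2 (h (W.starProjection_apply_mem x))]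
    abel
  rw [h1]
  exact norm_sub_starProjection_le _ _

/-- For tuples from the approximation class, the distance from a planewave space can be halved by
adding a number of frequencies of the optimal order; the constant does not depend on the space. -/
lemma exists_halving {κ : Type*} [Fintype κ] (hs : 0 < s) {𝔾₀ : Finset (Freq d)}
    {ψ : κ → EnergySpace V hV} (hψ : ∀ j, approxSeminorm V 𝔾₀ s (toL2 (ψ j)) < ∞) :
    ∃ C : ℝ, 0 ≤ C ∧ ∀ 𝔾 : Finset (Freq d), 𝔾₀ ⊆ 𝔾 → IsSymm 𝔾 →
      ∃ 𝔾' : Finset (Freq d), 𝔾 ⊆ 𝔾' ∧ IsSymm 𝔾' ∧ pwDist ψ 𝔾' ≤ pwDist ψ 𝔾 / 2 ∧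
        ((𝔾' \ 𝔾).card : ℝ) * pwDist ψ 𝔾 ^ s⁻¹ ≤ C := by
  classical
  set c : ℝ := √(Fintype.card κ) + 1 with hc
  have hc0 : 0 < c := by positivity
  set A : κ → ℝ := fun j => (approxSeminorm V 𝔾₀ s (toL2 (ψ j))).toReal + 1 with hA
  have hA0 : ∀ j, 0 < A j := fun j => by
    have : 0 ≤ (approxSeminorm V 𝔾₀ s (toL2 (ψ j))).toReal := ENNReal.toReal_nonneg
    linarith
  refine ⟨∑ j, (A j * (2 * c)) ^ s⁻¹, Finset.sum_nonneg fun j _ =>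
    Real.rpow_nonneg (by have := hA0 j; positivity) _, fun 𝔾 h𝔾 hsymm => ?_⟩
  set D := pwDist ψ 𝔾 with hD
  rcases (pwDist_nonneg ψ 𝔾).eq_or_lt with h0 | hpos
  · rw [← hD] at h0
    refine ⟨𝔾, subset_rfl, hsymm, by rw [← hD, ← h0]; simp, ?_⟩
    rw [Finset.sdiff_self, Finset.card_empty, Nat.cast_zero, zero_mul]
    exact Finset.sum_nonneg fun j _ => Real.rpow_nonneg (by have := hA0 j; positivity) _
  -- approximate each entry up to `D / (2 c)`, and unite the resulting sets with `𝔾`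
  have hε : 0 < D / (2 * c) := by positivity
  choose F hF1 hF2 hF3 hF4 using fun j => exists_bestError_le_of_approxSeminorm (hψ j) hε
  refine ⟨𝔾 ∪ Finset.univ.biUnion F, Finset.subset_union_left,
    isSymm_union hsymm (isSymm_biUnion hF2), ?_, ?_⟩
  · have h1 : ∀ j, ‖ψ j - (pwSpace hV (𝔾 ∪ Finset.univ.biUnion F)).starProjection (ψ j)‖ ≤
        D / (2 * c) := fun j => by
      refine le_trans (norm_sub_starProjection_anti (pwSpace_mono ?_) (ψ j))
        ((bestError_eq (𝔾 := F j) (ψ j)).symm.trans_le (hF3 j))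
      exact (Finset.subset_biUnion_of_mem F (Finset.mem_univ j)).trans Finset.subset_union_right
    refine (tupleNorm_le_of_forall hε.le h1).trans ?_
    calc √(Fintype.card κ) * (D / (2 * c)) ≤ c * (D / (2 * c)) := by
          gcongr
          linarith
      _ = D / 2 := by field_simp
  · have h1 : (𝔾 ∪ Finset.univ.biUnion F) \ 𝔾 ⊆ Finset.univ.biUnion fun j => F j \ 𝔾₀ := by
      intro G hG
      simp only [Finset.mem_sdiff, Finset.mem_union, Finset.mem_biUnion, Finset.mem_univ,
        true_and] at hG ⊢
      obtain ⟨hG1 | ⟨j, hj⟩, hG2⟩ := hG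
      · exact absurd hG1 hG2
      · exact ⟨j, hj, fun h => hG2 (h𝔾 h)⟩
    have h2 : ((((𝔾 ∪ Finset.univ.biUnion F) \ 𝔾).card : ℕ) : ℝ) ≤ ∑ j, ((F j \ 𝔾₀).card : ℝ) := by
      exact_mod_cast (Finset.card_le_card h1).trans Finset.card_biUnion_le
    have h3 : ∀ j, ((F j \ 𝔾₀).card : ℝ) * D ^ s⁻¹ ≤ (A j * (2 * c)) ^ s⁻¹ := fun j => by
      have e1 : ((F j \ 𝔾₀).card : ℝ) = (F j).card - 𝔾₀.card := by
        rw [Finset.card_sdiff_of_subset (hF1 j), Nat.cast_sub (Finset.card_le_card (hF1 j))]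
      have e2 := hF4 j
      rw [← e1, ← Real.le_rpow_inv_iff_of_pos (Nat.cast_nonneg _)
        (by have := hA0 j; positivity) hs] at e2
      calc _ ≤ (A j / (D / (2 * c))) ^ s⁻¹ * D ^ s⁻¹ := by gcongr
        _ = (A j * (2 * c)) ^ s⁻¹ := by
          rw [← Real.mul_rpow (by have := hA0 j; positivity) hpos.le]
          congr 1
          rw [div_div_eq_mul_div]
          exact div_mul_cancel₀ _ hpos.ne'
    calc _ ≤ (∑ j, ((F j \ 𝔾₀).card : ℝ)) * D ^ s⁻¹ := by gcongr
      _ = ∑ j, ((F j \ 𝔾₀).card : ℝ) * D ^ s⁻¹ := Finset.sum_mul _ _ _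
      _ ≤ _ := Finset.sum_le_sum fun j _ => h3 j

end Approximation

/-! ### Runs of the adaptive algorithm -/

section Run

variable {V : C(Torus d, ℝ)} {k₀ N m : ℕ} {Λ : Fin m → ℝ} {q : Fin m → ℕ}
  {θ ζ tol : ℝ} {M₀ n : ℕ} {𝔾 : ℕ → Finset (Freq d)} {u : ℕ → Fin N → L2 d}
  {rt : ℕ → Fin N → Freq d → ℂ} {δ : ℕ → Finset (Freq d)}

/-- The eigenspaces of a cluster have bases that are orthonormal in `L²`. -/
lemma IsCluster.exists_eigenFamily (hcl : IsCluster V k₀ N m Λ q) (hV : ∀ x, 0 < V x) :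
    ∃ ψ : (Σ i, Fin (q i)) → EnergySpace V hV,
      IsEigenFamily (incl V hV) ψ fun j => Λ j.1 := by
  classical
  have hΛ := hcl.pos_of_index hV
  have hfd : ∀ i, FiniteDimensional ℝ (genEig (incl V hV) (Λ i)) := fun i => by
    have := finiteDimensional_eigSum (J := incl V hV) smallOffFinite_incl (Λ i)
    exact Submodule.finiteDimensional_of_le (genEig_le_eigSum (le_refl (Λ i)))
  let e : ∀ i, OrthonormalBasis (Fin (q i)) ℝ (genEig (incl V hV) (Λ i)) := fun i =>
    (stdOrthonormalBasis ℝ (genEig (incl V hV) (Λ i))).reindex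
      (finCongr (hcl.finrank_genEig hV i))
  -- rescale an orthonormal basis for the energy inner product
  refine ⟨fun j => √(Λ j.1) • (e j.1 j.2 : EnergySpace V hV), ?_,
    fun j => Submodule.smul_mem _ _ (e j.1 j.2).2⟩
  rw [orthonormal_iff_ite]
  rintro ⟨i, l⟩ ⟨i', l'⟩
  simp only [map_smul, inner_smul_left, inner_smul_right, conj_trivial]
  by_cases hi : i = i'
  · subst hi
    have h1 := (e i l).2 (e i l')
    have h2 := orthonormal_iff_ite.1 (e i).orthonormal l l'
    rw [Submodule.coe_inner] at h2
    rw [h2] at h1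
    have h3 : inner ℝ (incl V hV (e i l)) (incl V hV (e i l')) =
        (Λ i)⁻¹ * if l = l' then 1 else 0 := by
      rw [h1, ← mul_assoc, inv_mul_cancel₀ (hΛ i).ne', one_mul]
    rw [h3, ← mul_assoc, ← mul_assoc, Real.mul_self_sqrt (hΛ i).le, mul_inv_cancel₀ (hΛ i).ne',
      one_mul]
    simp only [Sigma.mk.injEq, heq_eq_eq, true_and]
  · rw [genEig_inner_map (fun h => hi (hcl.strictMono.injective h)) (e i l).2 (e i' l').2,
      mul_zero, mul_zero, if_neg fun h => hi (Sigma.mk.inj_iff.1 h).1]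

lemma IsAdaptiveRun.isSymm (h : IsAdaptiveRun V k₀ N θ ζ tol M₀ n 𝔾 u rt δ) {j : ℕ}
    (hj : j ≤ n) : IsSymm (𝔾 j) := by
  induction j with
  | zero =>
    rw [h.init]
    exact isSymm_ballFreq M₀
  | succ j ih =>
    rw [h.refine_eq j (by omega)]
    exact isSymm_union (ih (by omega)) (h.mark j (by omega)).2.1

lemma IsAdaptiveRun.ballFreq_subset (h : IsAdaptiveRun V k₀ N θ ζ tol M₀ n 𝔾 u rt δ) {j : ℕ}
    (hj : j ≤ n) : ballFreq d M₀ ⊆ 𝔾 j := by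
  induction j with
  | zero => rw [h.init]
  | succ j ih =>
    rw [h.refine_eq j (by omega)]
    exact (ih (by omega)).trans Finset.subset_union_left

lemma IsAdaptiveRun.card_succ (h : IsAdaptiveRun V k₀ N θ ζ tol M₀ n 𝔾 u rt δ) {j : ℕ}
    (hj : j < n) : (𝔾 (j + 1)).card = (𝔾 j).card + (δ j).card := by
  rw [h.refine_eq j hj, Finset.card_union_of_disjoint (h.mark j hj).1.symm]

/-- The discrete eigenfunctions computed in a run form a Galerkin family in the energy space. -/
lemma IsAdaptiveRun.exists_galerkin (h : IsAdaptiveRun V k₀ N θ ζ tol M₀ n 𝔾 u rt δ)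
    (hV : ∀ x, 0 < V x) {j : ℕ} (hj : j ≤ n) : ∃ w : Fin N → EnergySpace V hV,
      (∀ l, toL2 (w l) = u j l) ∧ IsGalerkinFamily (incl V hV) (pwSpace hV (𝔾 j)) w
        fun l => eigenvalue V (VG (𝔾 j)) (k₀ + l + 1) := by
  classical
  have hmem := h.solve_mem j hj
  have hH1 : ∀ l, u j l ∈ H1 d := fun l => eigenspace_le_H1 _ _ (hmem l)
  refine ⟨fun l => of hV (u j l) (hH1 l), fun l => toL2_of _ _, ?_, fun l => ?_, fun l => ?_⟩
  · have h1 := orthonormal_iff_ite.1 (h.solve_orthonormal j hj)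
    rw [orthonormal_iff_ite]
    intro l l'
    have h2 := inner_eq_inner_incl (of hV (u j l) (hH1 l)) (of hV (u j l') (hH1 l'))
    rw [toL2_of, toL2_of, h1 l l'] at h2
    split_ifs at h2 ⊢ with hl
    · exact_mod_cast h2.symm
    · exact_mod_cast h2.symm
  · exact (toL2_mem_eigenspace_VG (hV := hV)).1 (by rw [toL2_of]; exact hmem l) |>.1
  · exact (toL2_mem_eigenspace_VG (hV := hV)).1 (by rw [toL2_of]; exact hmem l) |>.2

/-- One step of the algorithm: the error of the reference basis contracts, and every enlargement
which halves this error is admissible for the marking. -/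
lemma IsAdaptiveRun.step (h : IsAdaptiveRun V k₀ N θ ζ tol M₀ n 𝔾 u rt δ) (hV : ∀ x, 0 < V x)
    {a b : ℝ} (ha : 0 < a) (hab : ∀ x, a ≤ V x ∧ V x ≤ b) (hζ : 0 ≤ ζ) (hζθ : ζ ≤ θ)
    (hθζ : ζ * (1 + √(min a 1 / (3 * max b 1))) ≤ √(min a 1 / (3 * max b 1)) - θ)
    {ψ : (Σ i, Fin (q i)) → EnergySpace V hV} {κ σ : ℝ} (hκ0 : 0 ≤ κ) (hκ : κ ≤ 1 / 20)
    (hσ : √(1 - ((θ - ζ) / (1 + ζ) * (√(min a 1) / √(max b 1))) ^ 2) ≤ σ) (hσ1 : σ ≤ 1)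
    {j : ℕ} (hj : j < n)
    (hcomp : ∀ w : Fin N → EnergySpace V hV, IsGalerkinFamily (incl V hV) (pwSpace hV (𝔾 j)) w
        (fun l => eigenvalue V (VG (𝔾 j)) (k₀ + l + 1)) → ∀ 𝔾' : Finset (Freq d),
      pwDist ψ 𝔾' ≤ pwDist (fun l => lift (w l) (eigenvalue V (VG (𝔾 j)) (k₀ + l + 1))) 𝔾' +
          κ * pwDist ψ (𝔾 j) ∧
        (1 - κ) * pwDist (fun l => lift (w l) (eigenvalue V (VG (𝔾 j)) (k₀ + l + 1))) 𝔾' ≤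
          pwDist ψ 𝔾' + κ * pwDist ψ (𝔾 j)) :
    pwDist ψ (𝔾 (j + 1)) ≤ (σ + 5 * κ) * pwDist ψ (𝔾 j) ∧
      ∀ 𝔾' : Finset (Freq d), 𝔾 j ⊆ 𝔾' → IsSymm 𝔾' → pwDist ψ 𝔾' ≤ pwDist ψ (𝔾 j) / 2 →
        IsDorfler (rt j) θ (𝔾 j) (𝔾' \ 𝔾 j) := by
  obtain ⟨w, hw, hgal⟩ := h.exists_galerkin hV hj.le
  have hrt : ∀ l, HpSummable (-1) (rt j l) := fun l => (h.approx_mem j hj l).1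
  have happ : hpNorm (-1) (fun l => rt j l -
      residual V (eigenvalue V (VG (𝔾 j)) (k₀ + l + 1)) (toL2 (w l))) ≤
        ζ * hpNorm (-1) (rt j) := by
    simp only [hw]
    exact h.approx_le j hj
  have hc := hcomp w hgal
  have hD := pwDist_nonneg ψ (𝔾 j)
  have hτ := pwDist_nonneg (fun l => lift (w l) (eigenvalue V (VG (𝔾 j)) (k₀ + l + 1))) (𝔾 j)
  constructor
  · have e1 := hgal.pwDist_le_of_dorfler ha hab hζ hζθ hrt happ (h.mark j hj)
    rw [← h.refine_eq j hj] at e1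
    have e2 := (hc (𝔾 (j + 1))).1
    have e3 := (hc (𝔾 j)).2
    have e4 := e1.trans (mul_le_mul_of_nonneg_right hσ hτ)
    generalize pwDist (fun l => lift (w l) (eigenvalue V (VG (𝔾 j)) (k₀ + l + 1))) (𝔾 j) = τ at *
    generalize pwDist ψ (𝔾 j) = D at *
    have hσ0 : 0 ≤ σ := (Real.sqrt_nonneg _).trans hσ
    -- `(1 + κ) / (1 - κ) ≤ 1 + 4 κ`
    have e5 : τ ≤ (1 + 4 * κ) * D := by
      have : (1 - κ) * τ ≤ (1 - κ) * ((1 + 4 * κ) * D) := by nlinarith [mul_nonneg hκ0 hD]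
      exact le_of_mul_le_mul_left this (by linarith)
    have e6 : σ * τ ≤ (σ + 4 * κ) * D := by
      have h1 := mul_le_mul_of_nonneg_left e5 hσ0
      have h2 : σ * (κ * D) ≤ 1 * (κ * D) :=
        mul_le_mul_of_nonneg_right hσ1 (mul_nonneg hκ0 hD)
      linarith
    linarith
  · intro 𝔾' h𝔾 hsymm hhalf
    refine hgal.isDorfler_sdiff ha hab (h.isSymm hj.le) hsymm h𝔾 hθζ hrt happ ?_
    have e1 := (hc 𝔾').2
    have e2 := (hc (𝔾 j)).1
    have hτ' := pwDist_nonneg (fun l => lift (w l) (eigenvalue V (VG (𝔾 j)) (k₀ + l + 1))) 𝔾'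
    generalize pwDist (fun l => lift (w l) (eigenvalue V (VG (𝔾 j)) (k₀ + l + 1))) 𝔾' = τ' at *
    generalize pwDist (fun l => lift (w l) (eigenvalue V (VG (𝔾 j)) (k₀ + l + 1))) (𝔾 j) = τ at *
    generalize pwDist ψ (𝔾 j) = D at *
    generalize pwDist ψ 𝔾' = D' at *
    have e3 : 19 / 20 * D ≤ τ := by nlinarith
    have e4 : 19 / 20 * τ' ≤ 11 / 20 * D := by nlinarith
    have e5 : τ' ≤ 8 / 10 * τ := by linarith
    nlinarith

/-- The number of added frequencies, weighted by a power of the current error, stays bounded, as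
the errors decrease geometrically. -/
lemma IsAdaptiveRun.card_mul_le (h : IsAdaptiveRun V k₀ N θ ζ tol M₀ n 𝔾 u rt δ) {y : ℕ → ℝ}
    {γ C : ℝ} (hγ0 : 0 ≤ γ) (hγ : γ < 1) (hC : 0 ≤ C)
    (hstep : ∀ j < n, y (j + 1) ≤ γ * y j) (hcard : ∀ j < n, ((δ j).card : ℝ) * y j ≤ C) :
    ∀ j ≤ n, (((𝔾 j).card : ℝ) - (𝔾 0).card) * y j ≤ γ * C / (1 - γ) ∧
      0 ≤ ((𝔾 j).card : ℝ) - (𝔾 0).card := by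
  have h1 : 0 < 1 - γ := sub_pos.2 hγ
  intro j
  induction j with
  | zero =>
    intro _
    rw [sub_self, zero_mul]
    exact ⟨by positivity, le_rfl⟩
  | succ j ih =>
    intro hj
    obtain ⟨e1, e2⟩ := ih (by omega)
    have e3 := hcard j (by omega)
    have e4 : ((𝔾 (j + 1)).card : ℝ) - (𝔾 0).card =
        (((𝔾 j).card : ℝ) - (𝔾 0).card) + (δ j).card := by
      rw [h.card_succ (by omega)]
      push_cast
      ring
    have e5 : 0 ≤ (((𝔾 j).card : ℝ) - (𝔾 0).card) + (δ j).card :=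
      add_nonneg e2 (Nat.cast_nonneg _)
    rw [e4]
    refine ⟨?_, e5⟩
    calc _ ≤ ((((𝔾 j).card : ℝ) - (𝔾 0).card) + (δ j).card) * (γ * y j) :=
          mul_le_mul_of_nonneg_left (hstep j (by omega)) e5
      _ = γ * ((((𝔾 j).card : ℝ) - (𝔾 0).card) * y j + (δ j).card * y j) := by ring
      _ ≤ γ * (γ * C / (1 - γ) + C) := by gcongr
      _ = γ * C / (1 - γ) := by
          field_simp
          ring

end Run

/-! ### The optimal rate -/

/-- A quantity `D` with `X * D ^ (1 / s) ≤ B` decays at least like `X ^ (-s)`. -/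
lemma le_rpow_of_mul_rpow_inv_le {X D B s : ℝ} (hX : 0 < X) (hD : 0 ≤ D) (hB : 0 ≤ B) (hs : 0 < s)
    (h : X * D ^ s⁻¹ ≤ B) : D ≤ B ^ s * X ^ (-s) := by
  have h1 : D ^ s⁻¹ ≤ B / X := by rwa [le_div_iff₀ hX, mul_comm]
  have h2 := Real.rpow_le_rpow (Real.rpow_nonneg hD _) h1 hs.le
  rwa [← Real.rpow_mul hD, inv_mul_cancel₀ hs.ne', Real.rpow_one, Real.div_rpow hB hX.le,
    div_eq_mul_inv, ← Real.rpow_neg hX.le] at h2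

section

variable {V : C(Torus d, ℝ)} {k₀ N m : ℕ} {Λ r : Fin m → ℝ} {q : Fin m → ℕ}

/-- For a sufficiently large initial ball, the error of the reference basis along every run with
minimal marking decays with the optimal rate. -/
lemma IsCluster.exists_pwDist_le (hcl : IsCluster V k₀ N m Λ q) (hV : ∀ x, 0 < V x)
    (hr : ∀ i, 0 < r i ∧
      ∀ μ : ℝ, eigenspace V (H1 d) μ ≠ ⊥ → μ ≠ Λ i → r i < |μ⁻¹ - (Λ i)⁻¹|)
    {ψ : (Σ i, Fin (q i)) → EnergySpace V hV}
    (hψ : IsEigenFamily (incl V hV) ψ fun j => Λ j.1)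
    {a b : ℝ} (ha : 0 < a) (hab : ∀ x, a ≤ V x ∧ V x ≤ b) {θ ζ : ℝ} (hζ : 0 < ζ) (hζθ : ζ < θ)
    (hθζ : ζ * (1 + √(min a 1 / (3 * max b 1))) ≤ √(min a 1 / (3 * max b 1)) - θ)
    {s : ℝ} (hs : 0 < s) :
    ∃ M : ℕ, ∀ M₁ ≥ M, (∀ j, approxSeminorm V (ballFreq d M₁) s (toL2 (ψ j)) < ∞) →
      ∃ C : ℝ, 0 ≤ C ∧ ∀ M₀ ≥ M₁, ∀ (tol : ℝ) (n : ℕ) (𝔾 : ℕ → Finset (Freq d))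
        (u : ℕ → Fin N → L2 d) (rt : ℕ → Fin N → Freq d → ℂ) (δ : ℕ → Finset (Freq d)),
        IsAdaptiveRun V k₀ N θ ζ tol M₀ n 𝔾 u rt δ →
        (∀ j < n, ∀ δ' : Finset (Freq d), IsDorfler (rt j) θ (𝔾 j) δ' →
          (δ j).card ≤ δ'.card) →
        (𝔾 0).card < (𝔾 n).card →
        pwDist ψ (𝔾 n) ≤ C * (((𝔾 n).card : ℝ) - (𝔾 0).card) ^ (-s) := by
  have hb : 0 < max b 1 := lt_max_of_lt_right one_pos
  have hmin : 0 < min a 1 := lt_min ha one_pos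
  set ξ := (θ - ζ) / (1 + ζ) * (√(min a 1) / √(max b 1)) with hξ
  have hξ0 : 0 < ξ := by
    have h1 : 0 < θ - ζ := sub_pos.2 hζθ
    have h2 := Real.sqrt_pos.2 hmin
    have h3 := Real.sqrt_pos.2 hb
    positivity
  set σ := √(1 - ξ ^ 2) with hσ
  have hσ0 : 0 ≤ σ := Real.sqrt_nonneg _
  have hσ1 : σ < 1 := by
    rw [hσ, Real.sqrt_lt' one_pos]
    nlinarith [pow_pos hξ0 2]
  -- a comparison accurate enough that the contraction survives
  obtain ⟨M, hM⟩ := hcl.exists_comparison hV hr hψ (κ := (1 - σ) / 20) (by linarith) (by linarith)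
  refine ⟨M, fun M₁ hM₁ happ => ?_⟩
  obtain ⟨C, hC0, hC⟩ := exists_halving hs happ
  set ρ := σ + 5 * ((1 - σ) / 20) with hρ
  have hρ0 : 0 ≤ ρ := by rw [hρ]; linarith
  have hρ1 : ρ < 1 := by rw [hρ]; linarith
  have hs' : 0 < s⁻¹ := inv_pos.2 hs
  have hγ0 : 0 ≤ ρ ^ s⁻¹ := Real.rpow_nonneg hρ0 _
  have hγ1 : ρ ^ s⁻¹ < 1 := Real.rpow_lt_one hρ0 hρ1 hs'
  have hB : 0 ≤ ρ ^ s⁻¹ * C / (1 - ρ ^ s⁻¹) :=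
    div_nonneg (mul_nonneg hγ0 hC0) (sub_nonneg.2 hγ1.le)
  refine ⟨(ρ ^ s⁻¹ * C / (1 - ρ ^ s⁻¹)) ^ s, Real.rpow_nonneg hB _, ?_⟩
  intro M₀ hM₀ tol n 𝔾 u rt δ hrun hminimal hcard
  have hsub : ∀ j ≤ n, ballFreq d M₁ ⊆ 𝔾 j := fun j hj =>
    (ballFreq_mono hM₀).trans (hrun.ballFreq_subset hj)
  have hstep := fun j (hj : j < n) => hrun.step hV ha hab hζ.le hζθ.le hθζ (ψ := ψ)
    (κ := (1 - σ) / 20) (by linarith) (by linarith) le_rfl hσ1.le hj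
    (hM (𝔾 j) ((ballFreq_mono hM₁).trans (hsub j hj.le)))
  refine le_rpow_of_mul_rpow_inv_le (sub_pos.2 (by exact_mod_cast hcard)) (pwDist_nonneg _ _)
    hB hs (hrun.card_mul_le (y := fun j => pwDist ψ (𝔾 j) ^ s⁻¹) hγ0 hγ1 hC0 (fun j hj => ?_)
      (fun j hj => ?_) n le_rfl).1
  · rw [← Real.mul_rpow hρ0 (pwDist_nonneg _ _)]
    exact Real.rpow_le_rpow (pwDist_nonneg _ _) (hstep j hj).1 hs'.le
  · obtain ⟨𝔾', h1, h2, h3, h4⟩ := hC (𝔾 j) (hsub j hj.le) (hrun.isSymm hj.le)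
    refine le_trans (mul_le_mul_of_nonneg_right ?_ (Real.rpow_nonneg (pwDist_nonneg _ _) _)) h4
    exact_mod_cast hminimal j hj _ ((hstep j hj).2 𝔾' h1 h2 h3)

end

end PlaneWave

theorem mainTheorem4 {d : ℕ} (hd : 1 ≤ d)
    (σ : ℝ) (hσ : (d : ℝ) / 2 < σ)
    (V : C(Torus d, ℝ)) (hV : fourierCoef (fun x => (V x : ℂ)) ∈ Hp d σ)
    (νlo νhi : ℝ) (hν : 0 < νlo) (hVν : ∀ x, νlo ≤ V x ∧ V x ≤ νhi)
    (k₀ N m : ℕ) (Λ : Fin m → ℝ) (q : Fin m → ℕ) (hcl : IsCluster V k₀ N m Λ q)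
    (r : Fin m → ℝ)
    (hr : ∀ i, 0 < r i ∧
      ∀ μ : ℝ, eigenspace V (H1 d) μ ≠ ⊥ → μ ≠ Λ i → r i < |μ⁻¹ - (Λ i)⁻¹|)
    (s : ℝ) (hs : 0 < s)
    (θ ζ : ℝ)
    (hθ : 0 < θ ∧ θ < √(min νlo 1 / (3 * max νhi 1)))
    (hζ : 0 < ζ ∧ ζ < (√(min νlo 1 / (3 * max νhi 1)) - θ) /
      (1 + √(min νlo 1 / (3 * max νhi 1))))
    (hζθ : ζ < θ) :
    ∃ Mstar : ℕ, ∃ C : ℝ, 0 < C ∧ ∀ M₀ : ℕ, Mstar ≤ M₀ →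
      (∀ i, (eigenspace V (H1 d) (Λ i) : Set (L2 d)) ⊆ approxClass V (ballFreq d M₀) s) →
      ∀ U : (i : Fin m) → Fin (q i) → L2 d,
      (∀ i, Orthonormal ℂ (U i) ∧
        Submodule.span ℝ (Set.range (U i)) = eigenspace V (H1 d) (Λ i)) →
      ∀ tol : ℝ, 0 ≤ tol → tol < 1 →
      ∀ (n : ℕ) (𝔾 : ℕ → Finset (Freq d)) (u : ℕ → Fin N → L2 d)
        (rt : ℕ → Fin N → Freq d → ℂ) (δ : ℕ → Finset (Freq d)),
      IsAdaptiveRun V k₀ N θ ζ tol M₀ n 𝔾 u rt δ →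
      (∀ j < n, ∀ δ' : Finset (Freq d), IsDorfler (rt j) θ (𝔾 j) δ' → (δ j).card ≤ δ'.card) →
      (𝔾 0).card < (𝔾 n).card →
      projError V Λ r U (𝔾 n) ≤ C * (((𝔾 n).card : ℝ) - (𝔾 0).card) ^ (-s) ∧
      ∀ (i : Fin m) (l : Fin (q i)),
        eigenvalue V (VG (𝔾 n)) (k₀ + offset q i + l + 1) - Λ i ≤
          C * (((𝔾 n).card : ℝ) - (𝔾 0).card) ^ (-2 * s) := by
  have hVpos : ∀ x, 0 < V x := fun x => hν.trans_le (hVν x).1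
  obtain ⟨ψ, hψ⟩ := hcl.exists_eigenFamily hVpos
  obtain ⟨Ce, hCe0, M₁, hM₁⟩ := hcl.exists_error_bounds hr hψ
  have hθζ : ζ * (1 + √(min νlo 1 / (3 * max νhi 1))) ≤ √(min νlo 1 / (3 * max νhi 1)) - θ :=
    ((lt_div_iff₀ (by positivity)).1 hζ.2).le
  obtain ⟨M₂, hM₂⟩ := hcl.exists_pwDist_le hVpos hr hψ hν hVν hζ.1 hζθ hθζ hs
  -- The constant depends on the approximation seminorms of the eigenfunctions. It is taken from one
  -- sufficiently large radius `M` for which they are finite, and serves all larger radii as well,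
  -- since index sets that contain the larger ball contain `𝔾^M`. If there is no such `M`, then no
  -- sufficiently large initial ball satisfies the hypothesis.
  by_cases hex : ∃ M ≥ max M₁ M₂,
      ∀ i, (eigenspace V (H1 d) (Λ i) : Set (L2 d)) ⊆ approxClass V (ballFreq d M) s
  swap
  · exact ⟨max M₁ M₂, 1, one_pos, fun M₀ hM₀ happ => absurd ⟨M₀, hM₀, happ⟩ hex⟩
  obtain ⟨M, hM, happ⟩ := hex
  obtain ⟨C, hC0, hC⟩ := hM₂ M (le_of_max_le_right hM) fun j =>
    (happ j.1 (toL2_mem_eigenspace_H1.2 (hψ.mem j))).2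
  refine ⟨M, Ce * C + Ce * C ^ 2 + 1, by positivity, ?_⟩
  intro M₀ hM₀ _ U hU tol _ _ n 𝔾 u rt δ hrun hminimal hcard
  have hD := hC M₀ hM₀ tol n 𝔾 u rt δ hrun hminimal hcard
  obtain ⟨w, -, hw⟩ := hrun.exists_galerkin hVpos le_rfl
  obtain ⟨hE, hL⟩ := hM₁ (𝔾 n) ((ballFreq_mono ((le_of_max_le_left hM).trans hM₀)).trans
    (hrun.ballFreq_subset le_rfl)) (hrun.isSymm le_rfl) w hw
  have hX : (0 : ℝ) < ((𝔾 n).card : ℝ) - (𝔾 0).card := sub_pos.2 (by exact_mod_cast hcard)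
  set X : ℝ := ((𝔾 n).card : ℝ) - (𝔾 0).card
  have hXs : 0 < X ^ (-s) := Real.rpow_pos_of_pos hX _
  have hXs2 : X ^ (-2 * s) = (X ^ (-s)) ^ 2 := by
    rw [← Real.rpow_natCast, ← Real.rpow_mul hX.le]
    congr 1
    push_cast
    ring
  refine ⟨(hE U hU).trans ?_, fun i l => (hL i l).trans ?_⟩
  · calc Ce * pwDist ψ (𝔾 n) ≤ Ce * (C * X ^ (-s)) := by gcongr
      _ = Ce * C * X ^ (-s) := by ring
      _ ≤ (Ce * C + Ce * C ^ 2 + 1) * X ^ (-s) := by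
          gcongr
          nlinarith [mul_nonneg hCe0 (sq_nonneg C)]
  · rw [hXs2]
    have hD0 := pwDist_nonneg ψ (𝔾 n)
    calc Ce * pwDist ψ (𝔾 n) ^ 2 ≤ Ce * (C * X ^ (-s)) ^ 2 := by gcongr
      _ = Ce * C ^ 2 * (X ^ (-s)) ^ 2 := by ring
      _ ≤ (Ce * C + Ce * C ^ 2 + 1) * (X ^ (-s)) ^ 2 := by
          gcongr
          nlinarith [mul_nonneg hCe0 hC0]
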